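/- **Setting.** Let $c\in\mathbb C\setminus\{0\}$ and $$g(x,y)=\frac{c}{x-y},\qquad f(x,y)=\frac{x-y+c}{x-y},\qquad h(x,y)=\frac{x-y+c}{c}.$$ Put $[1]=[2]=0$, $[3]=1$. Let $T_{ij}(u)$ ($1\le i,j\le 3$, $u\in D\subseteq\mathbb C$) be linear operators on a complex vector space $\mathcal H$ which are the entries of a monodromy matrix with $\mathfrak{gl}(2|1)$ symmetry, i.e. for all $u\ne v$ in $D$ and all $i,j,k,l$ $$T_{ij}(u)T_{kl}(v)-(-1)^{([i]+[j])([k]+[l])}T_{kl}(v)T_{ij}(u)=(-1)^{[i]([k]+[l])+[k][l]}g(u,v)\bigl(T_{kj}(v)T_{il}(u)-T_{kj}(u)T_{il}(v)\bigr).$$ Let $\Omega\in\mathcal H$ be a pseudovacuum, $T_{ii}(u)\Omega=\lambda_i(u)\Omega$ and $T_{ij}(u)\Omega=0$ for $i>j$, and let $\Omega^\dagger$ be a dual pseudovacuum, a linear functional on $\mathcal H$ with $\Omega^\dagger T_{ii}(u)=\lambda_i(u)\Omega^\dagger$ and $\Omega^\dagger T_{ij}(u)=0$ for $i<j$, with the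 same functions $\lambda_i$. **Notation.** For sets of variables, $g,f,h$ and $\lambda_2$ denote the products over the sets, e.g. $f(\bar u,\bar v)=\prod_{j,k}f(u_j,v_k)$, $\lambda_2(\bar v)=\prod_k\lambda_2(v_k)$; likewise $T_{ij}(\bar u)=\prod_k T_{ij}(u_k)$ when $[i]+[j]$ is even. For $\bar v=\{v_1,\dots,v_n\}$ and $j,k\in\{1,2\}$ put $$\mathbb T_{j3}(\bar v)=\frac{T_{j3}(v_1)\cdots T_{j3}(v_n)}{\prod_{n\ge\ell>m\ge1}h(v_\ell,v_m)},\qquad \mathbb T_{3k}(\bar v)=\frac{T_{3k}(v_1)\cdots T_{3k}(v_n)}{\prod_{n\ge\ell>m\ge1}h(v_m,v_\ell)} .$$ For $\#\bar x=\#\bar y=n$ the domain wall partition function is $$K(\bar x|\bar y)=\prod_{j<k}g(x_j,x_k)\prod_{j>k}g(y_j,y_k)\;h(\bar x,\bar y)\;\det_n\left(\frac{g(x_j,y_k)}{h(x_j,y_k)}\right),\qquad K(\emptyset|\emptyset)=1 .$$ All sums below run over all partitions $\bar u\Rightarrow\{\bar u_\alpha,\bar u_{\bar\alpha}\}$ and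 $\bar v\Rightarrow\{\bar v_\alpha,\bar v_{\bar\alpha}\}$ with $\#\bar u_\alpha=\#\bar v_\alpha$ (subsets keep the natural order). **Bethe vectors.** For $\bar u=\{u_1,\dots,u_a\}$, $\bar v=\{v_1,\dots,v_b\}$ in $D$ let $$X_{a,b}(\bar u,\bar v)=\sum g(\bar v_\alpha,\bar u_\alpha)f(\bar u_\alpha,\bar u_{\bar\alpha})g(\bar v_{\bar\alpha},\bar v_\alpha)h(\bar u_\alpha,\bar u_\alpha)\,\mathbb T_{13}(\bar u_\alpha)T_{12}(\bar u_{\bar\alpha})\mathbb T_{23}(\bar v_{\bar\alpha})T_{22}(\bar v_\alpha).$$ The Bethe vector is $\Phi_{a,b}(\bar u,\bar v)=X_{a,b}(\bar u,\bar v)\Omega$. Let $\psi$ be the linear map of the algebra generated by the $T_{ij}(u)$ with the above relations that is determined by $\psi(1)=1$, $\psi(T_{ij}(u))=(-1)^{[i][j]+[i]}T_{ji}(u)$ and $\psi(xy)=(-1)^{[x][y]}\psi(y)\psi(x)$ for homogeneous $x,y$, where $T_{ij}$ has parity $[i]+[j]$. The dual Bethe vector is $\Phi^\dagger_{a,b}(\bar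 u,\bar v)=\Omega^\dagger\,\psi\bigl(X_{a,b}(\bar u,\bar v)\bigr)$. **Claim.** Let $a,b\ge0$ and suppose that $u_1,\dots,u_a,v_1,\dots,v_b$ are pairwise distinct, and that $h(u_j,u_k)\ne0$ and $h(v_j,v_k)\neq 0$ for $j\ne k$, and $h(v_j,u_k)\ne0$ for all $j,k$. Then $$\Phi_{a,b}(\bar u,\bar v)=\sum g(\bar v_\alpha,\bar u_\alpha)f(\bar u_{\bar\alpha},\bar u_\alpha)g(\bar v_{\bar\alpha},\bar v_\alpha)f(\bar v_\alpha,\bar u_{\bar\alpha})h(\bar u_\alpha,\bar u_\alpha)\lambda_2(\bar v_\alpha)\;T_{12}(\bar u_{\bar\alpha})\,\mathbb T_{13}(\bar u_\alpha)\,\mathbb T_{23}(\bar v_{\bar\alpha})\,\Omega,$$ $$\Phi_{a,b}(\bar u,\bar v)=\sum K(\bar v_\alpha|\bar u_\alpha)f(\bar u_\alpha,\bar u_{\bar\alpha})g(\bar v_\alpha,\bar v_{\bar\alpha})f(\bar v_{\bar\alpha},\bar u_\alpha)\lambda_2(\bar u_\alpha)\;\mathbb T_{23}(\bar v_{\bar\alpha})\,\mathbb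 T_{13}(\bar v_\alpha)\,T_{12}(\bar u_{\bar\alpha})\,\Omega,$$ and, for the dual Bethe vectors, $$\Phi^\dagger_{a,b}(\bar u,\bar v)=(-1)^{b(b-1)/2}\sum g(\bar v_\alpha,\bar u_\alpha)f(\bar u_{\bar\alpha},\bar u_\alpha)g(\bar v_{\bar\alpha},\bar v_\alpha)f(\bar v_\alpha,\bar u_{\bar\alpha})h(\bar u_\alpha,\bar u_\alpha)\lambda_2(\bar v_\alpha)\;\Omega^\dagger\,\mathbb T_{32}(\bar v_{\bar\alpha})\,\mathbb T_{31}(\bar u_\alpha)\,T_{21}(\bar u_{\bar\alpha}),$$ $$\Phi^\dagger_{a,b}(\bar u,\bar v)=(-1)^{b(b-1)/2}\sum K(\bar v_\alpha|\bar u_\alpha)f(\bar u_\alpha,\bar u_{\bar\alpha})g(\bar v_\alpha,\bar v_{\bar\alpha})f(\bar v_{\bar\alpha},\bar u_\alpha)\lambda_2(\bar u_\alpha)\;\Omega^\dagger\,T_{21}(\bar u_{\bar\alpha})\,\mathbb T_{31}(\bar v_\alpha)\,\mathbb T_{32}(\bar v_{\bar\alpha}).$$ -/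

import Mathlib

namespace GL21

noncomputable section

/-! ### Scalar functions -/

/-- The rational function `g(x,y) = c / (x - y)`. -/
def g (c x y : ℂ) : ℂ := c / (x - y)

/-- The rational function `f(x,y) = (x - y + c) / (x - y)`. -/
def f (c x y : ℂ) : ℂ := (x - y + c) / (x - y)

/-- The rational function `h(x,y) = (x - y + c) / c`. -/
def h (c x y : ℂ) : ℂ := (x - y + c) / c

/-- The domain wall partition function `K(x|y)` of two sets of `n` variables, by its determinant
representation; for `n = 0` all products and the determinant are `1`. -/
def K (c : ℂ) {n : ℕ} (x y : Fin n → ℂ) : ℂ :=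
  (∏ j, ∏ k ∈ Finset.Ioi j, g c (x j) (x k)) * (∏ j, ∏ k ∈ Finset.Iio j, g c (y j) (y k)) *
    (∏ j, ∏ k, h c (x j) (y k)) *
    Matrix.det (Matrix.of fun j k : Fin n => g c (x j) (y k) / h c (x j) (y k))

/-! ### Monodromy matrices -/

/-- The parity of the basis vectors of `ℂ^{2|1}`: the indices `0, 1, 2` of `Fin 3` stand for
`1, 2, 3`, and only the last one is odd. -/
def par : Fin 3 → ℕ := ![0, 0, 1]

variable {D : Set ℂ} {A : Type*} [Ring A] [Algebra ℂ A]

/-- `T i j u` are the entries of a monodromy matrix with `gl(2|1)` symmetry, defined for the values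
of the spectral parameter in `D`: the graded commutator of `T_{ij}(u)` and `T_{kl}(v)` equals
`(-1)^{[i]([k]+[l])+[k][l]} g(u,v) (T_{kj}(v) T_{il}(u) - T_{kj}(u) T_{il}(v))`. -/
def IsMonodromy (c : ℂ) (T : Fin 3 → Fin 3 → D → A) : Prop :=
  ∀ (i j k l : Fin 3) (u v : D), u ≠ v →
    T i j u * T k l v - (-1 : ℂ) ^ ((par i + par j) * (par k + par l)) • (T k l v * T i j u) =
      ((-1 : ℂ) ^ (par i * (par k + par l) + par k * par l) * g c u v) •
        (T k j v * T i l u - T k j u * T i l v)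

/-- Product of the `t (x k)`, `k ∈ S`, in the natural order. -/
def opProd {n : ℕ} (t : D → A) (x : Fin n → D) (S : Finset (Fin n)) : A :=
  ((S.sort (· ≤ ·)).map fun k => t (x k)).prod

/-- Symmetrised product of the odd operators `T_{j3}` over the variables `x k`, `k ∈ S`. -/
def opProdCol (c : ℂ) {n : ℕ} (t : D → A) (x : Fin n → D) (S : Finset (Fin n)) : A :=
  (∏ l ∈ S, ∏ m ∈ S with m < l, h c (x l) (x m))⁻¹ • opProd t x S

/-- Symmetrised product of the odd operators `T_{3k}` over the variables `x k`, `k ∈ S`. -/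
def opProdRow (c : ℂ) {n : ℕ} (t : D → A) (x : Fin n → D) (S : Finset (Fin n)) : A :=
  (∏ l ∈ S, ∏ m ∈ S with m < l, h c (x m) (x l))⁻¹ • opProd t x S

/-- Product of a two-variable function over two subsets of variables. -/
def fprod {m n : ℕ} (φ : ℂ → ℂ → ℂ) (x : Fin m → D) (S : Finset (Fin m)) (y : Fin n → D)
    (R : Finset (Fin n)) : ℂ :=
  ∏ j ∈ S, ∏ k ∈ R, φ (x j) (y k)

/-- The pairs of partitions `ū ⇒ {ū_α, ū_ᾱ}`, `v̄ ⇒ {v̄_α, v̄_ᾱ}` with `#ū_α = #v̄_α`, given by the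
index sets of `ū_α` and `v̄_α`. The complementary subsets have the complementary index sets. -/
abbrev Part (a b : ℕ) : Type :=
  {p : Finset (Fin a) × Finset (Fin b) // p.2.card = p.1.card}

/-- Index set of `ū_α`. -/
abbrev Part.U {a b : ℕ} (p : Part a b) : Finset (Fin a) := p.1.1

/-- Index set of `v̄_α`. -/
abbrev Part.V {a b : ℕ} (p : Part a b) : Finset (Fin b) := p.1.2

/-- `K(v̄_α | ū_α)`. -/
def Kpart (c : ℂ) {a b : ℕ} (u : Fin a → D) (v : Fin b → D) (p : Part a b) : ℂ :=
  K c (fun j => (v (p.V.orderEmbOfFin p.2 j) : ℂ)) (fun j => (u (p.U.orderEmbOfFin rfl j) : ℂ))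

/-- The operator
`X_{a,b}(ū,v̄) = ∑ g(v̄_α,ū_α) f(ū_α,ū_ᾱ) g(v̄_ᾱ,v̄_α) h(ū_α,ū_α) 𝕋₁₃(ū_α) T₁₂(ū_ᾱ) 𝕋₂₃(v̄_ᾱ) T₂₂(v̄_α)`. -/
def X (c : ℂ) (T : Fin 3 → Fin 3 → D → A) {a b : ℕ} (u : Fin a → D) (v : Fin b → D) : A :=
  ∑ p : Part a b,
    (fprod (g c) v p.V u p.U * fprod (f c) u p.U u p.Uᶜ * fprod (g c) v p.Vᶜ v p.V *
        fprod (h c) u p.U u p.U) •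
      (opProdCol c (T 0 2) u p.U * opProd (T 0 1) u p.Uᶜ * opProdCol c (T 1 2) v p.Vᶜ *
        opProd (T 1 1) v p.V)

/-! ### The algebra of monodromy matrix entries and its antimorphism -/

/-- The defining relations of the algebra generated by the `T_{ij}(u)`, `u ∈ D`. -/
inductive RTTRel (c : ℂ) (D : Set ℂ) :
    FreeAlgebra ℂ (Fin 3 × Fin 3 × D) → FreeAlgebra ℂ (Fin 3 × Fin 3 × D) → Prop
  | comm (i j k l : Fin 3) (u v : D) (huv : u ≠ v) : RTTRel c D
      (FreeAlgebra.ι ℂ (i, j, u) * FreeAlgebra.ι ℂ (k, l, v) -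
        (-1 : ℂ) ^ ((par i + par j) * (par k + par l)) •
          (FreeAlgebra.ι ℂ (k, l, v) * FreeAlgebra.ι ℂ (i, j, u)))
      (((-1 : ℂ) ^ (par i * (par k + par l) + par k * par l) * g c u v) •
        (FreeAlgebra.ι ℂ (k, j, v) * FreeAlgebra.ι ℂ (i, l, u) -
          FreeAlgebra.ι ℂ (k, j, u) * FreeAlgebra.ι ℂ (i, l, v)))

/-- The algebra generated by the `T_{ij}(u)`, `u ∈ D`, subject to the commutation relations of
`IsMonodromy`. -/
abbrev RTTAlgebra (c : ℂ) (D : Set ℂ) : Type := RingQuot (RTTRel c D)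

/-- The generators `T_{ij}(u)` of the algebra. -/
def gen (c : ℂ) (D : Set ℂ) (i j : Fin 3) (u : D) : RTTAlgebra c D :=
  RingQuot.mkAlgHom ℂ (RTTRel c D) (FreeAlgebra.ι ℂ (i, j, u))

theorem isMonodromy_gen (c : ℂ) (D : Set ℂ) : IsMonodromy c (gen c D) := by
  intro i j k l u v huv
  have := RingQuot.mkAlgHom_rel ℂ (RTTRel.comm (c := c) i j k l u v huv)
  simp only [map_sub, map_mul, map_smul] at this
  exact this

/-- The representation of the algebra defined by a monodromy matrix. -/
def lift (c : ℂ) (T : Fin 3 → Fin 3 → D → A) (hT : IsMonodromy c T) : RTTAlgebra c D →ₐ[ℂ] A :=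
  RingQuot.liftAlgHom ℂ ⟨FreeAlgebra.lift ℂ fun x => T x.1 x.2.1 x.2.2, by
    rintro _ _ ⟨i, j, k, l, u, v, huv⟩
    simpa only [map_sub, map_mul, map_smul, FreeAlgebra.lift_ι_apply] using hT i j k l u v huv⟩

@[simp] theorem lift_gen (c : ℂ) (T : Fin 3 → Fin 3 → D → A) (hT : IsMonodromy c T)
    (i j : Fin 3) (u : D) : lift c T hT (gen c D i j u) = T i j u := by
  simp [lift, gen]

theorem g_swap (c x y : ℂ) : g c x y = -g c y x := by
  rw [g, g, ← neg_sub y x, div_neg]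

/-- The second form of the commutation relations. -/
theorem IsMonodromy.swap {c : ℂ} {T : Fin 3 → Fin 3 → D → A} (hT : IsMonodromy c T)
    (i j k l : Fin 3) (u v : D) (huv : u ≠ v) :
    T i j u * T k l v - (-1 : ℂ) ^ ((par i + par j) * (par k + par l)) • (T k l v * T i j u) =
      ((-1 : ℂ) ^ (par l * (par i + par j) + par i * par j) * g c u v) •
        (T i l u * T k j v - T i l v * T k j u) := by
  have H := congrArg (fun z => -(-1 : ℂ) ^ ((par i + par j) * (par k + par l)) • z)
    (hT k l i j v u huv.symm)
  have e1 : (-1 : ℂ) ^ ((par i + par j) * (par k + par l)) *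
      (-1 : ℂ) ^ ((par k + par l) * (par i + par j)) = 1 := by
    rw [mul_comm (par k + par l), ← mul_pow]; norm_num
  have e2 : (-1 : ℂ) ^ ((par i + par j) * (par k + par l)) *
      (-1 : ℂ) ^ (par k * (par i + par j) + par i * par j) =
      (-1 : ℂ) ^ (par l * (par i + par j) + par i * par j) := by
    rw [← pow_add, show (par i + par j) * (par k + par l) +
      (par k * (par i + par j) + par i * par j) =
      2 * (par k * (par i + par j)) + (par l * (par i + par j) + par i * par j) by ring, pow_add,
      pow_mul]
    norm_num
  simp only [smul_sub, smul_smul, neg_mul, e1, ← mul_assoc, e2, neg_smul, one_smul] at H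
  rw [g_swap c v u] at H
  simp only [mul_neg, neg_smul, neg_neg] at H
  rw [smul_sub, ← H]
  abel

/-- The parity automorphism `T_{ij}(u) ↦ (-1)^{[i]+[j]} T_{ij}(u)`: it is `1` on the even part of
the algebra and `-1` on its odd part. -/
def parityAut (c : ℂ) (D : Set ℂ) : RTTAlgebra c D →ₐ[ℂ] RTTAlgebra c D :=
  lift c (fun i j u => (-1 : ℂ) ^ (par i + par j) • gen c D i j u) (by
    intro i j k l u v huv
    have H := congrArg (fun z => (-1 : ℂ) ^ (par i + par j + (par k + par l)) • z)
      (isMonodromy_gen c D i j k l u v huv)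
    simp only [smul_sub, smul_smul, smul_mul_smul_comm, ← pow_add] at H ⊢
    convert H using 3 <;> ring)

/-- The factors of the ordinary antimorphism behind `psi`. -/
def kap (i j : Fin 3) : ℂ :=
  Complex.I ^ ((par i + par j) ^ 2) * (-1) ^ (par i * par j + par i)

/-- The ordinary antimorphism `T_{ij}(u) ↦ ε (-1)^{[i][j]+[i]} T_{ji}(u)`, where `ε` is `1` or the
imaginary unit when `T_{ij}` is even or odd. -/
def antiHom (c : ℂ) (D : Set ℂ) : RTTAlgebra c D →ₐ[ℂ] (RTTAlgebra c D)ᵐᵒᵖ :=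
  lift c (fun i j u => MulOpposite.op (kap i j • gen c D j i u)) (by
    intro i j k l u v huv
    apply MulOpposite.unop_injective
    have H := congrArg (fun z => (kap i j * kap k l) • z)
      ((isMonodromy_gen c D).swap l k j i v u huv.symm)
    have e : kap i j * kap k l * (-1 : ℂ) ^ (par i * (par l + par k) + par l * par k) =
        (-1 : ℂ) ^ (par i * (par k + par l) + par k * par l) * (kap k j * kap i l) := by
      simp only [kap]
      fin_cases i <;> fin_cases j <;> fin_cases k <;> fin_cases l <;> norm_num [par]
    have e2 : (par l + par k) * (par j + par i) = (par i + par j) * (par k + par l) := by ring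
    rw [e2] at H
    simp only [smul_sub, smul_smul, smul_mul_smul_comm, MulOpposite.unop_sub,
      MulOpposite.unop_smul, MulOpposite.unop_mul, MulOpposite.unop_op] at H ⊢
    rw [← mul_assoc (kap i j * kap k l), e, g_swap c v u] at H
    convert H using 1
    · rw [mul_comm (kap k l), mul_comm ((-1 : ℂ) ^ _)]
    · rw [mul_comm (kap i l)]
      simp only [mul_neg, neg_smul]
      rw [mul_right_comm, sub_neg_eq_add, neg_add_eq_sub])

/-- The antimorphism `ψ` of the algebra. It is characterised by `psi_gen`, `psi_one` and
`psi_mul`. -/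
def psi (c : ℂ) (D : Set ℂ) : RTTAlgebra c D →ₗ[ℂ] RTTAlgebra c D :=
  (MulOpposite.opLinearEquiv ℂ).symm.toLinearMap ∘ₗ (antiHom c D).toLinearMap ∘ₗ
    ((1 / 2 : ℂ) • (LinearMap.id + (parityAut c D).toLinearMap) -
      (Complex.I / 2) • (LinearMap.id - (parityAut c D).toLinearMap))

theorem psi_of_parity (c : ℂ) (D : Set ℂ) {p : ℕ} (hp : p < 2) {x : RTTAlgebra c D}
    (hx : parityAut c D x = (-1 : ℂ) ^ p • x) :
    psi c D x = (-Complex.I) ^ p • (antiHom c D x).unop := by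
  have h0 : psi c D x = (antiHom c D ((1 / 2 : ℂ) • (x + parityAut c D x) -
      (Complex.I / 2) • (x - parityAut c D x))).unop := rfl
  rw [h0, hx]
  interval_cases p
  · rw [pow_zero, pow_zero, one_smul, one_smul, sub_self, smul_zero, sub_zero, ← two_smul ℂ x,
      smul_smul]
    norm_num
  · rw [pow_one, pow_one, neg_one_smul ℂ x, add_neg_cancel, smul_zero, zero_sub, sub_neg_eq_add,
      ← two_smul ℂ x, smul_smul, ← neg_smul, map_smul, MulOpposite.unop_smul]
    congr 1
    ring

theorem parityAut_gen (c : ℂ) (D : Set ℂ) (i j : Fin 3) (u : D) :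
    parityAut c D (gen c D i j u) = (-1 : ℂ) ^ (par i + par j) • gen c D i j u :=
  lift_gen c _ _ i j u

/-- `ψ(T_{ij}(u)) = (-1)^{[i][j]+[i]} T_{ji}(u)`. -/
theorem psi_gen (c : ℂ) (D : Set ℂ) (i j : Fin 3) (u : D) :
    psi c D (gen c D i j u) = (-1 : ℂ) ^ (par i * par j + par i) • gen c D j i u := by
  have hx : parityAut c D (gen c D i j u) =
      (-1 : ℂ) ^ ((par i + par j) % 2) • gen c D i j u := by
    rw [parityAut_gen, neg_one_pow_eq_pow_mod_two]
  rw [psi_of_parity c D (Nat.mod_lt _ two_pos) hx, show antiHom c D (gen c D i j u) =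
      MulOpposite.op (kap i j • gen c D j i u) from lift_gen c _ _ i j u, MulOpposite.unop_op,
    smul_smul]
  congr 1
  fin_cases i <;> fin_cases j <;> simp [par, kap]

theorem psi_one (c : ℂ) (D : Set ℂ) : psi c D 1 = 1 := by
  rw [psi_of_parity c D (p := 0) two_pos (by simp)]
  simp

/-- `ψ(x y) = (-1)^{[x][y]} ψ(y) ψ(x)` for `x`, `y` of parities `p`, `q`. -/
theorem psi_mul (c : ℂ) (D : Set ℂ) {p q : ℕ} (hp : p < 2) (hq : q < 2) {x y : RTTAlgebra c D}
    (hx : parityAut c D x = (-1 : ℂ) ^ p • x) (hy : parityAut c D y = (-1 : ℂ) ^ q • y) :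
    psi c D (x * y) = (-1 : ℂ) ^ (p * q) • (psi c D y * psi c D x) := by
  have hxy : parityAut c D (x * y) = (-1 : ℂ) ^ ((p + q) % 2) • (x * y) := by
    rw [map_mul, hx, hy, smul_mul_smul_comm, ← pow_add, neg_one_pow_eq_pow_mod_two]
  rw [psi_of_parity c D (Nat.mod_lt _ two_pos) hxy, psi_of_parity c D hp hx,
    psi_of_parity c D hq hy, map_mul, MulOpposite.unop_mul, smul_mul_smul_comm, smul_smul]
  congr 1
  interval_cases p <;> interval_cases q <;> simp

/-! ### Pseudovacuum and Bethe vectors -/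

variable {H : Type*} [AddCommGroup H] [Module ℂ H]

/-- `Ω` is a pseudovacuum with vacuum eigenvalues `lam i`. -/
structure IsVacuum (T : Fin 3 → Fin 3 → D → Module.End ℂ H) (lam : Fin 3 → D → ℂ) (Ω : H) :
    Prop where
  diag : ∀ i u, T i i u Ω = lam i u • Ω
  lower : ∀ i j u, j < i → T i j u Ω = 0

/-- `Ω'` is a dual pseudovacuum with vacuum eigenvalues `lam i`; operators act on the dual space
from the right, by composition. -/
structure IsDualVacuum (T : Fin 3 → Fin 3 → D → Module.End ℂ H) (lam : Fin 3 → D → ℂ)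
    (Ω' : Module.Dual ℂ H) : Prop where
  diag : ∀ i u, Ω' ∘ₗ T i i u = lam i u • Ω'
  upper : ∀ i j u, i < j → Ω' ∘ₗ T i j u = 0

/-- The Bethe vector `Φ_{a,b}(ū,v̄) = X_{a,b}(ū,v̄) Ω`. -/
def bethe (c : ℂ) (T : Fin 3 → Fin 3 → D → Module.End ℂ H) (Ω : H) {a b : ℕ} (u : Fin a → D)
    (v : Fin b → D) : H :=
  X c T u v Ω

/-- The dual Bethe vector `Φ†_{a,b}(ū,v̄) = ψ(X_{a,b}(ū,v̄) Ω) = Ω† ψ(X_{a,b}(ū,v̄))`. -/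
def dualBethe (c : ℂ) (T : Fin 3 → Fin 3 → D → Module.End ℂ H) (hT : IsMonodromy c T)
    (Ω' : Module.Dual ℂ H) {a b : ℕ} (u : Fin a → D) (v : Fin b → D) : Module.Dual ℂ H :=
  Ω' ∘ₗ lift c T hT (psi c D (X c (gen c D) u v))

end

end GL21

namespace GL21

noncomputable section

variable {D : Set ℂ} {A : Type*} [Ring A] [Algebra ℂ A]

/-! ### Elementary properties of the scalar functions -/

/-! All expansions are identities for the operator X itself. The pseudovacuum enters only at the
end: each term has a product of T₂₂ on its right, which turns into λ₂. Products of the odd operators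
T_{i3}, normalised by h, do not depend on the order of the factors (`listProd_perm`). So X can be
written with finite sets U, V of spectral parameters, and the identities are proved by induction on
U.

For the ordering T₁₂, T₁₃, T₂₃ fix the subset β of V that feeds T₂₂; only the first-row part of X
changes. Write R(U, β) for either ordering of T₁₂ and T₁₃ (`rowL`, `rowR`). Both satisfy R(U ∪ u, β)
= T₁₂(u) R(U, β) + ∑_j r_j T₁₃(u) R(U, β \ j), by `rowL_insert` and `rowR_insert`, hence they
coincide (`rowL_eq_rowR`). Operators are moved with the usual formulas of the algebraic Bethe ansatz
(`mul_symProd_even`, `mul_symProd_odd`), and the coefficients match by partial fractions, that is,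
by Lagrange interpolation (`eval_mul_prod_g`).

For the ordering T₂₃, T₁₃, T₁₂ let L_z and R_z be the steps `recL` and `recR`. They add z to U by
multiplying with T₁₂(z) on the left or on the right, plus correction terms. The original form of X
is generated by left steps (`xOp_insert`). The reversed form is generated by right steps
(`revOp_insert`); this rests on the expansion of K in one of its variables (`Kf_insert`). It remains
to see that L_z X = R_z X (`recL_xOp_eq_recR_xOp`). If p is the last variable added, then L_z L_p X
= L_p L_z X = L_p R_z X = R_z L_p X. The outer equalities are `recL_recL_comm` and
`recL_recR_eq_recR_recL`, and the middle one is the induction hypothesis. For U = ∅ the claim is the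
commutation of T₁₂(z) with a product of T₂₃ (`recL_symProd_eq_recR_symProd`).

For the dual vectors, a factor i on odd generators turns the graded antimorphism ψ into an ordinary
one. Composed with transposition it gives a monodromy matrix on the dual space with Ω† as its
pseudovacuum (`isMonodromy_dualT`, `IsDualVacuum.isVacuum_dualT`). The dual formulas are the first
two for this matrix, and the powers of i combine to the sign (`I_pow_mul_neg_I_pow`). -/

theorem f_eq_one_add_g (c : ℂ) {x y : ℂ} (hxy : x ≠ y) : f c x y = 1 + g c x y := by
  have := sub_ne_zero.2 hxy
  rw [f, g]; field_simp

theorem f_eq_one_sub_g (c : ℂ) {x y : ℂ} (hxy : x ≠ y) : f c x y = 1 - g c y x := by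
  rw [f_eq_one_add_g c hxy, g_swap, sub_eq_add_neg]

theorem f_eq_g_mul_h {c : ℂ} (hc : c ≠ 0) (x y : ℂ) : f c x y = g c x y * h c x y := by
  rw [f, g, h]; field_simp

theorem g_ne_zero {c : ℂ} (hc : c ≠ 0) {x y : ℂ} (hxy : x ≠ y) : g c x y ≠ 0 :=
  div_ne_zero hc (sub_ne_zero.2 hxy)

@[simp] theorem h_self {c : ℂ} (hc : c ≠ 0) (x : ℂ) : h c x x = 1 := by
  rw [h, sub_self, zero_add, div_self hc]

theorem g_mul_g (c : ℂ) {x y z : ℂ} (hxy : x ≠ y) (hxz : x ≠ z) (hyz : y ≠ z) :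
    g c x z * g c y z = g c x z * g c y x + g c y z * g c x y := by
  have h1 := sub_ne_zero.2 hxy
  have h2 := sub_ne_zero.2 hxz
  have h3 := sub_ne_zero.2 hyz
  have h4 := sub_ne_zero.2 hxy.symm
  simp only [g]
  field_simp
  ring

theorem val_ne {x y : D} (hxy : x ≠ y) : (x : ℂ) ≠ y := fun e => hxy (Subtype.ext e)

/-! ### Commutation relations -/

namespace IsMonodromy

variable {c : ℂ} {T : Fin 3 → Fin 3 → D → A}

theorem T01_mul_T02 (hT : IsMonodromy c T) {x y : D} (hxy : x ≠ y) :
    T 0 1 x * T 0 2 y =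
      f c y x • (T 0 2 y * T 0 1 x) + g c x y • (T 0 2 x * T 0 1 y) := by
  have H := hT.swap 0 1 0 2 x y hxy
  simp [par] at H
  rw [f_eq_one_sub_g c (val_ne hxy.symm), sub_eq_iff_eq_add.1 H]
  module

theorem T02_mul_T01 (hT : IsMonodromy c T) {x y : D} (hxy : x ≠ y) :
    T 0 2 x * T 0 1 y =
      f c y x • (T 0 1 y * T 0 2 x) + g c x y • (T 0 1 x * T 0 2 y) := by
  have H := hT.swap 0 2 0 1 x y hxy
  simp [par] at H
  rw [f_eq_one_sub_g c (val_ne hxy.symm), sub_eq_iff_eq_add.1 H]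
  module

theorem T11_mul_T12 (hT : IsMonodromy c T) {x y : D} (hxy : x ≠ y) :
    T 1 1 x * T 1 2 y =
      f c y x • (T 1 2 y * T 1 1 x) + g c x y • (T 1 2 x * T 1 1 y) := by
  have H := hT.swap 1 1 1 2 x y hxy
  simp [par] at H
  rw [f_eq_one_sub_g c (val_ne hxy.symm), sub_eq_iff_eq_add.1 H]
  module

theorem T11_mul_T01 (hT : IsMonodromy c T) {x y : D} (hxy : x ≠ y) :
    T 1 1 x * T 0 1 y =
      f c x y • (T 0 1 y * T 1 1 x) + g c y x • (T 0 1 x * T 1 1 y) := by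
  have H := hT 1 1 0 1 x y hxy
  simp [par] at H
  rw [f_eq_one_sub_g c (val_ne hxy), g_swap c y x]
  rw [sub_eq_iff_eq_add.1 H]
  module

theorem T02_mul_T12 (hT : IsMonodromy c T) {x y : D} (hxy : x ≠ y) :
    T 0 2 x * T 1 2 y =
      -(f c y x • (T 1 2 y * T 0 2 x) + g c x y • (T 1 2 x * T 0 2 y)) := by
  have H := hT 0 2 1 2 x y hxy
  simp [par] at H
  rw [f_eq_one_sub_g c (val_ne hxy.symm), eq_sub_of_add_eq H]
  module

theorem T12_mul_T02 (hT : IsMonodromy c T) {x y : D} (hxy : x ≠ y) :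
    T 1 2 x * T 0 2 y =
      -(f c y x • (T 0 2 y * T 1 2 x) + g c x y • (T 0 2 x * T 1 2 y)) := by
  have H := hT 1 2 0 2 x y hxy
  simp [par] at H
  rw [f_eq_one_sub_g c (val_ne hxy.symm), eq_sub_of_add_eq H]
  module

theorem T01_mul_T12 (hT : IsMonodromy c T) {x y : D} (hxy : x ≠ y) :
    T 0 1 x * T 1 2 y =
      T 1 2 y * T 0 1 x + g c x y • (T 0 2 x * T 1 1 y - T 0 2 y * T 1 1 x) := by
  have H := hT.swap 0 1 1 2 x y hxy
  simp [par] at H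
  rw [sub_eq_iff_eq_add.1 H]
  module

theorem even_comm (hT : IsMonodromy c T) (i j : Fin 3) (hij : par i = par j) (x y : D) :
    T i j x * T i j y = T i j y * T i j x := by
  rcases eq_or_ne x y with rfl | hxy
  · rfl
  have H := hT i j i j x y hxy
  have H' := hT i j i j y x hxy.symm
  have e : (-1 : ℂ) ^ ((par i + par j) * (par i + par j)) = 1 := by
    rw [hij, ← two_mul, mul_assoc, pow_mul]; norm_num
  rw [e, one_smul] at H H'
  rw [g_swap c y x] at H'
  rw [← sub_eq_zero]
  -- The two relations have opposite left sides but equal right sides, because g is antisymmetric.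
  -- Subtracting them avoids dividing by a factor 1 ± g, which may vanish.
  have h2 : (2 : ℂ) • (T i j x * T i j y - T i j y * T i j x) = 0 := by
    linear_combination (norm := module) H - H'
  exact (smul_eq_zero_iff_right two_ne_zero).1 h2

theorem odd_swap (hT : IsMonodromy c T) (i : Fin 3) (hi : par i = 0) {x y : D} (hxy : x ≠ y) :
    f c x y • (T i 2 x * T i 2 y) = -(f c y x • (T i 2 y * T i 2 x)) := by
  have H := hT i 2 i 2 x y hxy
  have p2 : par 2 = 1 := rfl
  simp only [hi, p2, zero_add, mul_one, pow_zero, pow_one, one_mul] at H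
  rw [f_eq_one_add_g c (val_ne hxy), f_eq_one_sub_g c (val_ne hxy.symm)]
  linear_combination (norm := module) H

/-- Since f = g h and g is antisymmetric, the nonzero factor g cancels together with the sign. This
is why h is the right normalisation for products of odd operators. -/
theorem odd_swap_h (hT : IsMonodromy c T) (hc : c ≠ 0) (i : Fin 3) (hi : par i = 0) {x y : D}
    (hxy : x ≠ y) : h c x y • (T i 2 x * T i 2 y) = h c y x • (T i 2 y * T i 2 x) := by
  have H := hT.odd_swap i hi hxy
  rw [f_eq_g_mul_h hc, f_eq_g_mul_h hc, g_swap c y x, mul_smul, mul_smul, neg_smul, neg_neg] at H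
  exact smul_right_injective A (g_ne_zero hc (val_ne hxy)) H

end IsMonodromy

/-! ### Symmetrised products over finite sets of spectral parameters -/

/-- The normalisation factor of a product of operators. -/
def pairProd (φ : ℂ → ℂ → ℂ) : List D → ℂ
  | [] => 1
  | x :: l => (l.map fun y : D => φ y x).prod * pairProd φ l

/-- The normalised product of the `t x` over a list. -/
def listProd (φ : ℂ → ℂ → ℂ) (t : D → A) (l : List D) : A :=
  (pairProd φ l)⁻¹ • (l.map t).prod

/-- The normalised product of the `t x` over a finite set, in an arbitrary order. -/
def symProd (φ : ℂ → ℂ → ℂ) (t : D → A) (S : Finset D) : A := listProd φ t S.toList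

theorem listProd_cons (φ : ℂ → ℂ → ℂ) (t : D → A) (x : D) (l : List D) :
    listProd φ t (x :: l) = (l.map fun y : D => φ y x).prod⁻¹ • (t x * listProd φ t l) := by
  rw [listProd, listProd, pairProd, List.map_cons, List.prod_cons, mul_smul_comm, smul_smul,
    mul_inv]

/-- The family `t` has the exchange symmetry which makes its products, normalised by `φ`,
independent of the order of the factors. -/
def ExchangeSymm (φ : ℂ → ℂ → ℂ) (t : D → A) : Prop :=
  ∀ x y : D, x ≠ y → φ x y • (t x * t y) = φ y x • (t y * t x)

/-- `φ` does not vanish at pairs of distinct elements of `S`. -/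
def NonvanishingOn (φ : ℂ → ℂ → ℂ) (S : Finset D) : Prop :=
  ∀ x ∈ S, ∀ y ∈ S, x ≠ y → φ x y ≠ 0

theorem NonvanishingOn.mono {φ : ℂ → ℂ → ℂ} {S R : Finset D} (hS : NonvanishingOn φ S)
    (hR : R ⊆ S) : NonvanishingOn φ R :=
  fun x hx y hy => hS x (hR hx) y (hR hy)

theorem NonvanishingOn.prod_ne_zero {φ : ℂ → ℂ → ℂ} {S : Finset D} {x : D} (hx : x ∉ S)
    (hS : NonvanishingOn φ (insert x S)) : ∏ y ∈ S, φ y x ≠ 0 :=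
  Finset.prod_ne_zero_iff.2 fun y hy => hS y (Finset.mem_insert_of_mem hy) x
    (Finset.mem_insert_self _ _) fun e => hx (e ▸ hy)

/-- Adjacent transpositions suffice. Swapping two neighbours trades one value of φ for the other,
both in the operators and in the normalisation, and all other factors of the normalisation are
unchanged. -/
theorem listProd_perm {φ : ℂ → ℂ → ℂ} {t : D → A} (ht : ExchangeSymm φ t) {l l' : List D}
    (hl : l.Perm l') (hn : l.Nodup) (hφ : ∀ x ∈ l, ∀ y ∈ l, x ≠ y → φ x y ≠ 0) :
    listProd φ t l = listProd φ t l' := by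
  induction hl with
  | nil => rfl
  | cons x hp ih =>
    rw [listProd_cons, listProd_cons, ih (List.nodup_cons.1 hn).2
      (fun y hy z hz => hφ y (List.mem_cons_of_mem _ hy) z (List.mem_cons_of_mem _ hz)),
      (hp.map _).prod_eq]
  | swap x y l =>
    have hxy : x ≠ y := fun e => by simp [e] at hn
    have h1 : φ x y ≠ 0 := hφ x (by simp) y (by simp) hxy
    have h2 : φ y x ≠ 0 := hφ y (by simp) x (by simp) hxy.symm
    have key : (φ x y)⁻¹ • (t y * t x) = (φ y x)⁻¹ • (t x * t y) := by
      rw [inv_smul_eq_iff₀ h1, smul_comm, ← ht y x hxy.symm, inv_smul_smul₀ h2]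
    simp only [listProd_cons, List.map_cons, List.prod_cons, mul_inv, mul_smul_comm, smul_smul,
      ← mul_assoc]
    have e1 : ∀ a b : ℂ, ((φ x y)⁻¹ * a * b) • (t y * t x * listProd φ t l) =
        (a * b) • (((φ x y)⁻¹ • (t y * t x)) * listProd φ t l) := fun a b => by
      rw [smul_mul_assoc, smul_smul]; ring_nf
    rw [e1, key, smul_mul_assoc, smul_smul]
    ring_nf
  | trans h₁ h₂ ih₁ ih₂ =>
    rw [ih₁ hn hφ, ih₂ (h₁.nodup_iff.1 hn) fun x hx y hy =>
      hφ x (h₁.mem_iff.2 hx) y (h₁.mem_iff.2 hy)]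

theorem symProd_eq_listProd {φ : ℂ → ℂ → ℂ} {t : D → A} (ht : ExchangeSymm φ t) {S : Finset D}
    {l : List D} (hl : S.toList.Perm l) (hφ : NonvanishingOn φ S) :
    symProd φ t S = listProd φ t l :=
  listProd_perm ht hl S.nodup_toList fun x hx y hy =>
    hφ x (Finset.mem_toList.1 hx) y (Finset.mem_toList.1 hy)

@[simp] theorem symProd_empty (φ : ℂ → ℂ → ℂ) (t : D → A) : symProd φ t ∅ = 1 := by
  simp [symProd, listProd, pairProd]

theorem symProd_insert {φ : ℂ → ℂ → ℂ} {t : D → A} (ht : ExchangeSymm φ t) {S : Finset D} {x : D}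
    (hx : x ∉ S) (hφ : NonvanishingOn φ (insert x S)) :
    symProd φ t (insert x S) = (∏ y ∈ S, φ y x)⁻¹ • (t x * symProd φ t S) := by
  rw [symProd_eq_listProd ht (Finset.toList_insert hx) hφ, listProd_cons, symProd,
    Finset.prod_map_toList]

theorem mul_symProd {φ : ℂ → ℂ → ℂ} {t : D → A} (ht : ExchangeSymm φ t) {S : Finset D} {x : D}
    (hx : x ∉ S) (hφ : NonvanishingOn φ (insert x S)) :
    t x * symProd φ t S = (∏ y ∈ S, φ y x) • symProd φ t (insert x S) := by
  rw [symProd_insert ht hx hφ, smul_inv_smul₀ (hφ.prod_ne_zero hx)]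

/-- The trivial normalisation. -/
def one₂ : ℂ → ℂ → ℂ := fun _ _ => 1

theorem nonvanishingOn_one₂ (S : Finset D) : NonvanishingOn one₂ S := fun _ _ _ _ _ => one_ne_zero

theorem IsMonodromy.exchangeSymm_even {c : ℂ} {T : Fin 3 → Fin 3 → D → A} (hT : IsMonodromy c T)
    (i j : Fin 3) (hij : par i = par j) : ExchangeSymm one₂ (T i j) := fun x y _ => by
  rw [hT.even_comm i j hij x y, one₂, one₂]

theorem IsMonodromy.exchangeSymm_odd {c : ℂ} {T : Fin 3 → Fin 3 → D → A} (hT : IsMonodromy c T)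
    (hc : c ≠ 0) (i : Fin 3) (hi : par i = 0) : ExchangeSymm (h c) (T i 2) :=
  fun _ _ hxy => hT.odd_swap_h hc i hi hxy

theorem symProd_one₂_insert {t : D → A} (ht : ExchangeSymm one₂ t) {S : Finset D} {x : D}
    (hx : x ∉ S) : symProd one₂ t (insert x S) = t x * symProd one₂ t S := by
  rw [symProd_insert ht hx (nonvanishingOn_one₂ _)]
  simp [one₂]

/-! ### Moving an operator through a symmetrised product -/

/-- There are two ways to end with the argument s: pass w and then exchange x with s, or exchange x
with w and then w with s. Their weights add up to a single product. -/
theorem f_mul_g_add_g_mul_g {c : ℂ} {x w s : ℂ} (hxw : x ≠ w) (hxs : x ≠ s) (hws : w ≠ s) :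
    f c w x * g c x s + g c x w * g c w s = g c x s * f c w s := by
  have h1 := g_mul_g c hxw hxs hws
  rw [f_eq_one_add_g c hxw.symm, f_eq_one_add_g c hws]
  linear_combination -h1

/-- The Bethe ansatz formula with its wanted term and its exchange terms. In the induction the new
factor w stands in front; the two contributions to each exchange with s ≠ w merge by
`f_mul_g_add_g_mul_g`, because the b's commute. -/
theorem mul_symProd_even {c : ℂ} {a b : D → A} (hb : ExchangeSymm one₂ b)
    (hab : ∀ x y : D, x ≠ y → a x * b y = f c y x • (b y * a x) + g c x y • (b x * a y))
    {S : Finset D} {x : D} (hx : x ∉ S) :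
    a x * symProd one₂ b S = (∏ y ∈ S, f c y x) • (symProd one₂ b S * a x) +
      ∑ s ∈ S, (g c x s * ∏ y ∈ S.erase s, f c y s) •
        (b x * symProd one₂ b (S.erase s) * a s) := by
  induction S using Finset.induction_on generalizing x with
  | empty => simp
  | insert w S hw ih =>
    rw [Finset.mem_insert, not_or] at hx
    have hsum : ∑ s ∈ S, (g c x s * ∏ y ∈ (insert w S).erase s, f c y s) •
          (b x * symProd one₂ b ((insert w S).erase s) * a s) =
        f c w x • (b w * ∑ s ∈ S, (g c x s * ∏ y ∈ S.erase s, f c y s) •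
          (b x * symProd one₂ b (S.erase s) * a s)) +
        g c x w • (b x * ∑ s ∈ S, (g c w s * ∏ y ∈ S.erase s, f c y s) •
          (b w * symProd one₂ b (S.erase s) * a s)) := by
      rw [Finset.mul_sum, Finset.mul_sum, Finset.smul_sum, Finset.smul_sum,
        ← Finset.sum_add_distrib]
      refine Finset.sum_congr rfl fun s hs => ?_
      have hws : w ≠ s := fun e => hw (e ▸ hs)
      have hxs : x ≠ s := fun e => hx.2 (e ▸ hs)
      have hw' : w ∉ S.erase s := fun e => hw (Finset.mem_of_mem_erase e)
      have hcomm : b w * b x = b x * b w := by simpa [one₂] using hb w x (Ne.symm hx.1)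
      rw [Finset.erase_insert_of_ne hws, Finset.prod_insert hw', symProd_one₂_insert hb hw']
      have e : b w * (b x * symProd one₂ b (S.erase s) * a s) =
          b x * (b w * symProd one₂ b (S.erase s)) * a s := by
        simp only [← mul_assoc, hcomm]
      rw [mul_smul_comm, mul_smul_comm, smul_smul, smul_smul, e, ← mul_assoc (b x),
        ← mul_assoc (b x), ← mul_assoc (b x), ← add_smul]
      congr 1
      linear_combination -(∏ y ∈ S.erase s, f c y s) *
        f_mul_g_add_g_mul_g (c := c) (val_ne hx.1) (val_ne hxs) (val_ne hws)
    rw [Finset.sum_insert hw, hsum, Finset.erase_insert hw, Finset.prod_insert hw,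
      symProd_one₂_insert hb hw, ← mul_assoc, hab x w hx.1, add_mul, smul_mul_assoc,
      smul_mul_assoc, mul_assoc (b w), mul_assoc (b x), ih hx.2, ih hw]
    simp only [mul_add, mul_smul_comm, ← mul_assoc]
    module

/-- The odd analogue of `mul_symProd_even`. Taking s out of the normalised product divides by the
values h(y, s), so the exchange coefficients contain g = f / h instead of f. The scalar ε is
collected once for each factor passed; it is -1 when a is odd as well. -/
theorem mul_symProd_odd {c : ℂ} (hc : c ≠ 0) {a b : D → A} (ε : ℂ)
    (hb : ∀ x y : D, x ≠ y → f c x y • (b x * b y) = -(f c y x • (b y * b x)))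
    (hb' : ExchangeSymm (h c) b)
    (hab : ∀ x y : D, x ≠ y → a x * b y = ε • (f c y x • (b y * a x) + g c x y • (b x * a y)))
    {S : Finset D} (hS : NonvanishingOn (h c) S) {x : D} (hx : x ∉ S) :
    a x * symProd (h c) b S = ε ^ S.card • ((∏ y ∈ S, f c y x) • (symProd (h c) b S * a x) +
      ∑ s ∈ S, (g c x s * ∏ y ∈ S.erase s, g c y s) •
        (b x * symProd (h c) b (S.erase s) * a s)) := by
  induction S using Finset.induction_on generalizing x with
  | empty => simp
  | insert w S hw ih =>
    rw [Finset.mem_insert, not_or] at hx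
    have hS' : NonvanishingOn (h c) S := hS.mono (Finset.subset_insert _ _)
    have hN := hS.prod_ne_zero hw
    have hsum : ∑ s ∈ S, (g c x s * ∏ y ∈ (insert w S).erase s, g c y s) •
          (b x * symProd (h c) b ((insert w S).erase s) * a s) =
        (∏ y ∈ S, h c y w)⁻¹ • (f c w x • (b w * ∑ s ∈ S, (g c x s * ∏ y ∈ S.erase s, g c y s) •
          (b x * symProd (h c) b (S.erase s) * a s)) +
        g c x w • (b x * ∑ s ∈ S, (g c w s * ∏ y ∈ S.erase s, g c y s) •
          (b w * symProd (h c) b (S.erase s) * a s))) := by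
      rw [eq_inv_smul_iff₀ hN, Finset.mul_sum, Finset.mul_sum, Finset.smul_sum, Finset.smul_sum,
        Finset.smul_sum, ← Finset.sum_add_distrib]
      refine Finset.sum_congr rfl fun s hs => ?_
      have hws : w ≠ s := fun e => hw (e ▸ hs)
      have hxs : x ≠ s := fun e => hx.2 (e ▸ hs)
      have hw' : w ∉ S.erase s := fun e => hw (Finset.mem_of_mem_erase e)
      have hSs : NonvanishingOn (h c) (insert w (S.erase s)) :=
        hS.mono (Finset.insert_subset_insert _ (Finset.erase_subset _ _))
      rw [Finset.erase_insert_of_ne hws, Finset.prod_insert hw', symProd_insert hb' hw' hSs,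
        ← Finset.mul_prod_erase S _ hs]
      have hN' := hSs.prod_ne_zero hw'
      -- The two contributions carry b(w) b(x) and b(x) b(w); the odd exchange relation brings them
      -- to a common order at the price of a sign.
      have e : f c w x • (b w * (b x * symProd (h c) b (S.erase s) * a s)) =
          -(f c x w • (b x * (b w * symProd (h c) b (S.erase s)) * a s)) := by
        have := congrArg (fun z => z * symProd (h c) b (S.erase s) * a s)
          (hb w x (Ne.symm hx.1))
        simpa only [smul_mul_assoc, neg_mul, mul_assoc] using this
      rw [mul_smul_comm, mul_smul_comm, mul_smul_comm, smul_comm (f c w x), e, ← mul_assoc (b x),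
        ← mul_assoc (b x), ← mul_assoc (b x), smul_mul_assoc, smul_smul, smul_smul, smul_smul,
        ← neg_smul, smul_smul, ← add_smul]
      congr 1
      have k1 := f_mul_g_add_g_mul_g (c := c) (val_ne hx.1) (val_ne hxs) (val_ne hws)
      have k2 := f_eq_g_mul_h hc s w
      rw [g_swap c s w, f_eq_one_sub_g c (val_ne hws.symm)] at k2
      rw [f_eq_one_add_g c (val_ne (Ne.symm hx.1)), f_eq_one_add_g c (val_ne hws),
        g_swap c w x] at k1
      rw [f_eq_one_add_g c (val_ne hx.1)]
      field_simp
      linear_combination (∏ y ∈ S.erase s, g c y s) * (g c x s * k2 - k1)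
    rw [Finset.sum_insert hw, hsum, Finset.erase_insert hw, Finset.prod_insert hw,
      symProd_insert hb' hw hS, mul_smul_comm, ← mul_assoc, hab x w hx.1, smul_mul_assoc, add_mul,
      smul_mul_assoc, smul_mul_assoc, mul_assoc (b w), mul_assoc (b x), ih hS' hx.2, ih hS' hw,
      Finset.card_insert_of_notMem hw]
    have e2 : ∏ y ∈ S, f c y w = (∏ y ∈ S, g c y w) * ∏ y ∈ S, h c y w := by
      rw [← Finset.prod_mul_distrib]
      exact Finset.prod_congr rfl fun y _ => f_eq_g_mul_h hc _ _
    rw [e2]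
    simp only [mul_add, mul_smul_comm, smul_mul_assoc, ← mul_assoc, smul_add, smul_smul]
    match_scalars <;> field_simp <;> ring

theorem symProd_one₂_insert_right {t : D → A} (ht : ExchangeSymm one₂ t) {S : Finset D} {x : D}
    (hx : x ∉ S) : symProd one₂ t (insert x S) = symProd one₂ t S * t x := by
  induction S using Finset.induction_on with
  | empty => rw [symProd_one₂_insert ht hx]; simp
  | insert w S hw ih =>
    rw [Finset.mem_insert, not_or] at hx
    have hcomm : t x * t w = t w * t x := by simpa [one₂] using ht x w hx.1
    rw [symProd_one₂_insert ht (by simp [hx]), symProd_one₂_insert ht hw, ← mul_assoc, hcomm,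
      mul_assoc, ← symProd_one₂_insert ht hx.2, ih hx.2, mul_assoc]

/-- The mirror image of `mul_symProd_even`: now b(x) arrives from the right, and S is peeled off at
its right end. -/
theorem symProd_even_mul {c : ℂ} {a b : D → A} (ha : ExchangeSymm one₂ a)
    (hab : ∀ x y : D, x ≠ y → a x * b y = f c x y • (b y * a x) + g c y x • (b x * a y))
    {S : Finset D} {x : D} (hx : x ∉ S) :
    symProd one₂ a S * b x = (∏ y ∈ S, f c y x) • (b x * symProd one₂ a S) +
      ∑ s ∈ S, (g c x s * ∏ y ∈ S.erase s, f c y s) •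
        (b s * a x * symProd one₂ a (S.erase s)) := by
  induction S using Finset.induction_on generalizing x with
  | empty => simp
  | insert w S hw ih =>
    rw [Finset.mem_insert, not_or] at hx
    have hsum : ∑ s ∈ S, (g c x s * ∏ y ∈ (insert w S).erase s, f c y s) •
          (b s * a x * symProd one₂ a ((insert w S).erase s)) =
        f c w x • ((∑ s ∈ S, (g c x s * ∏ y ∈ S.erase s, f c y s) •
          (b s * a x * symProd one₂ a (S.erase s))) * a w) +
        g c x w • ((∑ s ∈ S, (g c w s * ∏ y ∈ S.erase s, f c y s) •
          (b s * a w * symProd one₂ a (S.erase s))) * a x) := by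
      rw [Finset.sum_mul, Finset.sum_mul, Finset.smul_sum, Finset.smul_sum,
        ← Finset.sum_add_distrib]
      refine Finset.sum_congr rfl fun s hs => ?_
      have hws : w ≠ s := fun e => hw (e ▸ hs)
      have hxs : x ≠ s := fun e => hx.2 (e ▸ hs)
      have hw' : w ∉ S.erase s := fun e => hw (Finset.mem_of_mem_erase e)
      have hx' : x ∉ S.erase s := fun e => hx.2 (Finset.mem_of_mem_erase e)
      have e1 : a x * symProd one₂ a (S.erase s) * a w =
          a x * symProd one₂ a (insert w (S.erase s)) := by
        rw [mul_assoc, ← symProd_one₂_insert_right ha hw']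
      have e2 : a w * symProd one₂ a (S.erase s) * a x =
          a x * symProd one₂ a (insert w (S.erase s)) := by
        have hcomm : a w * a x = a x * a w := by simpa [one₂] using ha w x (Ne.symm hx.1)
        rw [mul_assoc, ← symProd_one₂_insert_right ha hx', symProd_one₂_insert ha hx',
          ← mul_assoc, hcomm, mul_assoc, ← symProd_one₂_insert ha hw']
      rw [Finset.erase_insert_of_ne hws, Finset.prod_insert hw', smul_mul_assoc, smul_mul_assoc,
        mul_assoc (b s), mul_assoc (b s), mul_assoc (b s), mul_assoc (b s), mul_assoc (b s), e1,
        e2, smul_smul, smul_smul, ← add_smul]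
      congr 1
      linear_combination -(∏ y ∈ S.erase s, f c y s) *
        f_mul_g_add_g_mul_g (c := c) (val_ne hx.1) (val_ne hxs) (val_ne hws)
    rw [Finset.sum_insert hw, hsum, Finset.erase_insert hw, Finset.prod_insert hw,
      symProd_one₂_insert_right ha hw, mul_assoc, hab w x (Ne.symm hx.1), mul_add, mul_smul_comm,
      mul_smul_comm, ← mul_assoc, ← mul_assoc, ih hx.2, ih hw]
    have hcomm : a x * symProd one₂ a S = symProd one₂ a S * a x := by
      rw [← symProd_one₂_insert ha hx.2, symProd_one₂_insert_right ha hx.2]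
    rw [mul_assoc (b w), hcomm]
    simp only [add_mul, smul_mul_assoc, ← mul_assoc]
    module

/-! ### Partial fractions -/

open Polynomial in
/-- Lagrange interpolation in terms of the function `g`. -/
theorem eval_mul_prod_g {ι : Type*} [DecidableEq ι] (c : ℂ) {s : Finset ι} {x : ι → ℂ}
    (hx : Set.InjOn x s) {P : ℂ[X]} (hP : P.degree < s.card) {t : ℂ} (ht : ∀ i ∈ s, x i ≠ t) :
    P.eval t * ∏ i ∈ s, g c (x i) t =
      ∑ i ∈ s, P.eval (x i) * g c (x i) t * ∏ j ∈ s.erase i, g c (x j) (x i) := by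
  -- Multiplied by the product of all g(x_i, t), a Lagrange basis polynomial becomes g(x_i, t) times
  -- the product of the g(x_j, x_i).
  conv_lhs => rw [Lagrange.eq_interpolate hx hP]
  rw [Lagrange.interpolate_apply, eval_finsetSum, Finset.sum_mul]
  refine Finset.sum_congr rfl fun i hi => ?_
  rw [eval_mul, eval_C, ← Finset.mul_prod_erase s _ hi, Lagrange.basis, eval_prod]
  have e : ∏ j ∈ s.erase i, g c (x j) (x i) =
      (∏ j ∈ s.erase i, eval t (Lagrange.basisDivisor (x i) (x j))) *
        ∏ j ∈ s.erase i, g c (x j) t := by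
    rw [← Finset.prod_mul_distrib]
    refine Finset.prod_congr rfl fun j hj => ?_
    have h1 : x j - t ≠ 0 := sub_ne_zero.2 (ht j (Finset.mem_of_mem_erase hj))
    have h2 : x j - x i ≠ 0 := sub_ne_zero.2 fun e =>
      Finset.ne_of_mem_erase hj (hx (Finset.mem_of_mem_erase hj) hi e)
    have h3 : x i - x j ≠ 0 := sub_ne_zero.2 fun e =>
      Finset.ne_of_mem_erase hj (hx (Finset.mem_of_mem_erase hj) hi e.symm)
    simp only [Lagrange.basisDivisor, g, eval_mul, eval_C, eval_sub, eval_X]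
    field_simp
    ring
  rw [e]
  ring

open Polynomial in
theorem degree_prod_lt {ι : Type*} {s : Finset ι} {p : ι → ℂ[X]} (hp : ∀ i ∈ s, (p i).natDegree ≤ 1)
    {n : ℕ} (hn : s.card < n) : (∏ i ∈ s, p i).degree < n := by
  refine lt_of_le_of_lt degree_le_natDegree (Nat.cast_lt.2 (lt_of_le_of_lt ?_ hn))
  refine (natDegree_prod_le _ _).trans ((Finset.sum_le_card_nsmul _ _ 1 hp).trans ?_)
  simp

open Polynomial in
/-- The polynomial `h(X, a)`. -/
def hPoly (c a : ℂ) : ℂ[X] := C c⁻¹ * (Polynomial.X - C (a - c))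

open Polynomial in
/-- The polynomial `h(a, X)`. -/
def hPoly' (c a : ℂ) : ℂ[X] := C c⁻¹ * (C (a + c) - Polynomial.X)

open Polynomial in
theorem eval_hPoly (c a t : ℂ) : (hPoly c a).eval t = h c t a := by
  simp [hPoly, h]; ring

open Polynomial in
theorem eval_hPoly' (c a t : ℂ) : (hPoly' c a).eval t = h c a t := by
  simp [hPoly', h]; ring

theorem natDegree_hPoly (c a : ℂ) : (hPoly c a).natDegree ≤ 1 := by
  unfold hPoly; compute_degree

theorem natDegree_hPoly' (c a : ℂ) : (hPoly' c a).natDegree ≤ 1 := by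
  unfold hPoly'; compute_degree

open Polynomial in
-- Interpolation of Q(X) ∏_{s ∈ U} (-h(X, s)) at the nodes U ∪ V. As f(t, s) = -h(t, s) g(s, t), the
-- factors f supply the g's of the nodes in U. The degree is below |U| + |V| by the bound on Q. At a
-- node s ∈ U the factor -h(s, s) = -1 turns g(s, t) into g(t, s).
theorem prod_g_mul_prod_f {c : ℂ} (hc : c ≠ 0) {U V : Finset D} (hUV : Disjoint U V) {t : D}
    (htU : t ∉ U) (htV : t ∉ V) {Q : ℂ[X]} (hQ : Q.degree < V.card) :
    Q.eval (t : ℂ) * (∏ j ∈ V, g c j t) * ∏ s ∈ U, f c t s =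
      (∑ s ∈ U, g c t s * (Q.eval (s : ℂ) * (∏ j ∈ V, g c j s) * ∏ s' ∈ U.erase s, f c s s')) +
      ∑ j ∈ V, g c j t * (Q.eval (j : ℂ) * (∏ i ∈ V.erase j, g c i j) * ∏ s ∈ U, f c j s) := by
  have hf : ∀ x y : ℂ, f c x y = g c y x * -h c x y := fun x y => by
    rw [f_eq_g_mul_h hc, g_swap]; ring
  have hP : ((∏ s ∈ U, -hPoly c (s : ℂ)) * Q).degree < (U ∪ V).card := by
    rw [Finset.card_union_of_disjoint hUV, Nat.cast_add]
    have h1 : (∏ s ∈ U, -hPoly c (s : ℂ)).natDegree ≤ U.card := by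
      refine (natDegree_prod_le _ _).trans ((Finset.sum_le_card_nsmul _ _ 1 ?_).trans (by simp))
      intro s _
      rw [natDegree_neg]
      exact natDegree_hPoly c s
    rcases eq_or_ne Q 0 with rfl | hQ0
    · rw [mul_zero, degree_zero]; exact WithBot.bot_lt_coe _
    have h2 := (natDegree_lt_iff_degree_lt hQ0).2 hQ
    refine lt_of_le_of_lt degree_le_natDegree ?_
    rw [← Nat.cast_add]
    exact Nat.cast_lt.2 (lt_of_le_of_lt natDegree_mul_le (by omega))
  have key := eval_mul_prod_g c (s := U ∪ V) (x := fun x : D => (x : ℂ))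
    (fun x _ y _ e => Subtype.ext e) hP (t := t) (fun i hi e => by
      rcases Finset.mem_union.1 hi with h1 | h1
      · exact htU (Subtype.ext e ▸ h1)
      · exact htV (Subtype.ext e ▸ h1))
  have hPe : ∀ x : ℂ, ((∏ s ∈ U, -hPoly c (s : ℂ)) * Q).eval x =
      (∏ s ∈ U, -h c x s) * Q.eval x := fun x => by
    simp [eval_prod, eval_hPoly]
  simp only [hPe] at key
  rw [Finset.prod_union hUV, Finset.sum_union hUV] at key
  have e1 : (∏ s ∈ U, f c t s) = (∏ s ∈ U, -h c t s) * ∏ s ∈ U, g c s t := by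
    rw [← Finset.prod_mul_distrib]
    exact Finset.prod_congr rfl fun s _ => by rw [hf, mul_comm]
  have e2 : ∀ s ∈ U, g c t s * (Q.eval (s : ℂ) * (∏ j ∈ V, g c j s) *
      ∏ s' ∈ U.erase s, f c s s') = (∏ s' ∈ U, -h c s s') * Q.eval (s : ℂ) * g c s t *
        ∏ j ∈ (U ∪ V).erase s, g c j s := fun s hs => by
    have hsV : s ∉ V := Finset.disjoint_left.1 hUV hs
    have hd : Disjoint (U.erase s) V := hUV.mono_left (Finset.erase_subset _ _)
    have e3 : (∏ s' ∈ U.erase s, f c s s') =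
        (∏ s' ∈ U.erase s, -h c s s') * ∏ s' ∈ U.erase s, g c s' s := by
      rw [← Finset.prod_mul_distrib]
      exact Finset.prod_congr rfl fun s' _ => by rw [hf, mul_comm]
    rw [Finset.erase_union_distrib, Finset.erase_eq_of_notMem hsV, Finset.prod_union hd,
      ← Finset.mul_prod_erase U _ hs, h_self hc, e3, g_swap c t s]
    ring
  have e4 : ∀ j ∈ V, g c j t * (Q.eval (j : ℂ) * (∏ i ∈ V.erase j, g c i j) *
      ∏ s ∈ U, f c j s) = (∏ s' ∈ U, -h c j s') * Q.eval (j : ℂ) * g c j t *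
        ∏ i ∈ (U ∪ V).erase j, g c i j := fun j hj => by
    have hjU : j ∉ U := Finset.disjoint_right.1 hUV hj
    have hd : Disjoint U (V.erase j) := hUV.mono_right (Finset.erase_subset _ _)
    have e3 : (∏ s' ∈ U, f c j s') = (∏ s' ∈ U, -h c j s') * ∏ s' ∈ U, g c s' j := by
      rw [← Finset.prod_mul_distrib]
      exact Finset.prod_congr rfl fun s' _ => by rw [hf, mul_comm]
    rw [Finset.erase_union_distrib, Finset.erase_eq_of_notMem hjU, Finset.prod_union hd, e3]
    ring
  rw [Finset.sum_congr rfl e2, Finset.sum_congr rfl e4, ← key, e1]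
  ring

open Polynomial in
theorem prod_g_mul_prod_f_mul_prod_h {c : ℂ} (hc : c ≠ 0) {U V : Finset D} (hUV : Disjoint U V)
    {t : D} (htU : t ∉ U) (htV : t ∉ V) {α : Finset D} (hα : V.card = α.card + 1) :
    (∏ a ∈ α, h c t a) * (∏ j ∈ V, g c j t) * ∏ s ∈ U, f c t s =
      (∑ s ∈ U, g c t s * ((∏ a ∈ α, h c s a) * (∏ j ∈ V, g c j s) *
        ∏ s' ∈ U.erase s, f c s s')) +
      ∑ j ∈ V, g c j t * ((∏ a ∈ α, h c j a) * (∏ i ∈ V.erase j, g c i j) *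
        ∏ s ∈ U, f c j s) := by
  have := prod_g_mul_prod_f hc hUV htU htV (Q := ∏ a ∈ α, hPoly c (a : ℂ))
    (degree_prod_lt (s := α) (n := V.card) (fun i _ => natDegree_hPoly c i) (by omega))
  simpa only [eval_prod, eval_hPoly] using this

open Polynomial in
-- The case of `prod_g_mul_prod_f` with the additional node x in V and Q = ∏_{z ∈ V} h(z, X). The
-- number of nodes exceeds the degree because of x, whose residue is the first term on the right.
theorem g_mul_prod_f_mul_prod_f {c : ℂ} (hc : c ≠ 0) {U V : Finset D} (hUV : Disjoint U V)
    {x t : D} (htU : t ∉ U) (htV : t ∉ V) (hxU : x ∉ U) (hxV : x ∉ V) (hxt : x ≠ t) :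
    g c x t * (∏ s ∈ U, f c t s) * ∏ z ∈ V, f c z t =
      g c x t * ((∏ s ∈ U, f c x s) * ∏ z ∈ V, f c z x) +
      (∑ s ∈ U, g c t s * ((∏ s' ∈ U.erase s, f c s s') * (∏ z ∈ V, f c z s) * g c x s)) +
      ∑ z ∈ V, g c z t * ((∏ s ∈ U, f c z s) * (∏ z' ∈ V.erase z, f c z' z) * g c x z) := by
  have key := prod_g_mul_prod_f hc (U := U) (V := insert x V)
    (Finset.disjoint_insert_right.2 ⟨hxU, hUV⟩) htU
    (by simp [htV, Ne.symm hxt]) (Q := ∏ z ∈ V, hPoly' c (z : ℂ))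
    (degree_prod_lt (s := V) (n := (insert x V).card) (fun i _ => natDegree_hPoly' c i)
      (by rw [Finset.card_insert_of_notMem hxV]; omega))
  simp only [eval_prod, eval_hPoly'] at key
  have hf : ∀ (t : D) (V : Finset D), ∏ z ∈ V, f c z t =
      (∏ z ∈ V, h c z t) * ∏ z ∈ V, g c z t := fun t V => by
    rw [← Finset.prod_mul_distrib]
    exact Finset.prod_congr rfl fun s _ => by rw [f_eq_g_mul_h hc, mul_comm]
  rw [Finset.prod_insert hxV, Finset.sum_insert hxV, Finset.erase_insert hxV] at key
  have e1 : ∀ s ∈ U, g c t s * ((∏ z ∈ V, h c z s) * (∏ j ∈ insert x V, g c j s) *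
      ∏ s' ∈ U.erase s, f c s s') =
      g c t s * ((∏ s' ∈ U.erase s, f c s s') * (∏ z ∈ V, f c z s) * g c x s) := fun s _ => by
    rw [Finset.prod_insert hxV, hf]; ring
  have e2 : ∀ z ∈ V, g c z t * ((∏ z' ∈ V, h c z' z) * (∏ i ∈ (insert x V).erase z, g c i z) *
      ∏ s ∈ U, f c z s) =
      g c z t * ((∏ s ∈ U, f c z s) * (∏ z' ∈ V.erase z, f c z' z) * g c x z) := fun z hz => by
    have hxz : x ≠ z := fun e => hxV (e ▸ hz)
    rw [Finset.erase_insert_of_ne hxz, Finset.prod_insert (by simp [hxV]),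
      ← Finset.mul_prod_erase V _ hz, h_self hc, hf]
    ring
  rw [Finset.sum_congr rfl e1, Finset.sum_congr rfl e2] at key
  rw [hf t, hf x]
  linear_combination key

open Polynomial in
theorem prod_f_mul_prod_f_eq {c : ℂ} (hc : c ≠ 0) {α β : Finset D} (hαβ : β.card = α.card)
    {t : D} (htα : t ∉ α) (htβ : t ∉ β) (ht : ∀ s ∈ α, h c t s ≠ 0) :
    (∏ s ∈ α, f c t s) * ∏ v ∈ β, f c v t =
      1 - (∏ v ∈ β, g c v t) * ∑ s ∈ α, g c s t * ((∏ s' ∈ α.erase s, g c s s') *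
        (∏ v ∈ β, h c v s) * ∏ s' ∈ α.erase s, h c t s') := by
  -- The nodes are the points of α and, as `none`, the extra point t + c, which is distinct from
  -- them because h(t, s) ≠ 0. There g(t + c, t) = 1 and h(v, t + c) inverts g(v, t), so this node
  -- produces the constant 1. At the node s it contributes g(t + c, s) = 1 / h(t, s).
  let x : Option D → ℂ := fun o => o.elim ((t : ℂ) + c) fun s => s
  have hne : ∀ s ∈ α, (s : ℂ) ≠ t + c := fun s hs e => ht s hs (by rw [h, e]; simp)
  have hinj : Set.InjOn x (Finset.insertNone α) := by
    rintro (_ | a) ha (_ | b) hb e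
    · rfl
    · exact absurd e.symm (hne b (by simpa using hb))
    · exact absurd e (hne a (by simpa using ha))
    · exact congrArg some (Subtype.ext e)
  have key := eval_mul_prod_g c hinj (P := ∏ v ∈ β, hPoly' c (v : ℂ))
    (degree_prod_lt (s := β) (n := (Finset.insertNone α).card) (fun i _ => natDegree_hPoly' c i)
      (by rw [Finset.card_insertNone]; omega)) (t := t) (by
      rintro (_ | a) ha e
      · exact hc (by simpa [x] using e)
      · exact htα (by rw [← Subtype.ext (show (a : ℂ) = t from e)]; simpa using ha))
  have en : (Finset.insertNone α).erase none = α.map Function.Embedding.some := by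
    ext (_ | a) <;> simp
  have es : ∀ s, (Finset.insertNone α).erase (some s) = Finset.insertNone (α.erase s) := by
    intro s; ext (_ | a) <;> simp
  simp only [eval_prod, eval_hPoly', Finset.prod_insertNone, Finset.sum_insertNone, en, es,
    Finset.prod_map, Function.Embedding.some_apply] at key
  change _ * (g c (t + c) t * ∏ s ∈ α, g c s t) = (∏ v ∈ β, h c v (t + c)) * g c (t + c) t *
    (∏ s ∈ α, g c s (t + c)) + ∑ s ∈ α, (∏ v ∈ β, h c v s) * g c s t *
      (g c (t + c) s * ∏ s' ∈ α.erase s, g c s' s) at key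
  have g1 : g c (t + c) t = 1 := by rw [g]; simp [hc]
  have hH : ∏ s ∈ α, h c t s ≠ 0 := Finset.prod_ne_zero_iff.2 ht
  have g2 : ∀ s : D, g c (t + c) s = (h c t s)⁻¹ := fun s => by
    rw [g, h, inv_div]; congr 1; ring
  have g3 : ∏ s ∈ α, g c s (t + c) = (-1) ^ α.card * (∏ s ∈ α, h c t s)⁻¹ := by
    rw [← Finset.prod_inv_distrib, ← Finset.prod_const, ← Finset.prod_mul_distrib]
    exact Finset.prod_congr rfl fun s _ => by rw [g_swap, g2]; ring
  have g4 : (∏ v ∈ β, g c v t) * ∏ v ∈ β, h c v (t + c) = 1 := by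
    rw [← Finset.prod_mul_distrib]
    refine Finset.prod_eq_one fun v hv => ?_
    have : (v : ℂ) - t ≠ 0 := sub_ne_zero.2 (val_ne fun e => htβ (e ▸ hv))
    rw [g, h]; field_simp; ring
  have g5 : ∏ s ∈ α, g c s t = (-1) ^ α.card * ∏ s ∈ α, g c t s := by
    rw [← Finset.prod_const, ← Finset.prod_mul_distrib]
    exact Finset.prod_congr rfl fun s _ => by rw [g_swap]; ring
  have g6 : ∑ s ∈ α, (∏ v ∈ β, h c v s) * g c s t *
      (g c (t + c) s * ∏ s' ∈ α.erase s, g c s' s) =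
      -(-1) ^ α.card * (∏ s ∈ α, h c t s)⁻¹ *
      ∑ s ∈ α, g c s t * ((∏ s' ∈ α.erase s, g c s s') *
        (∏ v ∈ β, h c v s) * ∏ s' ∈ α.erase s, h c t s') := by
    rw [Finset.mul_sum]
    refine Finset.sum_congr rfl fun s hs => ?_
    have g7 : ∏ s' ∈ α.erase s, g c s' s =
        -(-1) ^ α.card * ∏ s' ∈ α.erase s, g c s s' := by
      rw [← Finset.card_erase_add_one hs, pow_succ, ← Finset.prod_const, mul_neg_one, neg_neg,
        ← Finset.prod_mul_distrib]
      exact Finset.prod_congr rfl fun s _ => by rw [g_swap]; ring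
    have h8 := ht s hs
    have h9 : ∏ s' ∈ α.erase s, h c t s' ≠ 0 :=
      Finset.prod_ne_zero_iff.2 fun s' hs' => ht s' (Finset.mem_of_mem_erase hs')
    rw [g7, g2, ← Finset.mul_prod_erase α _ hs]
    field_simp
  have hfα : ∏ s ∈ α, f c t s = (∏ s ∈ α, g c t s) * ∏ s ∈ α, h c t s := by
    rw [← Finset.prod_mul_distrib]
    exact Finset.prod_congr rfl fun s _ => f_eq_g_mul_h hc _ _
  have hfβ : ∏ v ∈ β, f c v t = (∏ v ∈ β, g c v t) * ∏ v ∈ β, h c v t := by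
    rw [← Finset.prod_mul_distrib]
    exact Finset.prod_congr rfl fun s _ => f_eq_g_mul_h hc _ _
  rw [g1, g3, g5, g6] at key
  generalize ∑ s ∈ α, g c s t * ((∏ s' ∈ α.erase s, g c s s') *
    (∏ v ∈ β, h c v s) * ∏ s' ∈ α.erase s, h c t s') = Z at key ⊢
  have hsgn : ((-1 : ℂ) ^ α.card) * (-1) ^ α.card = 1 := by rw [← mul_pow]; norm_num
  rw [hfα, hfβ]
  field_simp at key
  linear_combination (∏ v ∈ β, g c v t) * key + g4

/-! ### Sums over subsets -/

/-- The bijection (α, s) ↦ (α ∪ {s}, s). It reindexes exchange terms, in which an operator releases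
or absorbs the parameter s. -/
theorem sum_powerset_sdiff {ι M : Type*} [DecidableEq ι] [AddCommMonoid M] (U : Finset ι)
    (F : ι → Finset ι → M) : ∑ α ∈ U.powerset, ∑ s ∈ U \ α, F s α =
      ∑ α ∈ U.powerset, ∑ s ∈ α, F s (α.erase s) := by
  rw [Finset.sum_sigma', Finset.sum_sigma']
  refine Finset.sum_bij' (fun p _ => ⟨insert p.2 p.1, p.2⟩) (fun p _ => ⟨p.1.erase p.2, p.2⟩)
    ?_ ?_ ?_ ?_ ?_
  · rintro ⟨α, s⟩ hp
    simp only [Finset.mem_sigma, Finset.mem_powerset, Finset.mem_sdiff] at hp ⊢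
    exact ⟨Finset.insert_subset hp.2.1 hp.1, Finset.mem_insert_self _ _⟩
  · rintro ⟨α, s⟩ hp
    simp only [Finset.mem_sigma, Finset.mem_powerset, Finset.mem_sdiff] at hp ⊢
    exact ⟨(Finset.erase_subset _ _).trans hp.1, hp.1 hp.2, Finset.notMem_erase _ _⟩
  · rintro ⟨α, s⟩ hp
    simp only [Finset.mem_sigma, Finset.mem_powerset, Finset.mem_sdiff] at hp
    simp [Finset.erase_insert hp.2.2]
  · rintro ⟨α, s⟩ hp
    simp only [Finset.mem_sigma] at hp
    simp [Finset.insert_erase hp.2]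
  · rintro ⟨α, s⟩ hp
    simp only [Finset.mem_sigma, Finset.mem_powerset, Finset.mem_sdiff] at hp
    simp [Finset.erase_insert hp.2.2]

theorem sum_sum_powerset_erase {ι M : Type*} [DecidableEq ι] [AddCommMonoid M] (V : Finset ι)
    (F : ι → Finset ι → M) : ∑ y ∈ V, ∑ β ∈ (V.erase y).powerset, F y β =
      ∑ β ∈ V.powerset, ∑ y ∈ V \ β, F y β := by
  refine Finset.sum_comm' fun y β => ?_
  simp only [Finset.mem_powerset, Finset.mem_sdiff, Finset.subset_erase]
  tauto

/-! ### Double products -/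

/-- Product of a two-variable function over two finite sets. -/
def dprod (φ : ℂ → ℂ → ℂ) (S R : Finset D) : ℂ := ∏ x ∈ S, ∏ y ∈ R, φ x y

@[simp] theorem dprod_empty_left (φ : ℂ → ℂ → ℂ) (R : Finset D) : dprod φ ∅ R = 1 := by
  simp [dprod]

@[simp] theorem dprod_empty_right (φ : ℂ → ℂ → ℂ) (S : Finset D) : dprod φ S ∅ = 1 := by
  simp [dprod]

theorem dprod_insert_left (φ : ℂ → ℂ → ℂ) {x : D} {S : Finset D} (hx : x ∉ S) (R : Finset D) :
    dprod φ (insert x S) R = (∏ y ∈ R, φ x y) * dprod φ S R := by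
  rw [dprod, Finset.prod_insert hx, dprod]

theorem dprod_insert_right (φ : ℂ → ℂ → ℂ) (S : Finset D) {y : D} {R : Finset D} (hy : y ∉ R) :
    dprod φ S (insert y R) = (∏ x ∈ S, φ x y) * dprod φ S R := by
  simp only [dprod, Finset.prod_insert hy, Finset.prod_mul_distrib]

theorem dprod_f {c : ℂ} (hc : c ≠ 0) (S R : Finset D) :
    dprod (f c) S R = dprod (g c) S R * dprod (h c) S R := by
  simp only [dprod, f_eq_g_mul_h hc, Finset.prod_mul_distrib]

/-! ### The operators `T₁₂` and `T₁₃` -/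

/-- The coefficients of the ordering in which `T₁₃` stands to the left of `T₁₂`. -/
def rowCoeffL (c : ℂ) (U β α : Finset D) : ℂ :=
  if β.card = α.card then dprod (g c) β α * dprod (f c) α (U \ α) * dprod (h c) α α else 0

/-- The coefficients of the ordering in which `T₁₂` stands to the left of `T₁₃`. -/
def rowCoeffR (c : ℂ) (U β α : Finset D) : ℂ :=
  if β.card = α.card then dprod (g c) β α * dprod (f c) (U \ α) α * dprod (f c) β (U \ α) *
    dprod (h c) α α else 0

/-- The part of the operator `X` which consists of the entries of the first row, with `T₁₃` to the
left of `T₁₂`. -/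
def rowL (c : ℂ) (T : Fin 3 → Fin 3 → D → A) (U β : Finset D) : A :=
  ∑ α ∈ U.powerset, rowCoeffL c U β α • (symProd (h c) (T 0 2) α * symProd one₂ (T 0 1) (U \ α))

/-- The part of the operator `X` which consists of the entries of the first row, with `T₁₂` to the
left of `T₁₃`. -/
def rowR (c : ℂ) (T : Fin 3 → Fin 3 → D → A) (U β : Finset D) : A :=
  ∑ α ∈ U.powerset, rowCoeffR c U β α • (symProd one₂ (T 0 1) (U \ α) * symProd (h c) (T 0 2) α)

/-- The coefficient of the recursion with respect to the first set of variables. -/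
def recCoeff (c : ℂ) (u : D) (U V : Finset D) (j : D) : ℂ :=
  g c j u * (∏ i ∈ V.erase j, g c i j) * ∏ s ∈ U, f c j s

theorem rowCoeffL_of_subset {c : ℂ} {U β α : Finset D} {u : D} (hu : u ∉ U) (hα : α ⊆ U) :
    rowCoeffL c (insert u U) β α = (∏ s ∈ α, f c s u) * rowCoeffL c U β α := by
  have hu' : u ∉ U \ α := fun e => hu (Finset.mem_sdiff.1 e).1
  rw [rowCoeffL, rowCoeffL, Finset.insert_sdiff_of_notMem _ fun e => hu (hα e),
    dprod_insert_right _ _ hu']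
  split_ifs
  · ring
  · simp

/-- T₁₃(α ∪ u) arises in two ways: T₁₂(u) exchanges its argument with some s in T₁₃(α ∪ s), or
T₁₃(u) is present from the start. After removal of common factors this is the partial fraction
expansion in t = u of ∏ h(t, α) ∏ g(β, t) ∏ f(t, U \ α), with poles at U \ α and at β. -/
theorem rowCoeffL_insert {c : ℂ} (hc : c ≠ 0) {U β α : Finset D} {u : D} (hu : u ∉ U) (huβ : u ∉ β)
    (hUβ : Disjoint U β) (hα : α ⊆ U) :
    rowCoeffL c (insert u U) β (insert u α) =
      (∑ s ∈ U \ α, rowCoeffL c U β (insert s α) * (g c u s * ∏ y ∈ α, g c y s) *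
        ∏ y ∈ α, h c y u) +
      ∑ j ∈ β, recCoeff c u U β j * rowCoeffL c U (β.erase j) α * ∏ y ∈ α, h c y u := by
  have huα : u ∉ α := fun e => hu (hα e)
  by_cases hcard : β.card = α.card + 1
  · have key := prod_g_mul_prod_f_mul_prod_h hc (U := U \ α) (V := β) (t := u) (α := α)
      (hUβ.mono_left Finset.sdiff_subset) (fun e => hu (Finset.mem_sdiff.1 e).1) huβ hcard
    have e0 : rowCoeffL c (insert u U) β (insert u α) =
        (dprod (g c) β α * dprod (f c) α (U \ α) * dprod (h c) α α * ∏ y ∈ α, h c y u) *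
          ((∏ a ∈ α, h c u a) * (∏ j ∈ β, g c j u) * ∏ s ∈ U \ α, f c u s) := by
      rw [rowCoeffL, if_pos (by rw [Finset.card_insert_of_notMem huα, hcard]),
        Finset.insert_sdiff_insert, Finset.sdiff_insert_of_notMem hu]
      simp only [dprod_insert_left _ huα, dprod_insert_right _ _ huα, Finset.prod_insert huα,
        h_self hc]
      ring
    rw [e0, key, mul_add, Finset.mul_sum, Finset.mul_sum]
    congr 1
    · refine Finset.sum_congr rfl fun s hs => ?_
      obtain ⟨hsU, hsα⟩ := Finset.mem_sdiff.1 hs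
      have hs' : s ∉ (U \ α).erase s := Finset.notMem_erase _ _
      rw [rowCoeffL, if_pos (by rw [Finset.card_insert_of_notMem hsα, hcard]),
        Finset.sdiff_insert, ← Finset.insert_erase hs, Finset.erase_insert hs']
      simp only [dprod_insert_left _ hsα, dprod_insert_right _ _ hsα, Finset.prod_insert hsα,
        dprod_insert_right _ _ hs', h_self hc, f_eq_g_mul_h hc, Finset.prod_mul_distrib]
      ring
    · refine Finset.sum_congr rfl fun j hj => ?_
      have hj' : j ∉ β.erase j := Finset.notMem_erase _ _
      have hU : ∏ s ∈ U, f c j s = (∏ s ∈ U \ α, f c j s) * ∏ s ∈ α, f c j s :=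
        (Finset.prod_sdiff hα).symm
      rw [rowCoeffL, if_pos (by rw [Finset.card_erase_of_mem hj]; omega), recCoeff, hU]
      conv_lhs => rw [← Finset.insert_erase hj, Finset.erase_insert hj']
      simp only [dprod_insert_left _ hj', f_eq_g_mul_h hc, Finset.prod_mul_distrib]
      ring
  · rw [rowCoeffL, if_neg (by rwa [Finset.card_insert_of_notMem huα]), Finset.sum_eq_zero,
      Finset.sum_eq_zero, add_zero]
    · intro j hj
      have := Finset.card_pos.2 ⟨j, hj⟩
      rw [rowCoeffL, if_neg (by rw [Finset.card_erase_of_mem hj]; omega)]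
      ring
    · intro s hs
      rw [rowCoeffL, if_neg (by rwa [Finset.card_insert_of_notMem (Finset.mem_sdiff.1 hs).2])]
      ring

/-- Here only T₁₂(u) has to be moved, through T₁₃(α); a T₁₃(u) already stands at the correct place.
-/
theorem rowL_insert {c : ℂ} (hc : c ≠ 0) {T : Fin 3 → Fin 3 → D → A} (hT : IsMonodromy c T)
    {U β : Finset D} {u : D} (hu : u ∉ U) (huβ : u ∉ β) (hUβ : Disjoint U β)
    (hφ : NonvanishingOn (h c) (insert u U)) :
    rowL c T (insert u U) β = T 0 1 u * rowL c T U β +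
      ∑ j ∈ β, recCoeff c u U β j • (T 0 2 u * rowL c T U (β.erase j)) := by
  have s1 := hT.exchangeSymm_even 0 1 rfl
  have s2 := hT.exchangeSymm_odd hc 0 rfl
  have hU : NonvanishingOn (h c) U := hφ.mono (Finset.subset_insert _ _)
  have hP : ∀ α ⊆ U, T 0 1 u * (symProd (h c) (T 0 2) α * symProd one₂ (T 0 1) (U \ α)) =
      (∏ s ∈ α, f c s u) •
        (symProd (h c) (T 0 2) α * symProd one₂ (T 0 1) (insert u (U \ α))) +
      ∑ s ∈ α, ((g c u s * ∏ y ∈ α.erase s, g c y s) * ∏ y ∈ α.erase s, h c y u) •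
        (symProd (h c) (T 0 2) (insert u (α.erase s)) *
          symProd one₂ (T 0 1) (U \ α.erase s)) := fun α hα => by
    have huα : u ∉ α := fun e => hu (hα e)
    rw [← mul_assoc, mul_symProd_odd hc 1 (fun x y => hT.odd_swap 0 rfl) s2
      (fun x y hxy => by rw [one_smul]; exact hT.T01_mul_T02 hxy) (hU.mono hα) huα, one_pow,
      one_smul, add_mul, smul_mul_assoc, mul_assoc, ← symProd_one₂_insert s1
        (fun e => hu (Finset.mem_sdiff.1 e).1), Finset.sum_mul]
    congr 1
    refine Finset.sum_congr rfl fun s hs => ?_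
    have h1 : u ∉ α.erase s := fun e => huα (Finset.mem_of_mem_erase e)
    have h2 : U \ α.erase s = insert s (U \ α) := by
      rw [Finset.sdiff_erase (hα hs)]
    rw [mul_symProd s2 h1 (hφ.mono (Finset.insert_subset_insert _
      ((Finset.erase_subset _ _).trans hα))), smul_mul_assoc, smul_mul_assoc, smul_mul_assoc,
      mul_assoc, ← symProd_one₂_insert s1 (fun e => (Finset.mem_sdiff.1 e).2 hs), smul_smul, h2]
  have hA : T 0 1 u * rowL c T U β =
      (∑ α ∈ U.powerset, ((∏ s ∈ α, f c s u) * rowCoeffL c U β α) •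
        (symProd (h c) (T 0 2) α * symProd one₂ (T 0 1) (insert u (U \ α)))) +
      ∑ α ∈ U.powerset, ∑ s ∈ U \ α, (rowCoeffL c U β (insert s α) *
        (g c u s * ∏ y ∈ α, g c y s) * ∏ y ∈ α, h c y u) •
        (symProd (h c) (T 0 2) (insert u α) * symProd one₂ (T 0 1) (U \ α)) := by
    rw [sum_powerset_sdiff U fun s α => (rowCoeffL c U β (insert s α) *
        (g c u s * ∏ y ∈ α, g c y s) * ∏ y ∈ α, h c y u) •
        (symProd (h c) (T 0 2) (insert u α) * symProd one₂ (T 0 1) (U \ α)),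
      rowL, Finset.mul_sum, ← Finset.sum_add_distrib]
    refine Finset.sum_congr rfl fun α hα => ?_
    rw [mul_smul_comm, hP α (Finset.mem_powerset.1 hα), smul_add, smul_smul, Finset.smul_sum,
      mul_comm]
    congr 1
    refine Finset.sum_congr rfl fun s hs => ?_
    rw [smul_smul, Finset.insert_erase hs]
    congr 1
    ring
  have hB : ∑ j ∈ β, recCoeff c u U β j • (T 0 2 u * rowL c T U (β.erase j)) =
      ∑ α ∈ U.powerset, ∑ j ∈ β, (recCoeff c u U β j * rowCoeffL c U (β.erase j) α *
        ∏ y ∈ α, h c y u) •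
        (symProd (h c) (T 0 2) (insert u α) * symProd one₂ (T 0 1) (U \ α)) := by
    rw [Finset.sum_comm]
    refine Finset.sum_congr rfl fun j _ => ?_
    rw [rowL, Finset.mul_sum, Finset.smul_sum]
    refine Finset.sum_congr rfl fun α hα => ?_
    have hα := Finset.mem_powerset.1 hα
    rw [mul_smul_comm, ← mul_assoc, mul_symProd s2 (fun e => hu (hα e))
      (hφ.mono (Finset.insert_subset_insert _ hα)), smul_mul_assoc, smul_smul, smul_smul,
      mul_assoc]
  rw [hA, hB, rowL, Finset.sum_powerset_insert hu, add_assoc]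
  congr 1
  · refine Finset.sum_congr rfl fun α hα => ?_
    have hα := Finset.mem_powerset.1 hα
    rw [rowCoeffL_of_subset hu hα, Finset.insert_sdiff_of_notMem _ fun e => hu (hα e)]
  · rw [← Finset.sum_add_distrib]
    refine Finset.sum_congr rfl fun α hα => ?_
    have hα := Finset.mem_powerset.1 hα
    rw [rowCoeffL_insert hc hu huβ hUβ hα, Finset.insert_sdiff_insert,
      Finset.sdiff_insert_of_notMem hu, add_smul, Finset.sum_smul, Finset.sum_smul]

/-- In this ordering u can enter T₁₃ only by a direct passage of T₁₃(u) through T₁₂(U \ α), so the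
expansion has poles at β alone. -/
theorem rowCoeffR_insert {c : ℂ} (hc : c ≠ 0) {U β α : Finset D} {u : D} (hu : u ∉ U)
    (huβ : u ∉ β) (hα : α ⊆ U) :
    rowCoeffR c (insert u U) β (insert u α) =
      ∑ j ∈ β, recCoeff c u U β j * rowCoeffR c U (β.erase j) α *
        ((∏ s ∈ U \ α, f c s u) * ∏ y ∈ α, h c y u) := by
  have huα : u ∉ α := fun e => hu (hα e)
  by_cases hcard : β.card = α.card + 1
  · have key := prod_g_mul_prod_f_mul_prod_h hc (U := ∅) (V := β) (t := u) (α := α)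
      (Finset.disjoint_empty_left _) (Finset.notMem_empty _) huβ hcard
    simp only [Finset.prod_empty, Finset.sum_empty, zero_add, mul_one] at key
    have e0 : rowCoeffR c (insert u U) β (insert u α) =
        (dprod (g c) β α * dprod (f c) (U \ α) α * dprod (f c) β (U \ α) * dprod (h c) α α *
          (∏ s ∈ U \ α, f c s u) * ∏ y ∈ α, h c y u) *
          ((∏ a ∈ α, h c u a) * (∏ j ∈ β, g c j u)) := by
      rw [rowCoeffR, if_pos (by rw [Finset.card_insert_of_notMem huα, hcard]),
        Finset.insert_sdiff_insert, Finset.sdiff_insert_of_notMem hu]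
      simp only [dprod_insert_left _ huα, dprod_insert_right _ _ huα, Finset.prod_insert huα,
        h_self hc]
      ring
    rw [e0, key, Finset.mul_sum]
    refine Finset.sum_congr rfl fun j hj => ?_
    have hj' : j ∉ β.erase j := Finset.notMem_erase _ _
    have hU : ∏ s ∈ U, f c j s = (∏ s ∈ U \ α, f c j s) * ∏ s ∈ α, f c j s :=
      (Finset.prod_sdiff hα).symm
    rw [rowCoeffR, if_pos (by rw [Finset.card_erase_of_mem hj]; omega), recCoeff, hU]
    conv_lhs => rw [← Finset.insert_erase hj, Finset.erase_insert hj']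
    simp only [dprod_insert_left _ hj', f_eq_g_mul_h hc, Finset.prod_mul_distrib]
    ring
  · rw [rowCoeffR, if_neg (by rwa [Finset.card_insert_of_notMem huα]), Finset.sum_eq_zero]
    intro j hj
    have := Finset.card_pos.2 ⟨j, hj⟩
    rw [rowCoeffR, if_neg (by rw [Finset.card_erase_of_mem hj]; omega)]
    ring

/-- Adding u to the T₁₂ part multiplies the coefficient by ∏ f(u, α) ∏ f(β, u). By
`prod_f_mul_prod_f_eq` this is 1, the share of the term T₁₂(u), plus a sum over s ∈ α, the share of
the exchanges of T₁₃(u) with T₁₂(s). -/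
theorem rowCoeffR_of_subset {c : ℂ} (hc : c ≠ 0) {U β α : Finset D} {u : D} (hu : u ∉ U)
    (huβ : u ∉ β) (hα : α ⊆ U) (hh : ∀ s ∈ U, h c u s ≠ 0) :
    rowCoeffR c (insert u U) β α = rowCoeffR c U β α +
      ∑ j ∈ β, ∑ s ∈ α, recCoeff c u U β j * rowCoeffR c U (β.erase j) (α.erase s) *
        (g c u s * (∏ y ∈ U \ α, f c y s) * ∏ y ∈ α.erase s, h c y s) := by
  have huα : u ∉ α := fun e => hu (hα e)
  by_cases hcard : β.card = α.card
  · have key := prod_f_mul_prod_f_eq hc hcard huα huβ fun s hs => hh s (hα hs)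
    have huU : u ∉ U \ α := fun e => hu (Finset.mem_sdiff.1 e).1
    have e0 : rowCoeffR c (insert u U) β α =
        rowCoeffR c U β α * ((∏ s ∈ α, f c u s) * ∏ v ∈ β, f c v u) := by
      rw [rowCoeffR, rowCoeffR, if_pos hcard, if_pos hcard, Finset.insert_sdiff_of_notMem _ huα,
        dprod_insert_left _ huU, dprod_insert_right _ _ huU]
      ring
    rw [e0, key, mul_sub, mul_one, sub_eq_add_neg, Finset.sum_comm, Finset.mul_sum,
      Finset.mul_sum, ← Finset.sum_neg_distrib]
    congr 1
    refine Finset.sum_congr rfl fun s hs => ?_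
    have hs' : s ∉ α.erase s := Finset.notMem_erase _ _
    -- A second expansion, with poles at β, splits the summand of s into the contributions of the
    -- single j of the recursion.
    have key2 := prod_g_mul_prod_f_mul_prod_h hc (U := ∅) (V := β) (t := u) (α := α.erase s)
      (Finset.disjoint_empty_left _) (Finset.notMem_empty _) huβ
      (by rw [Finset.card_erase_add_one hs, hcard])
    simp only [Finset.prod_empty, Finset.sum_empty, zero_add, mul_one] at key2
    have e1 : -(rowCoeffR c U β α * ((∏ v ∈ β, g c v u) * (g c s u *
        ((∏ s' ∈ α.erase s, g c s s') * (∏ v ∈ β, h c v s) * ∏ s' ∈ α.erase s, h c u s')))) =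
        (rowCoeffR c U β α * g c u s * (∏ s' ∈ α.erase s, g c s s') * (∏ v ∈ β, h c v s)) *
          ((∏ s' ∈ α.erase s, h c u s') * (∏ v ∈ β, g c v u)) := by
      rw [g_swap c s u]; ring
    rw [e1, key2, Finset.mul_sum]
    refine Finset.sum_congr rfl fun j hj => ?_
    have hj' : j ∉ β.erase j := Finset.notMem_erase _ _
    have hsU : s ∉ U \ α := fun e => (Finset.mem_sdiff.1 e).2 hs
    have hU : ∏ s ∈ U, f c j s = (∏ s ∈ U \ α, f c j s) * ∏ s ∈ α, f c j s :=
      (Finset.prod_sdiff hα).symm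
    rw [rowCoeffR, if_pos hcard, rowCoeffR, if_pos (by
      rw [Finset.card_erase_of_mem hj, Finset.card_erase_of_mem hs, hcard]), recCoeff, hU,
      Finset.sdiff_erase (hα hs)]
    have aux : ∀ β' α' : Finset D, s ∉ α' → j ∉ β' → α = insert s α' → β = insert j β' →
        dprod (g c) β α * dprod (f c) (U \ α) α * dprod (f c) β (U \ α) * dprod (h c) α α *
          g c u s * (∏ s' ∈ α', g c s s') * (∏ v ∈ β, h c v s) *
          (g c j u * ((∏ a ∈ α', h c j a) * ∏ i ∈ β', g c i j)) =
        g c j u * (∏ i ∈ β', g c i j) * ((∏ s ∈ U \ α, f c j s) * ∏ s ∈ α, f c j s) *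
          (dprod (g c) β' α' * dprod (f c) (insert s (U \ α)) α' *
            dprod (f c) β' (insert s (U \ α)) * dprod (h c) α' α') *
          (g c u s * (∏ y ∈ U \ α, f c y s) * ∏ y ∈ α', h c y s) := by
      intro β' α' h1 h2 h3 h4
      rw [dprod_insert_left _ hsU, dprod_insert_right _ _ hsU]
      generalize U \ α = W
      subst h3 h4
      simp only [dprod_insert_left _ h1, dprod_insert_right _ _ h1, Finset.prod_insert h1,
        dprod_insert_left _ h2, Finset.prod_insert h2, h_self hc, f_eq_g_mul_h hc,
        Finset.prod_mul_distrib, dprod_f hc]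
      ring
    exact aux _ _ hs' hj' (Finset.insert_erase hs).symm (Finset.insert_erase hj).symm
  · rw [rowCoeffR, if_neg hcard, rowCoeffR, if_neg hcard, Finset.sum_eq_zero, add_zero]
    intro j hj
    refine Finset.sum_eq_zero fun s hs => ?_
    have h1 := Finset.card_pos.2 ⟨j, hj⟩
    have h2 := Finset.card_pos.2 ⟨s, hs⟩
    rw [rowCoeffR, if_neg (by
      rw [Finset.card_erase_of_mem hj, Finset.card_erase_of_mem hs]; omega)]
    ring

theorem rowR_insert {c : ℂ} (hc : c ≠ 0) {T : Fin 3 → Fin 3 → D → A} (hT : IsMonodromy c T)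
    {U β : Finset D} {u : D} (hu : u ∉ U) (huβ : u ∉ β)
    (hφ : NonvanishingOn (h c) (insert u U)) :
    rowR c T (insert u U) β = T 0 1 u * rowR c T U β +
      ∑ j ∈ β, recCoeff c u U β j • (T 0 2 u * rowR c T U (β.erase j)) := by
  have s1 := hT.exchangeSymm_even 0 1 rfl
  have s2 := hT.exchangeSymm_odd hc 0 rfl
  have hh : ∀ s ∈ U, h c u s ≠ 0 := fun s hs => hφ u (Finset.mem_insert_self _ _) s
    (Finset.mem_insert_of_mem hs) fun e => hu (e ▸ hs)
  have hP : ∀ α ⊆ U, T 0 2 u * (symProd one₂ (T 0 1) (U \ α) * symProd (h c) (T 0 2) α) =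
      ((∏ s ∈ U \ α, f c s u) * ∏ y ∈ α, h c y u) •
        (symProd one₂ (T 0 1) (U \ α) * symProd (h c) (T 0 2) (insert u α)) +
      ∑ s ∈ U \ α, (g c u s * (∏ y ∈ U \ insert s α, f c y s) * ∏ y ∈ α, h c y s) •
        (symProd one₂ (T 0 1) (insert u (U \ insert s α)) *
          symProd (h c) (T 0 2) (insert s α)) := fun α hα => by
    rw [← mul_assoc, mul_symProd_even s1 (fun x y hxy => hT.T02_mul_T01 hxy)
      (fun e => hu (Finset.mem_sdiff.1 e).1), add_mul, smul_mul_assoc, mul_assoc,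
      mul_symProd s2 (fun e => hu (hα e)) (hφ.mono (Finset.insert_subset_insert _ hα)),
      mul_smul_comm, smul_smul, Finset.sum_mul]
    congr 1
    refine Finset.sum_congr rfl fun s hs => ?_
    obtain ⟨hsU, hsα⟩ := Finset.mem_sdiff.1 hs
    have h1 : (U \ α).erase s = U \ insert s α := (Finset.sdiff_insert _ _ _).symm
    have h2 : insert s α ⊆ U := Finset.insert_subset hsU hα
    rw [smul_mul_assoc, mul_assoc, mul_symProd s2 hsα (hφ.mono (h2.trans
      (Finset.subset_insert _ _))), h1, ← symProd_one₂_insert s1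
      (fun e => hu (Finset.mem_sdiff.1 e).1), mul_smul_comm, smul_smul]
  have hB : ∑ j ∈ β, recCoeff c u U β j • (T 0 2 u * rowR c T U (β.erase j)) =
      (∑ α ∈ U.powerset, ∑ j ∈ β, (recCoeff c u U β j * rowCoeffR c U (β.erase j) α *
        ((∏ s ∈ U \ α, f c s u) * ∏ y ∈ α, h c y u)) •
        (symProd one₂ (T 0 1) (U \ α) * symProd (h c) (T 0 2) (insert u α))) +
      ∑ α ∈ U.powerset, ∑ j ∈ β, ∑ s ∈ α,
        (recCoeff c u U β j * rowCoeffR c U (β.erase j) (α.erase s) *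
        (g c u s * (∏ y ∈ U \ α, f c y s) * ∏ y ∈ α.erase s, h c y s)) •
        (symProd one₂ (T 0 1) (insert u (U \ α)) * symProd (h c) (T 0 2) α) := by
    rw [Finset.sum_comm, Finset.sum_comm (s := U.powerset), ← Finset.sum_add_distrib]
    refine Finset.sum_congr rfl fun j _ => ?_
    have h0 : ∑ α ∈ U.powerset, ∑ s ∈ α,
        (recCoeff c u U β j * rowCoeffR c U (β.erase j) (α.erase s) *
        (g c u s * (∏ y ∈ U \ α, f c y s) * ∏ y ∈ α.erase s, h c y s)) •
        (symProd one₂ (T 0 1) (insert u (U \ α)) * symProd (h c) (T 0 2) α) =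
        ∑ α ∈ U.powerset, ∑ s ∈ U \ α,
        (recCoeff c u U β j * rowCoeffR c U (β.erase j) α *
        (g c u s * (∏ y ∈ U \ insert s α, f c y s) * ∏ y ∈ α, h c y s)) •
        (symProd one₂ (T 0 1) (insert u (U \ insert s α)) *
          symProd (h c) (T 0 2) (insert s α)) := by
      rw [sum_powerset_sdiff U fun s α => (recCoeff c u U β j * rowCoeffR c U (β.erase j) α *
        (g c u s * (∏ y ∈ U \ insert s α, f c y s) * ∏ y ∈ α, h c y s)) •
        (symProd one₂ (T 0 1) (insert u (U \ insert s α)) *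
          symProd (h c) (T 0 2) (insert s α))]
      refine Finset.sum_congr rfl fun α _ => Finset.sum_congr rfl fun s hs => ?_
      rw [Finset.insert_erase hs]
    rw [h0, ← Finset.sum_add_distrib, rowR, Finset.mul_sum, Finset.smul_sum]
    refine Finset.sum_congr rfl fun α hα => ?_
    rw [mul_smul_comm, hP α (Finset.mem_powerset.1 hα), smul_add, smul_add, smul_smul, smul_smul,
      Finset.smul_sum, Finset.smul_sum]
    congr 1
    refine Finset.sum_congr rfl fun s _ => ?_
    rw [smul_smul, smul_smul]
  rw [hB, add_comm (∑ α ∈ U.powerset, _), ← add_assoc, rowR, Finset.sum_powerset_insert hu, rowR,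
    Finset.mul_sum]
  congr 1
  · rw [← Finset.sum_add_distrib]
    refine Finset.sum_congr rfl fun α hα => ?_
    have hα := Finset.mem_powerset.1 hα
    rw [rowCoeffR_of_subset hc hu huβ hα hh, Finset.insert_sdiff_of_notMem _ fun e => hu (hα e),
      add_smul, mul_smul_comm, ← mul_assoc,
      ← symProd_one₂_insert s1 (fun e => hu (Finset.mem_sdiff.1 e).1), Finset.sum_smul]
    congr 1
    exact Finset.sum_congr rfl fun j _ => Finset.sum_smul
  · refine Finset.sum_congr rfl fun α hα => ?_
    have hα := Finset.mem_powerset.1 hα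
    rw [rowCoeffR_insert hc hu huβ hα, Finset.insert_sdiff_insert,
      Finset.sdiff_insert_of_notMem hu, Finset.sum_smul]

theorem rowL_eq_rowR {c : ℂ} (hc : c ≠ 0) {T : Fin 3 → Fin 3 → D → A} (hT : IsMonodromy c T)
    {U β : Finset D} (hUβ : Disjoint U β) (hφ : NonvanishingOn (h c) U) :
    rowL c T U β = rowR c T U β := by
  induction U using Finset.induction_on generalizing β with
  | empty => simp [rowL, rowR, rowCoeffL, rowCoeffR]
  | insert u U hu ih =>
    rw [Finset.disjoint_insert_left] at hUβ
    have hφ' : NonvanishingOn (h c) U := hφ.mono (Finset.subset_insert _ _)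
    rw [rowL_insert hc hT hu hUβ.1 hUβ.2 hφ, rowR_insert hc hT hu hUβ.1 hφ, ih hUβ.2 hφ']
    congr 1
    refine Finset.sum_congr rfl fun j _ => ?_
    rw [ih (hUβ.2.mono_right (Finset.erase_subset _ _)) hφ']

/-! ### The two exchange recursions -/

theorem sum_sum_erase_comm {ι M : Type*} [DecidableEq ι] [AddCommMonoid M] (V : Finset ι)
    (F : ι → ι → M) : ∑ j ∈ V, ∑ k ∈ V.erase j, F j k = ∑ j ∈ V, ∑ k ∈ V.erase j, F k j := by
  refine Finset.sum_comm' fun j k => ?_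
  simp only [Finset.mem_erase]
  tauto

/-- A sum over ordered pairs sees only the symmetrised summand. The quadratic terms below agree only
after this symmetrisation, not pair by pair. -/
theorem sum_sum_erase_congr {ι M : Type*} [DecidableEq ι] [AddCommGroup M] [Module ℂ M]
    {V : Finset ι} {F G : ι → ι → M}
    (hFG : ∀ j ∈ V, ∀ k ∈ V, j ≠ k → F j k + F k j = G j k + G k j) :
    ∑ j ∈ V, ∑ k ∈ V.erase j, F j k = ∑ j ∈ V, ∑ k ∈ V.erase j, G j k := by
  have hsum : ∀ F : ι → ι → M, (2 : ℂ) • ∑ j ∈ V, ∑ k ∈ V.erase j, F j k =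
      ∑ j ∈ V, ∑ k ∈ V.erase j, (F j k + F k j) := fun F => by
    simp only [Finset.sum_add_distrib]
    rw [← sum_sum_erase_comm V F, two_smul]
  refine smul_right_injective M (two_ne_zero (α := ℂ)) ?_
  simp only [hsum]
  refine Finset.sum_congr rfl fun j hj => Finset.sum_congr rfl fun k hk => ?_
  obtain ⟨h1, h2⟩ := Finset.mem_erase.1 hk
  exact hFG j hj k h2 h1.symm

/-- The recursion for `X`, adding a variable to the first set on the left. -/
def recL (c : ℂ) (T : Fin 3 → Fin 3 → D → A) (U : Finset D) (X : Finset D → A) (z : D)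
    (V : Finset D) : A :=
  T 0 1 z * X V + ∑ j ∈ V, recCoeff c z U V j • (T 0 2 z * X (V.erase j) * T 1 1 j)

/-- The recursion for `X`, adding a variable to the first set on the right. -/
def recR (c : ℂ) (T : Fin 3 → Fin 3 → D → A) (U : Finset D) (X : Finset D → A) (z : D)
    (V : Finset D) : A :=
  X V * T 0 1 z + ∑ j ∈ V, recCoeff c z U V j • (T 0 2 j * X (V.erase j) * T 1 1 z)

theorem recCoeff_insert (c : ℂ) {U V : Finset D} (z j : D) {p : D} (hp : p ∉ U) :
    recCoeff c z (insert p U) V j = f c j p * recCoeff c z U V j := by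
  rw [recCoeff, recCoeff, Finset.prod_insert hp]; ring

theorem recL_recL (c : ℂ) (T : Fin 3 → Fin 3 → D → A) {U : Finset D} (X : Finset D → A) (z : D)
    {p : D} (hp : p ∉ U) (V : Finset D) :
    recL c T (insert p U) (recL c T U X p) z V = T 0 1 z * T 0 1 p * X V +
      (∑ j ∈ V, (recCoeff c p U V j • (T 0 1 z * T 0 2 p * (X (V.erase j) * T 1 1 j)) +
        (f c j p * recCoeff c z U V j) • (T 0 2 z * T 0 1 p * (X (V.erase j) * T 1 1 j)))) +
      ∑ j ∈ V, ∑ k ∈ V.erase j,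
        (f c j p * recCoeff c z U V j * recCoeff c p U (V.erase j) k) •
          (T 0 2 z * T 0 2 p * (X ((V.erase j).erase k) * (T 1 1 k * T 1 1 j))) := by
  simp only [recL, recCoeff_insert c _ _ hp, mul_add, add_mul, Finset.mul_sum, Finset.sum_mul,
    smul_add, Finset.smul_sum, Finset.sum_add_distrib, mul_smul_comm, smul_mul_assoc, smul_smul,
    mul_assoc]
  abel

/-- The part of `recCoeff` which involves neither the new variable nor the element `k` of `V`. -/
def pairCoeff (c : ℂ) (U V : Finset D) (j k : D) : ℂ :=
  (∏ i ∈ (V.erase j).erase k, g c i j) * ∏ s ∈ U, f c j s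

theorem recCoeff_eq_pairCoeff (c : ℂ) (z : D) (U : Finset D) {V : Finset D} {j k : D}
    (hk : k ∈ V) (hjk : j ≠ k) :
    recCoeff c z U V j = g c j z * g c k j * pairCoeff c U V j k := by
  rw [recCoeff, pairCoeff,
    ← Finset.mul_prod_erase (V.erase j) _ (Finset.mem_erase.2 ⟨hjk.symm, hk⟩)]
  ring

theorem recCoeff_erase (c : ℂ) (z : D) (U V : Finset D) (j k : D) :
    recCoeff c z U (V.erase j) k = g c k z * pairCoeff c U V k j := by
  rw [recCoeff, pairCoeff, Finset.erase_right_comm]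
  ring

/-- Terms are compared by their number of T₁₃: with none, the T₁₂ commute; with one, `g_mul_g`
settles each j; with two, the summands are symmetrised in the pair (j, k). -/
theorem recL_recL_comm (c : ℂ) {T : Fin 3 → Fin 3 → D → A} (hT : IsMonodromy c T) {U : Finset D}
    (X : Finset D → A) {z p : D} (hz : z ∉ U) (hp : p ∉ U) (hzp : z ≠ p) {V : Finset D}
    (hzV : z ∉ V) (hpV : p ∉ V) :
    recL c T (insert p U) (recL c T U X p) z V = recL c T (insert z U) (recL c T U X z) p V := by
  rw [recL_recL c T X z hp, recL_recL c T X p hz, hT.even_comm 0 1 rfl z p]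
  congr 1
  · congr 1
    refine Finset.sum_congr rfl fun j hj => ?_
    have hjz : j ≠ z := fun e => hzV (e ▸ hj)
    have hjp : j ≠ p := fun e => hpV (e ▸ hj)
    rw [hT.T01_mul_T02 hzp, hT.T01_mul_T02 hzp.symm]
    have h1 := g_mul_g c (val_ne hjz) (val_ne hjp) (val_ne hzp)
    have h2 := g_mul_g c (val_ne hjp) (val_ne hjz) (val_ne hzp.symm)
    simp only [recCoeff]
    generalize X (V.erase j) * T 1 1 j = Y
    simp only [add_mul, smul_mul_assoc, smul_add, smul_smul]
    rw [f_eq_one_add_g c (val_ne hzp), f_eq_one_add_g c (val_ne hzp.symm),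
      f_eq_one_add_g c (val_ne hjz), f_eq_one_add_g c (val_ne hjp)]
    rw [g_swap c z j] at h1
    rw [g_swap c p j] at h2
    match_scalars
    · linear_combination -((∏ i ∈ V.erase j, g c i j) * ∏ s ∈ U, f c j s) * h2
    · linear_combination ((∏ i ∈ V.erase j, g c i j) * ∏ s ∈ U, f c j s) * h1
  · refine sum_sum_erase_congr fun j hj k hk hjk => ?_
    have hjz : j ≠ z := fun e => hzV (e ▸ hj)
    have hjp : j ≠ p := fun e => hpV (e ▸ hj)
    have hkz : k ≠ z := fun e => hzV (e ▸ hk)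
    have hkp : k ≠ p := fun e => hpV (e ▸ hk)
    rw [Finset.erase_right_comm (a := k) (b := j), hT.even_comm 1 1 rfl j k]
    generalize X ((V.erase j).erase k) * (T 1 1 k * T 1 1 j) = Y
    have hsw := congrArg (fun a => a * Y) (hT.odd_swap 0 rfl hzp)
    simp only [smul_mul_assoc, neg_mul] at hsw
    rw [recCoeff_eq_pairCoeff c z U hk hjk, recCoeff_eq_pairCoeff c z U hj hjk.symm,
      recCoeff_eq_pairCoeff c p U hk hjk, recCoeff_eq_pairCoeff c p U hj hjk.symm]
    simp only [recCoeff_erase]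
    generalize pairCoeff c U V j k = γj
    generalize pairCoeff c U V k j = γk
    -- The symmetrised coefficient is f(z, p) times a function that is antisymmetric in z and p
    -- through the factor z - p. This is compensated by the exchange relation f(z, p) T₁₃(z) T₁₃(p)
    -- = -f(p, z) T₁₃(p) T₁₃(z).
    have hS : ∀ z p : D, j ≠ z → j ≠ p → k ≠ z → k ≠ p → z ≠ p →
        f c j p * (g c j z * g c k j * γj) * (g c k p * γk) +
        f c k p * (g c k z * g c j k * γk) * (g c j p * γj) =
        (γj * γk * g c j z * g c j p * g c k z * g c k p * ((z - p) / c)) * f c z p := by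
      intro z p hjz hjp hkz hkp hzp
      have n1 := sub_ne_zero.2 (val_ne hjz)
      have n2 := sub_ne_zero.2 (val_ne hjp)
      have n3 := sub_ne_zero.2 (val_ne hkz)
      have n4 := sub_ne_zero.2 (val_ne hkp)
      have n5 := sub_ne_zero.2 (val_ne hzp)
      have n6 := sub_ne_zero.2 (val_ne hjk)
      rw [g_swap c j k]
      have n7 := sub_ne_zero.2 (val_ne hjk.symm)
      simp only [f, g]
      rcases eq_or_ne c 0 with rfl | hc
      · simp
      field_simp
      ring
    rw [← add_smul, ← add_smul, hS z p hjz hjp hkz hkp hzp, hS p z hjp hjz hkp hkz hzp.symm,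
      mul_smul, hsw]
    module

/-- The terms linear in T₁₃ differ by the exchange terms of T₁₂(p) T₁₃(k) and T₂₂(k) T₁₂(z).
Together these contain T₁₂(k) X(V \ k) - X(V \ k) T₁₂(k), which `ih` turns into terms with two T₁₃.
-/
theorem recL_recR_eq_recR_recL (c : ℂ) {T : Fin 3 → Fin 3 → D → A} (hT : IsMonodromy c T)
    {U : Finset D} (X : Finset D → A) {z p : D} (hz : z ∉ U) (hp : p ∉ U) {V : Finset D}
    (hzV : z ∉ V) (hpV : p ∉ V)
    (ih : ∀ k ∈ V, recL c T U X k (V.erase k) = recR c T U X k (V.erase k)) :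
    recL c T (insert z U) (recR c T U X z) p V = recR c T (insert p U) (recL c T U X p) z V := by
  have hL : recL c T (insert z U) (recR c T U X z) p V = T 0 1 p * X V * T 0 1 z +
      (∑ k ∈ V, (recCoeff c z U V k • (T 0 1 p * T 0 2 k * (X (V.erase k) * T 1 1 z)) +
        (f c k z * recCoeff c p U V k) • (T 0 2 p * X (V.erase k) * (T 0 1 z * T 1 1 k)))) +
      ∑ k ∈ V, ∑ j ∈ V.erase k,
        (f c k z * recCoeff c p U V k * recCoeff c z U (V.erase k) j) •
          (T 0 2 p * T 0 2 j * (X ((V.erase k).erase j) * (T 1 1 z * T 1 1 k))) := by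
    simp only [recL, recR, recCoeff_insert c _ _ hz, mul_add, add_mul, Finset.mul_sum,
      Finset.sum_mul, smul_add, Finset.smul_sum, Finset.sum_add_distrib, mul_smul_comm,
      smul_mul_assoc, smul_smul, mul_assoc]
    abel
  have hR : recR c T (insert p U) (recL c T U X p) z V = T 0 1 p * X V * T 0 1 z +
      (∑ k ∈ V, ((f c k p * recCoeff c z U V k) • (T 0 2 k * T 0 1 p * (X (V.erase k) * T 1 1 z)) +
        recCoeff c p U V k • (T 0 2 p * X (V.erase k) * (T 1 1 k * T 0 1 z)))) +
      ∑ k ∈ V, ∑ j ∈ V.erase k,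
        (f c k p * recCoeff c z U V k * recCoeff c p U (V.erase k) j) •
          (T 0 2 k * T 0 2 p * (X ((V.erase k).erase j) * (T 1 1 j * T 1 1 z))) := by
    simp only [recL, recR, recCoeff_insert c _ _ hp, mul_add, add_mul, Finset.mul_sum,
      Finset.sum_mul, smul_add, Finset.smul_sum, Finset.sum_add_distrib, mul_smul_comm,
      smul_mul_assoc, smul_smul, mul_assoc]
    abel
  have hS : ∀ k ∈ V, recCoeff c z U V k • (T 0 1 p * T 0 2 k * (X (V.erase k) * T 1 1 z)) +
        (f c k z * recCoeff c p U V k) • (T 0 2 p * X (V.erase k) * (T 0 1 z * T 1 1 k)) =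
      ((f c k p * recCoeff c z U V k) • (T 0 2 k * T 0 1 p * (X (V.erase k) * T 1 1 z)) +
        recCoeff c p U V k • (T 0 2 p * X (V.erase k) * (T 1 1 k * T 0 1 z))) +
      ∑ j ∈ V.erase k, ((recCoeff c z U V k * g c p k * recCoeff c k U (V.erase k) j) •
          (T 0 2 p * T 0 2 j * (X ((V.erase k).erase j) * (T 1 1 z * T 1 1 k))) -
        (recCoeff c z U V k * g c p k * recCoeff c k U (V.erase k) j) •
          (T 0 2 p * T 0 2 k * (X ((V.erase k).erase j) * (T 1 1 z * T 1 1 j)))) := by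
    intro k hk
    have hkz : k ≠ z := fun e => hzV (e ▸ hk)
    have hkp : k ≠ p := fun e => hpV (e ▸ hk)
    have hI := congrArg (fun a => (recCoeff c z U V k * g c p k) • (T 0 2 p * a * T 1 1 z)) (ih k hk)
    simp only [recL, recR, mul_add, add_mul, Finset.mul_sum, Finset.sum_mul, smul_add,
      Finset.smul_sum, mul_smul_comm, smul_mul_assoc, smul_smul] at hI
    -- This makes the weights of the two exchange terms equal, so that they form a commutator with
    -- X(V \ k).
    have hq : recCoeff c z U V k * g c p k = recCoeff c p U V k * g c z k := by
      rw [recCoeff, recCoeff, g_swap c p k, g_swap c z k]; ring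
    have e1 : ∑ j ∈ V.erase k, ((recCoeff c z U V k * g c p k * recCoeff c k U (V.erase k) j) •
          (T 0 2 p * T 0 2 j * (X ((V.erase k).erase j) * (T 1 1 z * T 1 1 k))) -
        (recCoeff c z U V k * g c p k * recCoeff c k U (V.erase k) j) •
          (T 0 2 p * T 0 2 k * (X ((V.erase k).erase j) * (T 1 1 z * T 1 1 j)))) =
        (recCoeff c z U V k * g c p k) • (T 0 2 p * (T 0 1 k * X (V.erase k)) * T 1 1 z) -
        (recCoeff c z U V k * g c p k) • (T 0 2 p * (X (V.erase k) * T 0 1 k) * T 1 1 z) := by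
      have e2 : ∀ j l m : D, T 0 2 p * (T 0 2 j * X ((V.erase k).erase m) * T 1 1 l) * T 1 1 z =
          T 0 2 p * T 0 2 j * (X ((V.erase k).erase m) * (T 1 1 z * T 1 1 l)) := fun j l m => by
        rw [hT.even_comm 1 1 rfl z l]
        simp only [mul_assoc]
      simp only [e2] at hI
      rw [Finset.sum_sub_distrib, sub_eq_sub_iff_add_eq_add, hI, add_comm]
    rw [e1, hT.T01_mul_T02 hkp.symm, hT.T11_mul_T01 hkz]
    simp only [add_mul, mul_add, smul_mul_assoc, mul_smul_comm, smul_add, smul_smul]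
    rw [hq]
    simp only [mul_assoc]
    module
  rw [hL, hR, Finset.sum_congr rfl hS, Finset.sum_add_distrib, ← add_assoc, add_assoc]
  congr 1
  simp only [← Finset.sum_add_distrib]
  refine sum_sum_erase_congr fun j hj k hk hjk => ?_
  have hjz : j ≠ z := fun e => hzV (e ▸ hj)
  have hjp : j ≠ p := fun e => hpV (e ▸ hj)
  have hkz : k ≠ z := fun e => hzV (e ▸ hk)
  have hkp : k ≠ p := fun e => hpV (e ▸ hk)
  rw [recCoeff_eq_pairCoeff c z U hk hjk, recCoeff_eq_pairCoeff c z U hj hjk.symm,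
    recCoeff_eq_pairCoeff c p U hk hjk, recCoeff_eq_pairCoeff c p U hj hjk.symm]
  simp only [recCoeff_erase]
  rw [Finset.erase_right_comm (a := k) (b := j), hT.even_comm 1 1 rfl j z,
    hT.even_comm 1 1 rfl k z]
  generalize pairCoeff c U V j k = γj
  generalize pairCoeff c U V k j = γk
  have e1 : ∀ k : D, k ≠ p → ∀ (a b : ℂ) (Y : A),
      (f c k p * a * b) • (T 0 2 k * T 0 2 p * Y) =
      -((f c p k * a * b) • (T 0 2 p * T 0 2 k * Y)) := fun k hkp a b Y => by
    have := congrArg (fun x => (a * b) • (x * Y)) (hT.odd_swap 0 rfl hkp)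
    simp only [smul_mul_assoc, neg_mul] at this
    linear_combination (norm := module) this
  rw [e1 j hjp, e1 k hkp]
  -- The four-point identity that remains for the terms with two T₁₃ after symmetrisation; both
  -- orders of (j, k) are needed.
  have hS : ∀ j k : D, j ≠ z → j ≠ p → k ≠ z → k ≠ p → j ≠ k →
      f c k z * g c k p * g c j k * g c j z + g c k z * g c p k * g c j k * g c j k -
        g c j z * g c p j * g c k j * g c k j = -(f c p j * g c j z * g c k j * g c k p) := by
    intro j k hjz hjp hkz hkp hjk
    have n1 := sub_ne_zero.2 (val_ne hjz)
    have n2 := sub_ne_zero.2 (val_ne hjp)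
    have n3 := sub_ne_zero.2 (val_ne hkz)
    have n4 := sub_ne_zero.2 (val_ne hkp)
    have n6 := sub_ne_zero.2 (val_ne hjk)
    have n7 := sub_ne_zero.2 (val_ne hjk.symm)
    have n8 := sub_ne_zero.2 (val_ne hjp.symm)
    rw [g_swap c p k, g_swap c p j, g_swap c k j]
    simp only [f, g]
    field_simp
    ring
  have k1 := hS j k hjz hjp hkz hkp hjk
  have k2 := hS k j hkz hkp hjz hjp hjk.symm
  match_scalars
  · linear_combination γj * γk * k2
  · linear_combination γj * γk * k1

/-- Peel T₂₃(w) off the left end. Its commutator with T₁₂(z) gives T₁₃ T₂₂; the induction hypothesis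
moves T₁₂(z) through the remaining product and `mul_symProd_odd` moves T₂₂. -/
theorem recL_symProd_eq_recR_symProd {c : ℂ} (hc : c ≠ 0) {T : Fin 3 → Fin 3 → D → A}
    (hT : IsMonodromy c T) {z : D} {V : Finset D} (hzV : z ∉ V) (hφ : NonvanishingOn (h c) V) :
    recL c T ∅ (symProd (h c) (T 1 2)) z V = recR c T ∅ (symProd (h c) (T 1 2)) z V := by
  have s2 := hT.exchangeSymm_odd hc 1 rfl
  induction V using Finset.induction_on with
  | empty => simp [recL, recR]
  | insert w W hw ih =>
    rw [Finset.mem_insert, not_or] at hzV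
    have hzw : z ≠ w := hzV.1
    have hW : NonvanishingOn (h c) W := hφ.mono (Finset.subset_insert _ _)
    have ih := ih hzV.2 hW
    set P : Finset D → A := symProd (h c) (T 1 2) with hP
    have hex : ∀ x, x ∉ W → T 1 1 x * P W = (∏ y ∈ W, f c y x) • (P W * T 1 1 x) +
        ∑ s ∈ W, (g c x s * ∏ y ∈ W.erase s, g c y s) • (T 1 2 x * P (W.erase s) * T 1 1 s) :=
      fun x hx => by
        have := mul_symProd_odd hc (a := T 1 1) (b := T 1 2) 1 (fun x y => hT.odd_swap 1 rfl) s2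
          (fun x y hxy => by rw [one_smul]; exact hT.T11_mul_T12 hxy) hW hx
        rwa [one_pow, one_smul] at this
    have hPj : ∀ j ∈ W, T 1 2 j * P (W.erase j) = (∏ y ∈ W.erase j, h c y j) • P W :=
      fun j hj => by
        rw [hP, mul_symProd s2 (Finset.notMem_erase _ _) (by rwa [Finset.insert_erase hj]),
          Finset.insert_erase hj]
    have hN := hφ.prod_ne_zero hw
    have hPw : P (insert w W) = (∏ y ∈ W, h c y w)⁻¹ • (T 1 2 w * P W) :=
      symProd_insert s2 hw hφ
    have hPwj : ∀ j ∈ W, P ((insert w W).erase j) =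
        ((∏ y ∈ W, h c y w)⁻¹ * h c j w) • (T 1 2 w * P (W.erase j)) := fun j hj => by
      have hjw : w ≠ j := fun e => hw (e ▸ hj)
      have h1 : h c j w ≠ 0 := hφ j (Finset.mem_insert_of_mem hj) w (Finset.mem_insert_self _ _)
        hjw.symm
      rw [Finset.erase_insert_of_ne hjw, hP, symProd_insert s2
        (fun e => hw (Finset.mem_of_mem_erase e)) (hφ.mono (Finset.insert_subset_insert _
          (Finset.erase_subset _ _))), ← Finset.mul_prod_erase W _ hj]
      congr 1
      field_simp
    have hr : ∀ j, recCoeff c z ∅ W j = g c j z * ∏ i ∈ W.erase j, g c i j := fun j => by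
      simp [recCoeff]
    have hr' : ∀ j ∈ W, recCoeff c z ∅ (insert w W) j =
        g c j z * (g c w j * ∏ i ∈ W.erase j, g c i j) := fun j hj => by
      have hjw : w ≠ j := fun e => hw (e ▸ hj)
      rw [recCoeff, Finset.erase_insert_of_ne hjw,
        Finset.prod_insert (fun e => hw (Finset.mem_of_mem_erase e))]
      simp
    have hrw : recCoeff c z ∅ (insert w W) w = g c w z * ∏ i ∈ W, g c i w := by
      rw [recCoeff, Finset.erase_insert hw]; simp
    -- This collects the coefficient of T₁₃(w) P(W) T₂₂(z), to which every j ∈ W contributes. The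
    -- other types of terms are compared for each j separately in `hsum`.
    have key := g_mul_prod_f_mul_prod_f hc (U := ∅) (V := W) (Finset.disjoint_empty_left _)
      (Finset.notMem_empty _) hzV.2 (Finset.notMem_empty _) hw (x := w) (t := z) hzw.symm
    simp only [Finset.prod_empty, Finset.sum_empty, mul_one, one_mul, add_zero] at key
    have hf : ∏ y ∈ W, f c y w = (∏ y ∈ W, g c y w) * ∏ y ∈ W, h c y w := by
      rw [← Finset.prod_mul_distrib]
      exact Finset.prod_congr rfl fun y _ => f_eq_g_mul_h hc _ _
    have hfj : ∀ j : D, ∏ y ∈ W.erase j, f c y j =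
        (∏ y ∈ W.erase j, g c y j) * ∏ y ∈ W.erase j, h c y j := fun j => by
      rw [← Finset.prod_mul_distrib]
      exact Finset.prod_congr rfl fun y _ => f_eq_g_mul_h hc _ _
    have hL : T 0 1 z * P W = P W * T 0 1 z + ∑ j ∈ W, (recCoeff c z ∅ W j •
        (T 0 2 j * (P (W.erase j) * T 1 1 z)) - recCoeff c z ∅ W j •
        (T 0 2 z * (P (W.erase j) * T 1 1 j))) := by
      rw [Finset.sum_sub_distrib, ← add_sub_assoc, eq_sub_iff_add_eq]
      simpa only [recL, recR, mul_assoc] using ih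
    have hA : T 1 2 w * (T 0 1 z * P W) = T 1 2 w * P W * T 0 1 z +
        ∑ j ∈ W, ((-(g c j z * (∏ i ∈ W.erase j, g c i j) * f c j w)) •
            (T 0 2 j * T 1 2 w * (P (W.erase j) * T 1 1 z)) +
          (g c j z * (∏ i ∈ W.erase j, g c i j) * f c z w) •
            (T 0 2 z * T 1 2 w * (P (W.erase j) * T 1 1 j)) +
          (g c j z * (∏ i ∈ W.erase j, g c i j) * g c w z) •
            (T 0 2 w * T 1 2 z * (P (W.erase j) * T 1 1 j))) -
        (∑ j ∈ W, g c j z * (∏ i ∈ W.erase j, f c i j) * g c w j) •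
          (T 0 2 w * P W * T 1 1 z) := by
      rw [hL, mul_add, ← mul_assoc, Finset.mul_sum, add_sub_assoc, Finset.sum_smul,
        ← Finset.sum_sub_distrib]
      congr 1
      refine Finset.sum_congr rfl fun j hj => ?_
      have hjw : w ≠ j := fun e => hw (e ▸ hj)
      rw [mul_sub, mul_smul_comm, mul_smul_comm, ← mul_assoc (T 1 2 w), ← mul_assoc (T 1 2 w),
        hT.T12_mul_T02 hjw, hT.T12_mul_T02 hzw.symm, hr]
      have e1 : T 0 2 w * T 1 2 j * (P (W.erase j) * T 1 1 z) =
          (∏ y ∈ W.erase j, h c y j) • (T 0 2 w * P W * T 1 1 z) := by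
        rw [mul_assoc, ← mul_assoc (T 1 2 j), hPj j hj, smul_mul_assoc, mul_smul_comm, mul_assoc]
      simp only [neg_mul, add_mul, smul_mul_assoc]
      rw [e1, hfj]
      module
    have hB : T 0 2 z * (T 1 1 w * P W) = (∏ y ∈ W, f c y w) • (T 0 2 z * P W * T 1 1 w) +
        ∑ j ∈ W, (g c w j * ∏ y ∈ W.erase j, g c y j) •
          (T 0 2 z * T 1 2 w * (P (W.erase j) * T 1 1 j)) := by
      rw [hex w hw, mul_add, mul_smul_comm, Finset.mul_sum]
      simp only [mul_smul_comm, mul_assoc]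
    have hC : T 0 2 w * (T 1 1 z * P W) = (∏ y ∈ W, f c y z) • (T 0 2 w * P W * T 1 1 z) +
        ∑ j ∈ W, (g c z j * ∏ y ∈ W.erase j, g c y j) •
          (T 0 2 w * T 1 2 z * (P (W.erase j) * T 1 1 j)) := by
      rw [hex z hzV.2, mul_add, mul_smul_comm, Finset.mul_sum]
      simp only [mul_smul_comm, mul_assoc]
    have hM : T 0 1 z * (T 1 2 w * P W) = T 1 2 w * (T 0 1 z * P W) +
        g c z w • (T 0 2 z * (T 1 1 w * P W)) - g c z w • (T 0 2 w * (T 1 1 z * P W)) := by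
      rw [← mul_assoc, hT.T01_mul_T12 hzw]
      simp only [add_mul, sub_mul, smul_mul_assoc, mul_assoc, smul_sub]
      abel
    have hsum : ∑ j ∈ W, ((-(g c j z * (∏ i ∈ W.erase j, g c i j) * f c j w)) •
            (T 0 2 j * T 1 2 w * (P (W.erase j) * T 1 1 z)) +
          (g c j z * (∏ i ∈ W.erase j, g c i j) * f c z w) •
            (T 0 2 z * T 1 2 w * (P (W.erase j) * T 1 1 j)) +
          (g c j z * (∏ i ∈ W.erase j, g c i j) * g c w z) •
            (T 0 2 w * T 1 2 z * (P (W.erase j) * T 1 1 j))) +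
        g c z w • ∑ j ∈ W, (g c w j * ∏ y ∈ W.erase j, g c y j) •
          (T 0 2 z * T 1 2 w * (P (W.erase j) * T 1 1 j)) -
        g c z w • ∑ j ∈ W, (g c z j * ∏ y ∈ W.erase j, g c y j) •
          (T 0 2 w * T 1 2 z * (P (W.erase j) * T 1 1 j)) =
        ∑ j ∈ W, (g c j z * (g c w j * ∏ i ∈ W.erase j, g c i j) * h c j w) •
          (T 0 2 j * T 1 2 w * (P (W.erase j) * T 1 1 z)) -
        ∑ j ∈ W, (g c j z * (g c w j * ∏ i ∈ W.erase j, g c i j) * h c j w) •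
          (T 0 2 z * T 1 2 w * (P (W.erase j) * T 1 1 j)) := by
      rw [Finset.smul_sum, Finset.smul_sum, ← Finset.sum_add_distrib, ← Finset.sum_sub_distrib,
        ← Finset.sum_sub_distrib]
      refine Finset.sum_congr rfl fun j hj => ?_
      have hjw : w ≠ j := fun e => hw (e ▸ hj)
      have hjz : z ≠ j := fun e => hzV.2 (e ▸ hj)
      have k1 : g c j z * g c z w + g c z w * g c w j = -(g c j z * g c w j) := by
        have n1 := sub_ne_zero.2 (val_ne hjw)
        have n2 := sub_ne_zero.2 (val_ne hjz.symm)
        have n3 := sub_ne_zero.2 (val_ne hzw)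
        simp only [g]
        field_simp
        ring
      have k2 := f_eq_g_mul_h hc j w
      rw [g_swap c j w] at k2
      have k3 := f_eq_one_sub_g c (val_ne hjw.symm)
      rw [f_eq_one_add_g c (val_ne hzw), g_swap c w z, g_swap c z j]
      match_scalars
      · linear_combination -(g c j z * ∏ i ∈ W.erase j, g c i j) * k2
      · linear_combination (∏ i ∈ W.erase j, g c i j) * (k1 + g c j z * (k2 - k3))
      · ring
    have hLs : ∀ j ∈ W, recCoeff c z ∅ (insert w W) j •
          (T 0 2 z * P ((insert w W).erase j) * T 1 1 j) =
        (∏ y ∈ W, h c y w)⁻¹ • ((g c j z * (g c w j * ∏ i ∈ W.erase j, g c i j) * h c j w) •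
          (T 0 2 z * T 1 2 w * (P (W.erase j) * T 1 1 j))) := fun j hj => by
      rw [hr' j hj, hPwj j hj]
      simp only [mul_smul_comm, smul_mul_assoc, smul_smul, mul_assoc]
      congr 1
      ring
    have hRs : ∀ j ∈ W, recCoeff c z ∅ (insert w W) j •
          (T 0 2 j * P ((insert w W).erase j) * T 1 1 z) =
        (∏ y ∈ W, h c y w)⁻¹ • ((g c j z * (g c w j * ∏ i ∈ W.erase j, g c i j) * h c j w) •
          (T 0 2 j * T 1 2 w * (P (W.erase j) * T 1 1 z))) := fun j hj => by
      rw [hr' j hj, hPwj j hj]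
      simp only [mul_smul_comm, smul_mul_assoc, smul_smul, mul_assoc]
      congr 1
      ring
    have hrw' : recCoeff c z ∅ (insert w W) w =
        (∏ y ∈ W, h c y w)⁻¹ * (g c w z * ∏ y ∈ W, f c y w) := by
      rw [hrw, hf]; field_simp
    have hS : ∑ j ∈ W, g c j z * (∏ i ∈ W.erase j, f c i j) * g c w j =
        g c w z * (∏ y ∈ W, f c y z) - g c w z * ∏ y ∈ W, f c y w := by
      rw [key, add_sub_cancel_left]
      exact Finset.sum_congr rfl fun j _ => mul_assoc _ _ _
    rw [recL, recR, Finset.sum_insert hw, Finset.sum_insert hw, Finset.sum_congr rfl hLs,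
      Finset.sum_congr rfl hRs, ← Finset.smul_sum, ← Finset.smul_sum, Finset.erase_insert hw, hPw,
      hrw', mul_smul_comm, hM, hA, hB, hC, hS, smul_add (g c z w), smul_add (g c z w),
      smul_mul_assoc, mul_smul (∏ y ∈ W, h c y w)⁻¹, mul_smul (∏ y ∈ W, h c y w)⁻¹]
    simp only [← smul_add]
    congr 1
    rw [g_swap c w z] at hsum ⊢
    linear_combination (norm := module) hsum

/-! ### The left and right recursions for X -/

/-- The operator `X` for two finite sets of variables. -/
def xOp (c : ℂ) (T : Fin 3 → Fin 3 → D → A) (U V : Finset D) : A :=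
  ∑ β ∈ V.powerset, dprod (g c) (V \ β) β •
    (rowL c T U β * symProd (h c) (T 1 2) (V \ β) * symProd one₂ (T 1 1) β)

theorem rowL_empty (c : ℂ) (T : Fin 3 → Fin 3 → D → A) (β : Finset D) :
    rowL c T ∅ β = if β = ∅ then 1 else 0 := by
  rw [rowL, Finset.powerset_empty, Finset.sum_singleton, rowCoeffL]
  simp [Finset.card_eq_zero]

theorem xOp_empty (c : ℂ) (T : Fin 3 → Fin 3 → D → A) (V : Finset D) :
    xOp c T ∅ V = symProd (h c) (T 1 2) V := by
  rw [xOp, Finset.sum_eq_single ∅]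
  · simp [rowL_empty, symProd_empty]
  · intro β _ hβ
    simp [rowL_empty, hβ]
  · intro hV
    exact absurd (Finset.empty_mem_powerset V) hV

theorem erase_sdiff_erase_of_mem {ι : Type*} [DecidableEq ι] (V : Finset ι) {β : Finset ι} {j : ι}
    (hj : j ∈ β) : V.erase j \ β.erase j = V \ β := by
  ext x; simp only [Finset.mem_sdiff, Finset.mem_erase]
  by_cases hx : x = j
  · subst hx; simp [hj]
  · simp [hx]

/-- The recursion of the first-row part, summed over β: for j ∈ β the operator T₂₂(j) splits off at
the right end, and the factors g(V \ β, j) complete the coefficient for β to the one for V. -/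
theorem xOp_insert {c : ℂ} (hc : c ≠ 0) {T : Fin 3 → Fin 3 → D → A} (hT : IsMonodromy c T)
    {U V : Finset D} {u : D} (hu : u ∉ U) (huV : u ∉ V) (hUV : Disjoint U V)
    (hφ : NonvanishingOn (h c) (insert u U)) :
    xOp c T (insert u U) V = recL c T U (xOp c T U) u V := by
  have s1 := hT.exchangeSymm_even 1 1 rfl
  have hB : ∑ j ∈ V, recCoeff c u U V j • (T 0 2 u * xOp c T U (V.erase j) * T 1 1 j) =
      ∑ β ∈ V.powerset, ∑ j ∈ β, recCoeff c u U V j • (T 0 2 u *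
        (dprod (g c) (V.erase j \ β.erase j) (β.erase j) • (rowL c T U (β.erase j) *
          symProd (h c) (T 1 2) (V.erase j \ β.erase j) * symProd one₂ (T 1 1) (β.erase j))) *
            T 1 1 j) := by
    rw [← sum_powerset_sdiff V fun j β => recCoeff c u U V j • (T 0 2 u *
        (dprod (g c) (V.erase j \ β) β • (rowL c T U β *
          symProd (h c) (T 1 2) (V.erase j \ β) * symProd one₂ (T 1 1) β)) * T 1 1 j),
      ← sum_sum_powerset_erase]
    refine Finset.sum_congr rfl fun j _ => ?_
    rw [xOp, Finset.mul_sum, Finset.sum_mul, Finset.smul_sum]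
  rw [recL, hB, xOp, xOp, Finset.mul_sum, ← Finset.sum_add_distrib]
  refine Finset.sum_congr rfl fun β hβ => ?_
  have hβ := Finset.mem_powerset.1 hβ
  rw [rowL_insert hc hT hu (fun e => huV (hβ e)) (hUV.mono_right hβ) hφ]
  simp only [add_mul, smul_add, Finset.sum_mul, Finset.smul_sum]
  congr 1
  · simp only [mul_smul_comm, mul_assoc]
  · refine Finset.sum_congr rfl fun j hj => ?_
    have hj' : j ∉ β.erase j := Finset.notMem_erase _ _
    have e1 := erase_sdiff_erase_of_mem V hj
    have e2 : dprod (g c) (V \ β) β = (∏ i ∈ V \ β, g c i j) * dprod (g c) (V \ β) (β.erase j) := by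
      rw [← dprod_insert_right _ _ hj', Finset.insert_erase hj]
    have e3 : symProd one₂ (T 1 1) β = symProd one₂ (T 1 1) (β.erase j) * T 1 1 j := by
      rw [← symProd_one₂_insert_right s1 hj', Finset.insert_erase hj]
    have e4 : ∏ i ∈ V.erase j, g c i j = (∏ i ∈ V \ β, g c i j) * ∏ i ∈ β.erase j, g c i j := by
      rw [← e1, Finset.prod_sdiff (Finset.erase_subset_erase j hβ)]
    rw [e1, e2, e3, recCoeff, recCoeff, e4]
    simp only [mul_smul_comm, smul_mul_assoc, smul_smul, mul_assoc]
    congr 1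
    ring

theorem recL_congr (c : ℂ) (T : Fin 3 → Fin 3 → D → A) (U : Finset D) {X Y : Finset D → A} (z : D)
    {V : Finset D} (hXY : ∀ W ⊆ V, X W = Y W) : recL c T U X z V = recL c T U Y z V := by
  rw [recL, recL, hXY V subset_rfl]
  congr 1
  refine Finset.sum_congr rfl fun j _ => ?_
  rw [hXY _ (Finset.erase_subset _ _)]

theorem recR_congr (c : ℂ) (T : Fin 3 → Fin 3 → D → A) (U : Finset D) {X Y : Finset D → A} (z : D)
    {V : Finset D} (hXY : ∀ W ⊆ V, X W = Y W) : recR c T U X z V = recR c T U Y z V := by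
  rw [recR, recR, hXY V subset_rfl]
  congr 1
  refine Finset.sum_congr rfl fun j _ => ?_
  rw [hXY _ (Finset.erase_subset _ _)]

theorem recL_xOp_eq_recR_xOp {c : ℂ} (hc : c ≠ 0) {T : Fin 3 → Fin 3 → D → A}
    (hT : IsMonodromy c T) {U : Finset D} (hU : NonvanishingOn (h c) U) :
    ∀ {V : Finset D} {z : D}, z ∉ U → z ∉ V → Disjoint U V → NonvanishingOn (h c) V →
      recL c T U (xOp c T U) z V = recR c T U (xOp c T U) z V := by
  induction U using Finset.induction_on with
  | empty =>
    intro V z _ hzV _ hV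
    rw [recL_congr c T ∅ z fun W _ => xOp_empty c T W, recR_congr c T ∅ z fun W _ => xOp_empty c T W]
    exact recL_symProd_eq_recR_symProd hc hT hzV hV
  | insert p U hp ih =>
    intro V z hz hzV hUV hV
    rw [Finset.mem_insert, not_or] at hz
    rw [Finset.disjoint_insert_left] at hUV
    obtain ⟨hpV, hUV⟩ := hUV
    have hX : ∀ W ⊆ V, xOp c T (insert p U) W = recL c T U (xOp c T U) p W := fun W hW =>
      xOp_insert hc hT hp (fun e => hpV (hW e)) (hUV.mono_right hW) hU
    -- The hypothesis is needed for z with every subset of V, and also with each k ∈ V in the role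
    -- of z and the set V \ k; hence the quantification over V and z.
    have ih := fun {V : Finset D} {z : D} => ih (hU.mono (Finset.subset_insert _ _)) (V := V) (z := z)
    rw [recL_congr c T _ z hX, recR_congr c T _ z hX,
      recL_recL_comm c hT _ hz.2 hp hz.1 hzV hpV, recL_congr c T _ p fun W hW =>
        ih hz.2 (fun e => hzV (hW e)) (hUV.mono_right hW) (hV.mono hW)]
    exact recL_recR_eq_recR_recL c hT _ hz.2 hp hzV hpV fun k hk =>
      ih (Finset.disjoint_right.1 hUV hk) (Finset.notMem_erase _ _)
        (hUV.mono_right (Finset.erase_subset _ _)) (hV.mono (Finset.erase_subset _ _))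

/-! ### The domain wall partition function -/

/-- The product of the `g (x j) (x k)` over all pairs `j < k`. -/
def gProd (c : ℂ) {n : ℕ} (x : Fin n → ℂ) : ℂ := ∏ j, ∏ k ∈ Finset.Ioi j, g c (x j) (x k)

theorem gProd_eq_div (c : ℂ) {n : ℕ} (x : Fin n → ℂ) :
    gProd c x = (∏ j : Fin n, ∏ _k ∈ Finset.Ioi j, -c) / (Matrix.vandermonde x).det := by
  rw [gProd, Matrix.det_vandermonde, ← Finset.prod_div_distrib]
  refine Finset.prod_congr rfl fun j _ => ?_
  rw [← Finset.prod_div_distrib]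
  refine Finset.prod_congr rfl fun k _ => ?_
  rw [g, ← neg_sub (x k), div_neg, neg_div]

/-- Up to a constant the product is the inverse of a Vandermonde determinant. In K this sign cancels
that of the other determinant, which makes K symmetric in each set of variables. -/
theorem gProd_comp_perm (c : ℂ) {n : ℕ} (x : Fin n → ℂ) (σ : Equiv.Perm (Fin n)) :
    gProd c (x ∘ σ) = ((Equiv.Perm.sign σ : ℤ) : ℂ) * gProd c x := by
  have hv : Matrix.vandermonde (x ∘ σ) = (Matrix.vandermonde x).submatrix σ id := by
    ext i j
    simp [Matrix.vandermonde]
  rw [gProd_eq_div, gProd_eq_div, hv, Matrix.det_permute]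
  rcases Int.units_eq_one_or (Equiv.Perm.sign σ) with e | e <;> simp [e, div_neg]

theorem prod_Iio_g (c : ℂ) {n : ℕ} (y : Fin n → ℂ) :
    ∏ j, ∏ k ∈ Finset.Iio j, g c (y j) (y k) =
      (∏ j : Fin n, ∏ _k ∈ Finset.Ioi j, (-1 : ℂ)) * gProd c y := by
  rw [gProd, ← Finset.prod_mul_distrib]
  simp only [← Finset.prod_mul_distrib, neg_one_mul, ← g_swap]
  exact Finset.prod_comm' fun j k => by simp

theorem K_eq (c : ℂ) {n : ℕ} (x y : Fin n → ℂ) :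
    K c x y = (∏ j : Fin n, ∏ _k ∈ Finset.Ioi j, (-1 : ℂ)) * gProd c x * gProd c y *
      (∏ j, ∏ k, h c (x j) (y k)) *
        Matrix.det (Matrix.of fun j k : Fin n => g c (x j) (y k) / h c (x j) (y k)) := by
  rw [K, prod_Iio_g, ← gProd]
  ring

theorem K_comp_perm_left (c : ℂ) {n : ℕ} (x y : Fin n → ℂ) (σ : Equiv.Perm (Fin n)) :
    K c (x ∘ σ) y = K c x y := by
  rw [K_eq, K_eq, gProd_comp_perm]
  have h1 := Matrix.det_permute σ
    (Matrix.of fun j k : Fin n => g c (x j) (y k) / h c (x j) (y k))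
  rw [show (Matrix.of fun j k : Fin n => g c ((x ∘ σ) j) (y k) / h c ((x ∘ σ) j) (y k)) =
    (Matrix.of fun j k : Fin n => g c (x j) (y k) / h c (x j) (y k)).submatrix σ id from rfl, h1,
    show ∏ j, ∏ k, h c ((x ∘ σ) j) (y k) = ∏ j, ∏ k, h c (x j) (y k) from
      Equiv.prod_comp σ fun j => ∏ k, h c (x j) (y k)]
  rcases Int.units_eq_one_or (Equiv.Perm.sign σ) with e | e <;> simp [e]

theorem K_comp_perm_right (c : ℂ) {n : ℕ} (x y : Fin n → ℂ) (σ : Equiv.Perm (Fin n)) :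
    K c x (y ∘ σ) = K c x y := by
  rw [K_eq, K_eq, gProd_comp_perm]
  have h1 := Matrix.det_permute' σ
    (Matrix.of fun j k : Fin n => g c (x j) (y k) / h c (x j) (y k))
  rw [show (Matrix.of fun j k : Fin n => g c (x j) ((y ∘ σ) k) / h c (x j) ((y ∘ σ) k)) =
    (Matrix.of fun j k : Fin n => g c (x j) (y k) / h c (x j) (y k)).submatrix id σ from rfl, h1,
    show ∏ j, ∏ k, h c (x j) ((y ∘ σ) k) = ∏ j, ∏ k, h c (x j) (y k) from
      Finset.prod_congr rfl fun j _ => Equiv.prod_comp σ fun k => h c (x j) (y k)]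
  rcases Int.units_eq_one_or (Equiv.Perm.sign σ) with e | e <;> simp [e]

theorem gProd_cons (c : ℂ) {n : ℕ} (x₀ : ℂ) (x : Fin n → ℂ) :
    gProd c (Fin.cons x₀ x : Fin (n + 1) → ℂ) = (∏ i, g c x₀ (x i)) * gProd c x := by
  simp [gProd, Fin.prod_univ_succ]

/-- A cycle of sign (-1)^j brings x_j to the front. -/
theorem gProd_eq_succAbove (c : ℂ) {n : ℕ} (x : Fin (n + 1) → ℂ) (j : Fin (n + 1)) :
    gProd c x = (-1) ^ (j : ℕ) * (∏ i, g c (x j) (x (j.succAbove i))) *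
      gProd c (x ∘ j.succAbove) := by
  have hx : x ∘ j.cycleRange.symm = Fin.cons (x j) (x ∘ j.succAbove) := by
    funext i
    refine Fin.cases ?_ (fun i => ?_) i <;> simp
  have h1 := gProd_comp_perm c x j.cycleRange.symm
  rw [hx, gProd_cons, Equiv.Perm.sign_symm, Fin.sign_cycleRange] at h1
  push_cast at h1
  simp only [Function.comp_apply] at h1
  rw [mul_assoc, h1, ← mul_assoc, ← mul_pow]
  simp

theorem prod_neg_comm (c : ℂ) {ι : Type*} (s : Finset ι) (t : ℂ) (x : ι → ℂ) :
    ∏ i ∈ s, g c t (x i) = (-1) ^ s.card * ∏ i ∈ s, g c (x i) t := by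
  rw [← Finset.prod_const, ← Finset.prod_mul_distrib]
  exact Finset.prod_congr rfl fun i _ => by rw [neg_one_mul, ← g_swap]

/-- A linear combination of the columns of the matrix in K that has product form. Division by h(x_j,
y_k) removes the factor i = j, and the sum interpolates ∏_{i ≠ j} h(x_i, X) at the nodes y,
evaluated at x_j. -/
theorem sum_mul_g_div_h {c : ℂ} {n : ℕ} {x y : Fin (n + 1) → ℂ} (hy : Function.Injective y)
    (hxy : ∀ i j, x i ≠ y j) (hh : ∀ i j, h c (x i) (y j) ≠ 0) (j : Fin (n + 1)) :
    ∑ k, ((∏ i, h c (x i) (y k)) * ∏ l ∈ Finset.univ.erase k, g c (y k) (y l)) *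
        (g c (x j) (y k) / h c (x j) (y k)) =
      (∏ i ∈ Finset.univ.erase j, h c (x i) (x j)) * ∏ k, g c (x j) (y k) := by
  have key := eval_mul_prod_g c (s := Finset.univ) (x := y) hy.injOn
    (P := ∏ i ∈ Finset.univ.erase j, hPoly' c (x i))
    (degree_prod_lt (s := Finset.univ.erase j) (n := (Finset.univ : Finset (Fin (n + 1))).card)
      (fun i _ => natDegree_hPoly' c (x i)) (by simp)) (t := x j) (fun i _ => (hxy j i).symm)
  simp only [Polynomial.eval_prod, eval_hPoly'] at key
  rw [prod_neg_comm, mul_left_comm, key, Finset.mul_sum]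
  refine Finset.sum_congr rfl fun k _ => ?_
  rw [prod_neg_comm, g_swap c (y k) (x j), Finset.card_erase_of_mem (Finset.mem_univ k),
    ← Finset.mul_prod_erase Finset.univ (fun i => h c (x i) (y k)) (Finset.mem_univ j)]
  have := hh j k
  simp only [Finset.card_univ, Fintype.card_fin, Nat.add_sub_cancel, pow_succ]
  field_simp

theorem prod_erase_eq_succAbove {n : ℕ} (F : Fin (n + 1) → ℂ) (j : Fin (n + 1)) :
    ∏ i ∈ Finset.univ.erase j, F i = ∏ i, F (j.succAbove i) := by
  have : Finset.univ.erase j = Finset.univ.map j.succAboveEmb := by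
    ext i
    simp only [Finset.mem_erase, Finset.mem_univ, and_true, Finset.mem_map, true_and,
      Fin.succAboveEmb_apply, Fin.exists_succAbove_eq_iff]
  rw [this, Finset.prod_map]
  rfl

/-- Replace the column of y₀ by the combination of `sum_mul_g_div_h` and expand along it; the minors
are the determinants of the smaller K's. -/
theorem K_cons {c : ℂ} (hc : c ≠ 0) {n : ℕ} {x : Fin (n + 1) → ℂ} {y₀ : ℂ} {y : Fin n → ℂ}
    (hy : Function.Injective (Fin.cons y₀ y : Fin (n + 1) → ℂ))
    (hxy : ∀ i j, x i ≠ (Fin.cons y₀ y : Fin (n + 1) → ℂ) j)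
    (hh : ∀ i j, h c (x i) ((Fin.cons y₀ y : Fin (n + 1) → ℂ) j) ≠ 0) :
    K c x (Fin.cons y₀ y) = ∑ j, g c (x j) y₀ * (∏ i, f c (x (j.succAbove i)) (x j)) *
      (∏ k, f c (x j) (y k)) * K c (x ∘ j.succAbove) y := by
  set Y : Fin (n + 1) → ℂ := Fin.cons y₀ y with hY
  set M : Matrix (Fin (n + 1)) (Fin (n + 1)) ℂ :=
    Matrix.of fun j k => g c (x j) (Y k) / h c (x j) (Y k) with hM
  set ρ : Fin (n + 1) → ℂ := fun k =>
    (∏ i, h c (x i) (Y k)) * ∏ l ∈ Finset.univ.erase k, g c (Y k) (Y l) with hρ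
  have hdet := Matrix.det_updateCol_sum M 0 ρ
  rw [Matrix.det_succ_column_zero, smul_eq_mul] at hdet
  have hρ0 : ρ 0 = (∏ i, h c (x i) y₀) * ∏ l, g c y₀ (y l) := by
    rw [hρ]
    simp only [prod_erase_eq_succAbove]
    simp [hY]
  have hH : ∏ j, ∏ k, h c (x j) (Y k) =
      (∏ i, h c (x i) y₀) * ∏ i, ∏ k, h c (x i) (y k) := by
    rw [← Finset.prod_mul_distrib]
    exact Finset.prod_congr rfl fun i _ => by simp [hY, Fin.prod_univ_succ]
  have hsgn : (∏ j : Fin (n + 1), ∏ _k ∈ Finset.Ioi j, (-1 : ℂ)) =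
      (-1) ^ n * ∏ j : Fin n, ∏ _k ∈ Finset.Ioi j, (-1 : ℂ) := by
    simp only [Fin.prod_univ_succ, Finset.prod_const, Fin.card_Ioi, Fin.val_zero, Fin.val_succ]
    congr 1
    exact Finset.prod_congr rfl fun i _ => by congr 1; omega
  -- The column operation multiplies the determinant by ρ 0, and exactly this factor is present in
  -- the prefactor of K, so nothing has to be divided out.
  have e0 : K c x Y = ((-1) ^ n * (∏ j : Fin n, ∏ _k ∈ Finset.Ioi j, (-1 : ℂ)) * gProd c x *
      gProd c y * ∏ i, ∏ k, h c (x i) (y k)) * (ρ 0 * M.det) := by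
    rw [K_eq, hsgn, hH, hρ0, hY, gProd_cons]
    ring
  rw [e0, ← hdet, Finset.mul_sum]
  refine Finset.sum_congr rfl fun j _ => ?_
  have h1 : (M.updateCol 0 fun k => ∑ i, ρ i • M k i) j 0 =
      (∏ i ∈ Finset.univ.erase j, h c (x i) (x j)) * ∏ k, g c (x j) (Y k) := by
    rw [Matrix.updateCol_self, ← sum_mul_g_div_h hy hxy hh j]
    rfl
  have h2 : (M.updateCol 0 fun k => ∑ i, ρ i • M k i).submatrix j.succAbove Fin.succ =
      Matrix.of fun i k : Fin n => g c ((x ∘ j.succAbove) i) (y k) /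
        h c ((x ∘ j.succAbove) i) (y k) := by
    ext i k
    simp [hM, hY]
  have h3 : ∏ i, ∏ k, h c (x i) (y k) = (∏ k, h c (x j) (y k)) *
      ∏ i, ∏ k, h c ((x ∘ j.succAbove) i) (y k) := by
    rw [← Finset.mul_prod_erase Finset.univ (fun i => ∏ k, h c (x i) (y k)) (Finset.mem_univ j),
      prod_erase_eq_succAbove]
    rfl
  have h4 : ∏ k, g c (x j) (Y k) = g c (x j) y₀ * ∏ k, g c (x j) (y k) := by
    simp [hY, Fin.prod_univ_succ]
  have h5 : ((-1 : ℂ) ^ (j : ℕ)) * (-1) ^ (j : ℕ) = 1 := by rw [← mul_pow]; simp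
  have h6 : ((-1 : ℂ) ^ n) * (-1) ^ n = 1 := by rw [← mul_pow]; simp
  rw [h1, h2, h3, h4, gProd_eq_succAbove c x j, K_eq, prod_erase_eq_succAbove,
    prod_neg_comm c Finset.univ (x j), Finset.card_univ, Fintype.card_fin]
  simp only [f_eq_g_mul_h hc, Finset.prod_mul_distrib]
  generalize (∏ j : Fin n, ∏ _k ∈ Finset.Ioi j, (-1 : ℂ)) = s
  generalize Matrix.det (n := Fin n) (R := ℂ) _ = d
  generalize gProd c (x ∘ j.succAbove) = q1
  generalize gProd c y = q2
  generalize ∏ i, ∏ k, h c ((x ∘ j.succAbove) i) (y k) = q3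
  generalize (-1 : ℂ) ^ (j : ℕ) = a at *
  generalize (-1 : ℂ) ^ n = b at *
  linear_combination (g c (x j) y₀ * (∏ i, g c (x (j.succAbove i)) (x j)) *
    (∏ i, h c (x (j.succAbove i)) (x j)) * ((∏ k, g c (x j) (y k)) * ∏ k, h c (x j) (y k)) *
    (s * q1 * q2 * q3 * d)) * (b * b * h5 + h6)

/-- The domain wall partition function of two finite sets; it is `0` if their numbers of elements
differ. -/
def Kf (c : ℂ) (β α : Finset D) : ℂ :=
  if hn : β.card = α.card then
    K c (fun j => (β.equivFin.symm j : ℂ)) (fun j => (α.equivFin.symm (Fin.cast hn j) : ℂ))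
  else 0

theorem exists_perm_of_map_eq {n m : ℕ} (hnm : n = m) {S : Finset D} (e : Fin n ≃ S) (x : Fin m ↪ D)
    (hx : Finset.univ.map x = S) : ∃ σ : Fin n ≃ Fin m, ∀ j, (e j : D) = x (σ j) := by
  subst hx
  have h : ∀ j, ∃ k, x k = e j := fun j => by
    obtain ⟨k, _, hk⟩ := Finset.mem_map.1 (e j).2
    exact ⟨k, hk⟩
  choose σ hσ using h
  have hinj : Function.Injective σ := fun j k hjk =>
    e.injective (Subtype.ext (by rw [← hσ, ← hσ, hjk]))
  exact ⟨Equiv.ofBijective σ ((Fintype.bijective_iff_injective_and_card σ).2 ⟨hinj, by simp [hnm]⟩),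
    fun j => (hσ j).symm⟩

theorem K_congr_equiv (c : ℂ) {n m : ℕ} (hnm : n = m) (x y : Fin m → ℂ) (σ τ : Fin n ≃ Fin m) :
    K c (fun j => x (σ j)) (fun j => y (τ j)) = K c x y := by
  subst hnm
  rw [← K_comp_perm_left c x y σ, ← K_comp_perm_right c (x ∘ σ) y τ]
  rfl

/-- By the symmetry of K in both sets, the arbitrary enumerations in `Kf` do not matter. -/
theorem Kf_map (c : ℂ) {n : ℕ} (x y : Fin n ↪ D) :
    Kf c (Finset.univ.map x) (Finset.univ.map y) =
      K c (fun j => (x j : ℂ)) (fun j => (y j : ℂ)) := by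
  have hn : (Finset.univ.map x).card = (Finset.univ.map y).card := by simp
  obtain ⟨σ, hσ⟩ := exists_perm_of_map_eq (by simp) (Finset.univ.map x).equivFin.symm x rfl
  obtain ⟨τ, hτ⟩ := exists_perm_of_map_eq (by simp)
    ((finCongr hn).trans (Finset.univ.map y).equivFin.symm) y rfl
  rw [Kf, dif_pos hn, ← K_congr_equiv c (n := (Finset.univ.map x).card) (by simp) _ _ σ τ]
  congr 1
  · funext j; rw [hσ]
  · funext j; rw [← hτ]; rfl

theorem Kf_of_card_ne (c : ℂ) {β α : Finset D} (hn : β.card ≠ α.card) : Kf c β α = 0 := dif_neg hn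

@[simp] theorem Kf_empty (c : ℂ) : Kf c (∅ : Finset D) ∅ = 1 := by
  simpa [K] using Kf_map c (n := 0) (Function.Embedding.ofIsEmpty (β := D))
    (Function.Embedding.ofIsEmpty (β := D))

theorem exists_map_univ_eq {S : Finset D} {n : ℕ} (hS : S.card = n) :
    ∃ x : Fin n ↪ D, Finset.univ.map x = S := by
  refine ⟨(S.equivFinOfCardEq hS).symm.toEmbedding.trans (Function.Embedding.subtype _), ?_⟩
  ext d
  simp only [Finset.mem_map, Finset.mem_univ, true_and, Function.Embedding.trans_apply,
    Equiv.coe_toEmbedding, Function.Embedding.subtype_apply]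
  exact ⟨fun ⟨j, hj⟩ => hj ▸ ((S.equivFinOfCardEq hS).symm j).2, fun hd =>
    ⟨S.equivFinOfCardEq hS ⟨d, hd⟩, by simp⟩⟩

theorem map_univ_erase {n : ℕ} (x : Fin (n + 1) ↪ D) (j : Fin (n + 1)) :
    (Finset.univ.map x).erase (x j) = Finset.univ.map (j.succAboveEmb.trans x) := by
  ext d
  simp only [Finset.mem_erase, Finset.mem_map, Finset.mem_univ, true_and,
    Function.Embedding.trans_apply, Fin.succAboveEmb_apply]
  constructor
  · rintro ⟨h1, k, rfl⟩
    obtain ⟨i, rfl⟩ := Fin.exists_succAbove_eq fun e : k = j => h1 (e ▸ rfl)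
    exact ⟨i, rfl⟩
  · rintro ⟨i, rfl⟩
    exact ⟨fun e => Fin.succAbove_ne j i (x.injective e), _, rfl⟩

theorem Kf_insert {c : ℂ} (hc : c ≠ 0) {β α : Finset D} {y : D} (hy : y ∉ α) (hyβ : y ∉ β)
    (hβα : Disjoint α β) (hh : ∀ x ∈ β, ∀ z ∈ insert y α, h c x z ≠ 0) :
    Kf c β (insert y α) = ∑ j ∈ β, g c j y * (∏ i ∈ β.erase j, f c i j) *
      (∏ s ∈ α, f c j s) * Kf c (β.erase j) α := by
  by_cases hcard : β.card = α.card + 1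
  · obtain ⟨n, hn⟩ : ∃ n, α.card = n := ⟨_, rfl⟩
    rw [hn] at hcard
    obtain ⟨Z, rfl⟩ := exists_map_univ_eq hn
    obtain ⟨X, rfl⟩ := exists_map_univ_eq hcard
    simp only [Finset.mem_map, Finset.mem_univ, true_and, not_exists] at hy hyβ
    have hY : Function.Injective (Fin.cons y Z : Fin (n + 1) → D) :=
      Fin.cons_injective_iff.2 ⟨fun ⟨k, hk⟩ => hy k hk, Z.injective⟩
    have hmap : insert y (Finset.univ.map Z) =
        Finset.univ.map (⟨Fin.cons y Z, hY⟩ : Fin (n + 1) ↪ D) := by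
      ext d
      simp [Fin.exists_fin_succ, eq_comm]
    have hcons : (fun j => ((Fin.cons y Z : Fin (n + 1) → D) j : ℂ)) =
        (Fin.cons (y : ℂ) (fun j => (Z j : ℂ)) : Fin (n + 1) → ℂ) := by
      funext j
      refine Fin.cases ?_ (fun j => ?_) j <;> simp
    have hXY : ∀ i j, X i ≠ (Fin.cons y Z : Fin (n + 1) → D) j := fun i j => by
      refine Fin.cases (hyβ i) (fun j e => ?_) j
      have e : X i = Z j := e
      exact Finset.disjoint_left.1 hβα (Finset.mem_map_of_mem Z (Finset.mem_univ j))
        (e ▸ Finset.mem_map_of_mem X (Finset.mem_univ i))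
    rw [hmap] at hh ⊢
    rw [Kf_map]
    simp only [Function.Embedding.coeFn_mk]
    rw [hcons, K_cons hc (by rw [← hcons]; exact Subtype.val_injective.comp hY)
      (fun i j => by rw [← hcons]; exact fun e => hXY i j (Subtype.ext e))
      (fun i j => by
        rw [← hcons]
        exact hh _ (Finset.mem_map_of_mem X (Finset.mem_univ i)) _
          (Finset.mem_map_of_mem ⟨Fin.cons y Z, hY⟩ (Finset.mem_univ j))),
      Finset.sum_map]
    refine Finset.sum_congr rfl fun j _ => ?_
    rw [map_univ_erase, Kf_map, Finset.prod_map, Finset.prod_map]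
    rfl
  · rw [Kf_of_card_ne c (by rwa [Finset.card_insert_of_notMem hy]), Finset.sum_eq_zero]
    intro j hj
    have := Finset.card_pos.2 ⟨j, hj⟩
    rw [Kf_of_card_ne c (by rw [Finset.card_erase_of_mem hj]; omega), mul_zero]

/-! ### The reversed ordering -/

/-- The coefficients of the reversed ordering. -/
def revCoeff (c : ℂ) (U V β α : Finset D) : ℂ :=
  Kf c β α * dprod (f c) α (U \ α) * dprod (g c) β (V \ β) * dprod (f c) (V \ β) α

/-- The operator `X` with the factors `T₂₃`, `T₁₃`, `T₁₂`, `T₂₂` in this order. -/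
def revOp (c : ℂ) (T : Fin 3 → Fin 3 → D → A) (U V : Finset D) : A :=
  ∑ α ∈ U.powerset, ∑ β ∈ V.powerset, revCoeff c U V β α •
    (symProd (h c) (T 1 2) (V \ β) * symProd (h c) (T 0 2) β * symProd one₂ (T 0 1) (U \ α) *
      symProd one₂ (T 1 1) α)

theorem revOp_empty (c : ℂ) (T : Fin 3 → Fin 3 → D → A) (V : Finset D) :
    revOp c T ∅ V = symProd (h c) (T 1 2) V := by
  rw [revOp, Finset.powerset_empty, Finset.sum_singleton, Finset.sum_eq_single ∅]
  · simp [revCoeff]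
  · intro β _ hβ
    rw [revCoeff, Kf_of_card_ne c (by simpa using hβ)]
    simp
  · intro hV
    exact absurd (Finset.empty_mem_powerset V) hV

theorem revOp_mul {c : ℂ} {T : Fin 3 → Fin 3 → D → A} (hT : IsMonodromy c T)
    {U V : Finset D} {q : D} (hq : q ∉ U) :
    revOp c T U V * T 0 1 q = (∑ α ∈ U.powerset, ∑ β ∈ V.powerset,
      (revCoeff c U V β α * ∏ y ∈ α, f c y q) • (symProd (h c) (T 1 2) (V \ β) *
        symProd (h c) (T 0 2) β * symProd one₂ (T 0 1) (insert q (U \ α)) *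
          symProd one₂ (T 1 1) α)) +
      ∑ α ∈ U.powerset, ∑ β ∈ V.powerset,
        (∑ s ∈ U \ α, revCoeff c U V β (insert s α) * (g c q s * ∏ y ∈ α, f c y s)) •
          (symProd (h c) (T 1 2) (V \ β) * symProd (h c) (T 0 2) β *
            symProd one₂ (T 0 1) (U \ α) * symProd one₂ (T 1 1) (insert q α)) := by
  have s1 := hT.exchangeSymm_even 1 1 rfl
  have s2 := hT.exchangeSymm_even 0 1 rfl
  have e1 : ∑ α ∈ U.powerset, ∑ β ∈ V.powerset,
        (∑ s ∈ U \ α, revCoeff c U V β (insert s α) * (g c q s * ∏ y ∈ α, f c y s)) •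
          (symProd (h c) (T 1 2) (V \ β) * symProd (h c) (T 0 2) β *
            symProd one₂ (T 0 1) (U \ α) * symProd one₂ (T 1 1) (insert q α)) =
      ∑ α ∈ U.powerset, ∑ s ∈ α, ∑ β ∈ V.powerset,
        (revCoeff c U V β (insert s (α.erase s)) * (g c q s * ∏ y ∈ α.erase s, f c y s)) •
          (symProd (h c) (T 1 2) (V \ β) * symProd (h c) (T 0 2) β *
            symProd one₂ (T 0 1) (U \ (α.erase s)) *
              symProd one₂ (T 1 1) (insert q (α.erase s))) := by
    rw [← sum_powerset_sdiff U fun s α => ∑ β ∈ V.powerset,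
        (revCoeff c U V β (insert s α) * (g c q s * ∏ y ∈ α, f c y s)) •
          (symProd (h c) (T 1 2) (V \ β) * symProd (h c) (T 0 2) β *
            symProd one₂ (T 0 1) (U \ α) *
              symProd one₂ (T 1 1) (insert q α))]
    refine Finset.sum_congr rfl fun α _ => ?_
    rw [Finset.sum_comm]
    refine Finset.sum_congr rfl fun β _ => ?_
    rw [Finset.sum_smul]
  rw [e1, revOp, Finset.sum_mul, ← Finset.sum_add_distrib]
  refine Finset.sum_congr rfl fun α hα => ?_
  have hα := Finset.mem_powerset.1 hα
  rw [Finset.sum_mul, Finset.sum_comm (s := α), ← Finset.sum_add_distrib]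
  refine Finset.sum_congr rfl fun β _ => ?_
  rw [smul_mul_assoc, mul_assoc, symProd_even_mul s1 (fun x y => hT.T11_mul_T01)
    (fun e => hq (hα e)), mul_add, smul_add, mul_smul_comm, smul_smul,
    symProd_one₂_insert_right s2 fun e => hq (Finset.mem_sdiff.1 e).1]
  congr 1
  · simp only [mul_assoc]
  · rw [Finset.mul_sum, Finset.smul_sum]
    refine Finset.sum_congr rfl fun s hs => ?_
    have h1 : U \ α.erase s = insert s (U \ α) := by rw [Finset.sdiff_erase (hα hs)]
    rw [Finset.insert_erase hs, h1, symProd_one₂_insert_right s2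
      (fun e => (Finset.mem_sdiff.1 e).2 hs), symProd_one₂_insert s1
      (fun e => hq (hα (Finset.mem_of_mem_erase e)))]
    simp only [mul_smul_comm, smul_smul, mul_assoc]

/-- T₁₃(j) passes T₂₃(S), with a sign for each factor; what comes out, T₁₃(j) or an exchanged
T₁₃(s), is absorbed into T₁₃(β) at the price of values of h. -/
theorem mul_symProd_mul_symProd {c : ℂ} (hc : c ≠ 0) {T : Fin 3 → Fin 3 → D → A}
    (hT : IsMonodromy c T) {S β : Finset D} {j : D} (hj : j ∉ S) (hjβ : j ∉ β)
    (hSβ : Disjoint S β) (hφ : NonvanishingOn (h c) (insert j (S ∪ β))) :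
    T 0 2 j * (symProd (h c) (T 1 2) S * symProd (h c) (T 0 2) β) =
      ((-1) ^ S.card * (∏ y ∈ S, f c y j) * ∏ y ∈ β, h c y j) •
        (symProd (h c) (T 1 2) S * symProd (h c) (T 0 2) (insert j β)) +
      ∑ s ∈ S, ((-1) ^ S.card * (g c j s * ∏ y ∈ S.erase s, g c y s) *
          (∏ y ∈ S.erase s, h c y j) * ∏ y ∈ β, h c y s) •
        (symProd (h c) (T 1 2) (insert j (S.erase s)) *
          symProd (h c) (T 0 2) (insert s β)) := by
  have s0 := hT.exchangeSymm_odd hc 0 rfl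
  have s1 := hT.exchangeSymm_odd hc 1 rfl
  have hS : S ⊆ insert j (S ∪ β) := fun x hx => by simp [hx]
  rw [← mul_assoc, mul_symProd_odd hc (a := T 0 2) (b := T 1 2) (-1)
    (fun x y => hT.odd_swap 1 rfl) s1
    (fun x y hxy => by rw [neg_one_smul]; exact hT.T02_mul_T12 hxy) (hφ.mono hS) hj,
    smul_mul_assoc, add_mul, smul_add, smul_mul_assoc, mul_assoc, mul_symProd s0 hjβ
      (hφ.mono (Finset.insert_subset_insert _ Finset.subset_union_right)), Finset.sum_mul,
    Finset.smul_sum]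
  congr 1
  · simp only [mul_smul_comm, smul_smul]
    congr 1
    ring
  · refine Finset.sum_congr rfl fun s hs => ?_
    rw [mul_symProd s1 (fun e => hj (Finset.mem_of_mem_erase e))
      (hφ.mono (Finset.insert_subset_insert _ ((Finset.erase_subset _ _).trans
        Finset.subset_union_left))), smul_mul_assoc, mul_assoc, smul_mul_assoc, smul_smul,
      mul_symProd s0 (Finset.disjoint_left.1 hSβ hs) (hφ.mono fun x hx => by
        rcases Finset.mem_insert.1 hx with rfl | hx
        · simp [hs]
        · simp [hx])]
    simp only [mul_smul_comm, smul_smul]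
    congr 1
    ring

theorem erase_sdiff_erase {ι : Type*} [DecidableEq ι] {V β : Finset ι} {j x : ι} (hxV : x ∈ V)
    (hx : x ∈ β) (hj : j ∉ β) : V.erase j \ β.erase x = insert x ((V \ β).erase j) := by
  have hxj : x ≠ j := fun e => hj (e ▸ hx)
  ext y; simp only [Finset.mem_sdiff, Finset.mem_erase, Finset.mem_insert]
  by_cases hy : y = x
  · subst hy; simp [hxj, hxV]
  · simp [hy]; tauto

/-- The three groups on the right come from exchanges of T₁₂(q) with T₂₂(s), from direct passages of
T₁₃(j), and from exchanges of T₁₃(j) with T₂₃(x). Once K(β | α ∪ q) and K(β | α ∪ s) are expanded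
over x ∈ β, all terms have the common factor C R(x). What remains for each x is
`g_mul_prod_f_mul_prod_f` for U \ α, V \ β and t = q. -/
theorem revCoeff_insert {c : ℂ} (hc : c ≠ 0) {U V β α : Finset D} {q : D} (hq : q ∉ U)
    (hqV : q ∉ V) (hUV : Disjoint U V) (hα : α ⊆ U) (hβ : β ⊆ V)
    (hh : ∀ x ∈ V, ∀ z ∈ insert q U, h c x z ≠ 0) :
    revCoeff c (insert q U) V β (insert q α) =
      (∑ s ∈ U \ α, revCoeff c U V β (insert s α) * (g c q s * ∏ y ∈ α, f c y s)) +
      ((∑ j ∈ β, recCoeff c q U V j * revCoeff c U (V.erase j) (β.erase j) α *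
        ((-1) ^ (V \ β).card * (∏ y ∈ V \ β, f c y j) * ∏ y ∈ β.erase j, h c y j)) +
      ∑ j ∈ V \ β, ∑ x ∈ β, recCoeff c q U V j * revCoeff c U (V.erase j) (β.erase x) α *
        ((-1) ^ (V \ β).card * (g c j x * ∏ y ∈ (V \ β).erase j, g c y x) *
          (∏ y ∈ (V \ β).erase j, h c y j) * ∏ y ∈ β.erase x, h c y x)) := by
  have hqα : q ∉ α := fun e => hq (hα e)
  have hαβ : Disjoint α β := (hUV.mono_left hα).mono_right hβ
  set R : D → ℂ := fun x => (∏ i ∈ β.erase x, f c i x) * (∏ s ∈ α, f c x s) *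
    Kf c (β.erase x) α with hR
  set C : ℂ := dprod (f c) α (U \ α) * dprod (g c) β (V \ β) * dprod (f c) (V \ β) α with hC
  have hK : ∀ y ∈ insert q U, y ∉ α → y ∉ β → Kf c β (insert y α) = ∑ x ∈ β, g c x y * R x :=
    fun y hy hyα hyβ => by
      rw [Kf_insert hc hyα hyβ hαβ fun x hx z hz => hh x (hβ hx) z
        (Finset.insert_subset hy (hα.trans (Finset.subset_insert _ _)) hz)]
      refine Finset.sum_congr rfl fun x _ => ?_
      rw [hR]; ring
  have hVα : Disjoint (U \ α) (V \ β) := (hUV.mono_left Finset.sdiff_subset).mono_right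
    Finset.sdiff_subset
  have hL : revCoeff c (insert q U) V β (insert q α) = ∑ x ∈ β, C * R x *
      (g c x q * (∏ s ∈ U \ α, f c q s) * ∏ z ∈ V \ β, f c z q) := by
    rw [revCoeff, hK q (Finset.mem_insert_self _ _) hqα (fun e => hqV (hβ e)),
      Finset.insert_sdiff_insert, Finset.sdiff_insert_of_notMem hq, dprod_insert_left _ hqα,
      dprod_insert_right _ _ hqα, Finset.sum_mul, Finset.sum_mul, Finset.sum_mul]
    refine Finset.sum_congr rfl fun x _ => ?_
    rw [hC]; ring
  have h1 : ∀ s ∈ U \ α, revCoeff c U V β (insert s α) * (g c q s * ∏ y ∈ α, f c y s) =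
      ∑ x ∈ β, C * R x * (g c q s * ((∏ s' ∈ (U \ α).erase s, f c s s') *
        (∏ z ∈ V \ β, f c z s) * g c x s)) := fun s hs => by
    obtain ⟨hsU, hsα⟩ := Finset.mem_sdiff.1 hs
    have e1 : dprod (f c) α (U \ α) =
        (∏ y ∈ α, f c y s) * dprod (f c) α ((U \ α).erase s) := by
      rw [← dprod_insert_right _ _ (Finset.notMem_erase _ _), Finset.insert_erase hs]
    rw [revCoeff, hK s (Finset.mem_insert_of_mem hsU) hsα
      (fun e => Finset.disjoint_left.1 hUV hsU (hβ e)), Finset.sdiff_insert,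
      dprod_insert_left _ hsα, dprod_insert_right _ _ hsα, Finset.sum_mul, Finset.sum_mul,
      Finset.sum_mul, Finset.sum_mul]
    refine Finset.sum_congr rfl fun x _ => ?_
    rw [hC, e1]; ring
  have h2 : ∀ j ∈ β, recCoeff c q U V j * revCoeff c U (V.erase j) (β.erase j) α *
      ((-1) ^ (V \ β).card * (∏ y ∈ V \ β, f c y j) * ∏ y ∈ β.erase j, h c y j) =
      C * R j * (g c j q * ((∏ s ∈ U \ α, f c j s) * ∏ z ∈ V \ β, f c z j)) := fun j hj => by
    have e1 := erase_sdiff_erase_of_mem V hj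
    have e2 : dprod (g c) β (V \ β) = ((-1) ^ (V \ β).card * ∏ y ∈ V \ β, g c y j) *
        dprod (g c) (β.erase j) (V \ β) := by
      rw [← prod_neg_comm c (V \ β) j fun y : D => (y : ℂ),
        ← dprod_insert_left _ (Finset.notMem_erase _ _), Finset.insert_erase hj]
    have e3 : ∏ i ∈ V.erase j, g c i j = (∏ i ∈ V \ β, g c i j) * ∏ i ∈ β.erase j, g c i j := by
      rw [← e1, Finset.prod_sdiff (Finset.erase_subset_erase j hβ)]
    have e4 : ∏ s ∈ U, f c j s = (∏ s ∈ U \ α, f c j s) * ∏ s ∈ α, f c j s :=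
      (Finset.prod_sdiff hα).symm
    have e5 : ∏ i ∈ β.erase j, f c i j = (∏ i ∈ β.erase j, g c i j) * ∏ i ∈ β.erase j, h c i j := by
      simp only [f_eq_g_mul_h hc, Finset.prod_mul_distrib]
    rw [recCoeff, revCoeff, e1, e3, e4, hC, hR, e2]
    simp only [e5]
    ring
  have h3 : ∀ j ∈ V \ β, ∀ x ∈ β, recCoeff c q U V j *
      revCoeff c U (V.erase j) (β.erase x) α *
        ((-1) ^ (V \ β).card * (g c j x * ∏ y ∈ (V \ β).erase j, g c y x) *
          (∏ y ∈ (V \ β).erase j, h c y j) * ∏ y ∈ β.erase x, h c y x) =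
      C * R x * (g c j q * ((∏ s ∈ U \ α, f c j s) * (∏ z' ∈ (V \ β).erase j, f c z' j) *
        g c x j)) := fun j hj x hx => by
    obtain ⟨hjV, hjβ⟩ := Finset.mem_sdiff.1 hj
    have hxj : x ≠ j := fun e => hjβ (e ▸ hx)
    have hx' : x ∉ (V \ β).erase j := fun e =>
      (Finset.mem_sdiff.1 (Finset.mem_of_mem_erase e)).2 hx
    have hj' : j ∉ (V \ β).erase j := Finset.notMem_erase _ _
    have hxβ : x ∉ β.erase x := Finset.notMem_erase _ _
    have e1 := erase_sdiff_erase (hβ hx) hx hjβ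
    have e2 : V.erase j = insert x ((V \ β).erase j ∪ β.erase x) := by
      ext y; simp only [Finset.mem_union, Finset.mem_sdiff, Finset.mem_erase, Finset.mem_insert]
      by_cases hy : y = x
      · subst hy; simp [hxj, hβ hx]
      · by_cases hyj : y = j
        · subst hyj; simp [hy, hjβ]
        · simp [hy, hyj]
          constructor
          · intro h; tauto
          · rintro (h | h)
            · exact h.1
            · exact hβ h
    have hd : Disjoint ((V \ β).erase j) (β.erase x) :=
      (Finset.disjoint_of_subset_left (Finset.erase_subset _ _) Finset.sdiff_disjoint).mono_right
        (Finset.erase_subset _ _)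
    have e3 : ∏ i ∈ V.erase j, g c i j = g c x j * ((∏ i ∈ (V \ β).erase j, g c i j) *
        ∏ i ∈ β.erase x, g c i j) := by
      rw [e2, Finset.prod_insert (by simp [hx]), Finset.prod_union hd]
    have e4 : ∏ s ∈ U, f c j s = (∏ s ∈ U \ α, f c j s) * ∏ s ∈ α, f c j s :=
      (Finset.prod_sdiff hα).symm
    have e5 : ∏ i ∈ β.erase x, f c i x = (∏ i ∈ β.erase x, g c i x) * ∏ i ∈ β.erase x, h c i x := by
      simp only [f_eq_g_mul_h hc, Finset.prod_mul_distrib]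
    have e6 : ∏ i ∈ (V \ β).erase j, f c i j =
        (∏ i ∈ (V \ β).erase j, g c i j) * ∏ i ∈ (V \ β).erase j, h c i j := by
      simp only [f_eq_g_mul_h hc, Finset.prod_mul_distrib]
    have e7 : dprod (g c) β (V \ β) = (g c x j * ((-1) ^ ((V \ β).erase j).card *
        ∏ y ∈ (V \ β).erase j, g c y x)) * ((∏ i ∈ β.erase x, g c i j) *
        dprod (g c) (β.erase x) ((V \ β).erase j)) := by
      rw [← prod_neg_comm c _ (x : ℂ) fun y : D => (y : ℂ), ← dprod_insert_right _ _ hj',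
        ← Finset.prod_insert (f := fun y : D => g c x y) hj', Finset.insert_erase hj,
        ← dprod_insert_left _ hxβ, Finset.insert_erase hx]
    have e8 : dprod (f c) (V \ β) α =
        (∏ s ∈ α, f c j s) * dprod (f c) ((V \ β).erase j) α := by
      rw [← dprod_insert_left _ hj', Finset.insert_erase hj]
    rw [recCoeff, revCoeff, e1, e3, e4, hC, hR, e7, e8, dprod_insert_right _ _ hx',
      dprod_insert_left _ hx', ← Finset.card_erase_add_one hj, pow_succ, g_swap c j x]
    simp only [e5, e6]
    ring
  rw [hL, Finset.sum_congr rfl h1, Finset.sum_congr rfl h2,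
    Finset.sum_congr rfl fun j hj => Finset.sum_congr rfl (h3 j hj), Finset.sum_comm (s := U \ α),
    Finset.sum_comm (s := V \ β), ← Finset.sum_add_distrib, ← Finset.sum_add_distrib]
  refine Finset.sum_congr rfl fun x hx => ?_
  have hxU : x ∉ U := fun e => Finset.disjoint_left.1 hUV e (hβ hx)
  rw [g_mul_prod_f_mul_prod_f hc hVα (fun e => hq (Finset.mem_sdiff.1 e).1)
    (fun e => hqV (Finset.mem_sdiff.1 e).1) (fun e => hxU (Finset.mem_sdiff.1 e).1)
    (fun e => (Finset.mem_sdiff.1 e).2 hx) (fun e => hqV (e ▸ hβ hx)), ← Finset.mul_sum,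
    ← Finset.mul_sum]
  ring

theorem revOp_insert {c : ℂ} (hc : c ≠ 0) {T : Fin 3 → Fin 3 → D → A} (hT : IsMonodromy c T)
    {U V : Finset D} {q : D} (hq : q ∉ U) (hqV : q ∉ V) (hUV : Disjoint U V)
    (hφ : NonvanishingOn (h c) V) (hh : ∀ x ∈ V, ∀ z ∈ insert q U, h c x z ≠ 0) :
    revOp c T (insert q U) V = recR c T U (revOp c T U) q V := by
  have s1 := hT.exchangeSymm_even 1 1 rfl
  set Op : Finset D → Finset D → A := fun β α => symProd (h c) (T 1 2) (V \ β) *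
    symProd (h c) (T 0 2) β * symProd one₂ (T 0 1) (U \ α) *
      symProd one₂ (T 1 1) (insert q α) with hOp
  have hB : ∑ j ∈ V, recCoeff c q U V j • (T 0 2 j * revOp c T U (V.erase j) * T 1 1 q) =
      ∑ α ∈ U.powerset, ∑ β ∈ V.powerset,
        ((∑ j ∈ β, recCoeff c q U V j * revCoeff c U (V.erase j) (β.erase j) α *
          ((-1) ^ (V \ β).card * (∏ y ∈ V \ β, f c y j) * ∏ y ∈ β.erase j, h c y j)) +
        ∑ j ∈ V \ β, ∑ x ∈ β, recCoeff c q U V j * revCoeff c U (V.erase j) (β.erase x) α *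
          ((-1) ^ (V \ β).card * (g c j x * ∏ y ∈ (V \ β).erase j, g c y x) *
            (∏ y ∈ (V \ β).erase j, h c y j) * ∏ y ∈ β.erase x, h c y x)) • Op β α := by
    have e0 : ∑ j ∈ V, recCoeff c q U V j • (T 0 2 j * revOp c T U (V.erase j) * T 1 1 q) =
        ∑ α ∈ U.powerset, ∑ j ∈ V, ∑ β ∈ (V.erase j).powerset,
          (((recCoeff c q U V j * revCoeff c U (V.erase j) β α) *
            ((-1) ^ (V.erase j \ β).card * (∏ y ∈ V.erase j \ β, f c y j) *
              ∏ y ∈ β, h c y j)) •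
            (symProd (h c) (T 1 2) (V.erase j \ β) * symProd (h c) (T 0 2) (insert j β) *
              symProd one₂ (T 0 1) (U \ α) * symProd one₂ (T 1 1) (insert q α)) +
          ∑ s ∈ V.erase j \ β, ((recCoeff c q U V j * revCoeff c U (V.erase j) β α) *
            ((-1) ^ (V.erase j \ β).card *
              (g c j s * ∏ y ∈ (V.erase j \ β).erase s, g c y s) *
              (∏ y ∈ (V.erase j \ β).erase s, h c y j) * ∏ y ∈ β, h c y s)) •
            (symProd (h c) (T 1 2) (insert j ((V.erase j \ β).erase s)) *
              symProd (h c) (T 0 2) (insert s β) *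
              symProd one₂ (T 0 1) (U \ α) * symProd one₂ (T 1 1) (insert q α))) := by
      rw [Finset.sum_comm]
      refine Finset.sum_congr rfl fun j hj => ?_
      rw [revOp, Finset.mul_sum, Finset.sum_mul, Finset.smul_sum]
      refine Finset.sum_congr rfl fun α hα => ?_
      have hα := Finset.mem_powerset.1 hα
      rw [Finset.mul_sum, Finset.sum_mul, Finset.smul_sum]
      refine Finset.sum_congr rfl fun β hβ => ?_
      have hβ := Finset.mem_powerset.1 hβ
      have key := mul_symProd_mul_symProd hc hT (S := V.erase j \ β) (β := β) (j := j)
        (fun e => Finset.notMem_erase _ _ (Finset.mem_sdiff.1 e).1)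
        (fun e => Finset.notMem_erase _ _ (hβ e)) Finset.sdiff_disjoint
        (by rwa [Finset.sdiff_union_of_subset hβ, Finset.insert_erase hj])
      rw [symProd_one₂_insert_right s1 (fun e => hq (hα e)), mul_smul_comm, smul_mul_assoc,
        smul_smul, ← mul_assoc, ← mul_assoc, key]
      simp only [add_mul, smul_add, smul_mul_assoc, Finset.sum_mul, Finset.smul_sum, smul_smul,
        mul_assoc]
    rw [e0]
    refine Finset.sum_congr rfl fun α _ => ?_
    simp only [Finset.sum_add_distrib, add_smul]
    congr 1
    -- Direct passage: j joins β.
    · refine (sum_sum_powerset_erase V _).trans ((sum_powerset_sdiff V _).trans ?_)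
      refine Finset.sum_congr rfl fun β _ => ?_
      rw [Finset.sum_smul]
      refine Finset.sum_congr rfl fun j hj => ?_
      rw [erase_sdiff_erase_of_mem V hj, Finset.insert_erase hj]
    -- Exchange: x joins β, while j takes its place among the arguments of T₂₃.
    · rw [Finset.sum_congr rfl fun j _ => sum_powerset_sdiff (V.erase j) _]
      refine (sum_sum_powerset_erase V _).trans ?_
      refine Finset.sum_congr rfl fun β hβ => ?_
      have hβ := Finset.mem_powerset.1 hβ
      rw [Finset.sum_smul]
      refine Finset.sum_congr rfl fun j hj => ?_
      rw [Finset.sum_smul]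
      refine Finset.sum_congr rfl fun x hx => ?_
      have hx' : x ∉ (V \ β).erase j := fun e =>
        (Finset.mem_sdiff.1 (Finset.mem_of_mem_erase e)).2 hx
      rw [erase_sdiff_erase (hβ hx) hx (Finset.mem_sdiff.1 hj).2, Finset.erase_insert hx',
        Finset.insert_erase hj, Finset.insert_erase hx, Finset.card_insert_of_notMem hx',
        Finset.card_erase_add_one hj]
  rw [recR, revOp_mul hT hq, hB, add_assoc, revOp, Finset.sum_powerset_insert hq]
  congr 1
  · refine Finset.sum_congr rfl fun α hα => Finset.sum_congr rfl fun β _ => ?_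
    have hα := Finset.mem_powerset.1 hα
    have hqα : q ∉ α := fun e => hq (hα e)
    rw [Finset.insert_sdiff_of_notMem _ hqα, revCoeff, revCoeff, Finset.insert_sdiff_of_notMem _ hqα,
      dprod_insert_right _ _ fun e => hq (Finset.mem_sdiff.1 e).1]
    congr 1
    ring
  · rw [← Finset.sum_add_distrib]
    refine Finset.sum_congr rfl fun α hα => ?_
    rw [← Finset.sum_add_distrib]
    refine Finset.sum_congr rfl fun β hβ => ?_
    rw [← add_smul, revCoeff_insert hc hq hqV hUV (Finset.mem_powerset.1 hα)
      (Finset.mem_powerset.1 hβ) hh, Finset.insert_sdiff_insert, Finset.sdiff_insert_of_notMem hq]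

theorem xOp_eq_revOp {c : ℂ} (hc : c ≠ 0) {T : Fin 3 → Fin 3 → D → A} (hT : IsMonodromy c T)
    {U : Finset D} (hU : NonvanishingOn (h c) U) : ∀ {V : Finset D}, Disjoint U V →
      NonvanishingOn (h c) V → (∀ x ∈ V, ∀ z ∈ U, h c x z ≠ 0) → xOp c T U V = revOp c T U V := by
  induction U using Finset.induction_on with
  | empty =>
    intro V _ _ _
    rw [xOp_empty, revOp_empty]
  | insert u U hu ih =>
    intro V hUV hV hVU
    rw [Finset.disjoint_insert_left] at hUV
    obtain ⟨huV, hUV⟩ := hUV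
    have hU' := hU.mono (Finset.subset_insert u U)
    rw [xOp_insert hc hT hu huV hUV hU, recL_xOp_eq_recR_xOp hc hT hU' hu huV hUV hV,
      revOp_insert hc hT hu huV hUV hV hVU]
    exact recR_congr c T U u fun W hW => ih hU' (hUV.mono_right hW) (hV.mono hW)
      fun x hx z hz => hVU x (hW hx) z (Finset.mem_insert_of_mem hz)

/-! ### Expansions of X as double sums over subsets -/

theorem xOp_eq_sum_rowCoeffL (c : ℂ) (T : Fin 3 → Fin 3 → D → A) (U V : Finset D) :
    xOp c T U V = ∑ α ∈ U.powerset, ∑ β ∈ V.powerset,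
      (rowCoeffL c U β α * dprod (g c) (V \ β) β) • (symProd (h c) (T 0 2) α *
        symProd one₂ (T 0 1) (U \ α) * symProd (h c) (T 1 2) (V \ β) * symProd one₂ (T 1 1) β) := by
  rw [Finset.sum_comm, xOp]
  refine Finset.sum_congr rfl fun β _ => ?_
  rw [rowL, Finset.sum_mul, Finset.sum_mul, Finset.smul_sum]
  refine Finset.sum_congr rfl fun α _ => ?_
  rw [smul_mul_assoc, smul_mul_assoc, smul_smul, mul_comm (dprod _ _ _)]

theorem xOp_eq_sum_rowCoeffR {c : ℂ} (hc : c ≠ 0) {T : Fin 3 → Fin 3 → D → A}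
    (hT : IsMonodromy c T) {U V : Finset D} (hU : NonvanishingOn (h c) U) (hUV : Disjoint U V) :
    xOp c T U V = ∑ α ∈ U.powerset, ∑ β ∈ V.powerset,
      (rowCoeffR c U β α * dprod (g c) (V \ β) β) • (symProd one₂ (T 0 1) (U \ α) *
        symProd (h c) (T 0 2) α * symProd (h c) (T 1 2) (V \ β) * symProd one₂ (T 1 1) β) := by
  rw [Finset.sum_comm, xOp]
  refine Finset.sum_congr rfl fun β hβ => ?_
  rw [rowL_eq_rowR hc hT (hUV.mono_right (Finset.mem_powerset.1 hβ)) hU, rowR, Finset.sum_mul,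
    Finset.sum_mul, Finset.smul_sum]
  refine Finset.sum_congr rfl fun α _ => ?_
  rw [smul_mul_assoc, smul_mul_assoc, smul_smul, mul_comm (dprod _ _ _)]

/-! ### Products over index sets -/

theorem pairProd_map_eq (φ : ℂ → ℂ → ℂ) {n : ℕ} (x : Fin n → D) {l : List (Fin n)}
    (hl : l.Pairwise (· < ·)) : pairProd φ (l.map x) =
      ∏ i ∈ l.toFinset, ∏ m ∈ l.toFinset with m < i, φ (x i) (x m) := by
  induction l with
  | nil => simp [pairProd]
  | cons a l ih =>
    obtain ⟨h1, h2⟩ := List.pairwise_cons.1 hl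
    have ha : a ∉ l.toFinset := fun e => lt_irrefl _ (h1 a (List.mem_toFinset.1 e))
    have hn : l.Nodup := h2.imp ne_of_lt
    have hfa : (insert a l.toFinset).filter (· < a) = ∅ := by
      rw [Finset.filter_eq_empty_iff]
      intro m hm
      rcases Finset.mem_insert.1 hm with rfl | hm
      · exact lt_irrefl _
      · exact (h1 m (List.mem_toFinset.1 hm)).asymm
    have hfi : ∀ i ∈ l.toFinset, (insert a l.toFinset).filter (· < i) =
        insert a (l.toFinset.filter (· < i)) := fun i hi => by
      rw [Finset.filter_insert, if_pos (h1 i (List.mem_toFinset.1 hi))]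
    rw [List.map_cons, pairProd, ih h2, List.toFinset_cons, Finset.prod_insert ha, hfa,
      Finset.prod_empty, one_mul, List.map_map, ← List.prod_toFinset _ hn,
      ← Finset.prod_mul_distrib]
    refine Finset.prod_congr rfl fun i hi => ?_
    rw [hfi i hi, Finset.prod_insert fun e => ha (Finset.mem_filter.1 e).1]
    rfl

theorem opProdCol_eq_listProd (c : ℂ) {n : ℕ} (t : D → A) (x : Fin n → D) (S : Finset (Fin n)) :
    opProdCol c t x S = listProd (h c) t ((S.sort (· ≤ ·)).map x) := by
  rw [opProdCol, listProd, pairProd_map_eq _ _ (Finset.sortedLT_sort S).pairwise,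
    Finset.sort_toFinset, opProd, List.map_map]
  rfl

theorem opProdRow_eq_listProd (c : ℂ) {n : ℕ} (t : D → A) (x : Fin n → D) (S : Finset (Fin n)) :
    opProdRow c t x S = listProd (fun a b => h c b a) t ((S.sort (· ≤ ·)).map x) := by
  rw [opProdRow, listProd, pairProd_map_eq _ _ (Finset.sortedLT_sort S).pairwise,
    Finset.sort_toFinset, opProd, List.map_map]
  rfl

theorem opProd_eq_listProd {n : ℕ} (t : D → A) (x : Fin n → D) (S : Finset (Fin n)) :
    opProd t x S = listProd one₂ t ((S.sort (· ≤ ·)).map x) := by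
  rw [listProd, pairProd_map_eq _ _ (Finset.sortedLT_sort S).pairwise, opProd, List.map_map]
  simp only [one₂, Finset.prod_const_one, inv_one, one_smul]
  rfl

theorem toList_map_perm {n : ℕ} (x : Fin n ↪ D) (S : Finset (Fin n)) :
    (S.map x).toList.Perm ((S.sort (· ≤ ·)).map x) := by
  rw [← Multiset.coe_eq_coe, Finset.coe_toList, Finset.map_val, ← Multiset.map_coe,
    Finset.sort_eq]

theorem opProdCol_eq_symProd {c : ℂ} {n : ℕ} {t : D → A} (ht : ExchangeSymm (h c) t)
    (x : Fin n ↪ D) {S : Finset (Fin n)} (hS : NonvanishingOn (h c) (S.map x)) :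
    opProdCol c t x S = symProd (h c) t (S.map x) := by
  rw [opProdCol_eq_listProd, symProd_eq_listProd ht (toList_map_perm x S) hS]

theorem opProd_eq_symProd {n : ℕ} {t : D → A} (ht : ExchangeSymm one₂ t)
    (x : Fin n ↪ D) (S : Finset (Fin n)) :
    opProd t x S = symProd one₂ t (S.map x) := by
  rw [opProd_eq_listProd, symProd_eq_listProd ht (toList_map_perm x S) (nonvanishingOn_one₂ _)]

theorem fprod_eq_dprod (φ : ℂ → ℂ → ℂ) {m n : ℕ} (x : Fin m ↪ D) (S : Finset (Fin m))
    (y : Fin n ↪ D) (R : Finset (Fin n)) : fprod φ x S y R = dprod φ (S.map x) (R.map y) := by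
  simp only [fprod, dprod, Finset.prod_map]

theorem map_compl {n : ℕ} (x : Fin n ↪ D) (S : Finset (Fin n)) :
    Sᶜ.map x = Finset.univ.map x \ S.map x := by
  ext d
  simp only [Finset.mem_map, Finset.mem_compl, Finset.mem_sdiff, Finset.mem_univ, true_and]
  constructor
  · rintro ⟨i, hi, rfl⟩
    exact ⟨⟨i, rfl⟩, fun ⟨j, hj, e⟩ => hi (x.injective e ▸ hj)⟩
  · rintro ⟨⟨i, rfl⟩, hi⟩
    exact ⟨i, fun e => hi ⟨i, e, rfl⟩, rfl⟩

theorem Kpart_eq_Kf (c : ℂ) {a b : ℕ} (u : Fin a ↪ D) (v : Fin b ↪ D) (p : Part a b) :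
    Kpart c u v p = Kf c (p.V.map v) (p.U.map u) := by
  have h1 : p.V.map v = Finset.univ.map ((p.V.orderEmbOfFin p.2).toEmbedding.trans v) := by
    rw [← Finset.map_map, Finset.map_orderEmbOfFin_univ]
  have h2 : p.U.map u = Finset.univ.map ((p.U.orderEmbOfFin rfl).toEmbedding.trans u) := by
    rw [← Finset.map_map, Finset.map_orderEmbOfFin_univ]
  rw [h1, h2, Kf_map]
  rfl

theorem sum_powerset_map {M : Type*} [AddCommMonoid M] {n : ℕ} (x : Fin n ↪ D)
    (F : Finset D → M) :
    ∑ α ∈ (Finset.univ.map x).powerset, F α = ∑ S : Finset (Fin n), F (S.map x) := by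
  symm
  refine Finset.sum_nbij (fun S => S.map x) (fun S _ => ?_) (fun S _ R _ e => ?_)
    (fun α hα => ?_) fun _ _ => rfl
  · exact Finset.mem_powerset.2 (Finset.map_subset_map.2 (Finset.subset_univ _))
  · exact Finset.map_injective x e
  · obtain ⟨S, _, rfl⟩ := Finset.subset_map_iff.1 (Finset.mem_powerset.1 hα)
    exact ⟨S, Finset.mem_univ _, rfl⟩

/-- The finite-set coefficients vanish for subsets of different sizes, so the unrestricted double
sum is a sum over partitions. -/
theorem sum_powerset_map_eq_sum_part {M : Type*} [AddCommMonoid M] {a b : ℕ} (u : Fin a ↪ D)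
    (v : Fin b ↪ D) {F : Finset D → Finset D → M} (hF : ∀ α β, β.card ≠ α.card → F α β = 0) :
    ∑ α ∈ (Finset.univ.map u).powerset, ∑ β ∈ (Finset.univ.map v).powerset, F α β =
      ∑ p : Part a b, F (p.U.map u) (p.V.map v) := by
  rw [sum_powerset_map, Finset.sum_congr rfl fun S _ => sum_powerset_map v (F (S.map u)),
    ← Fintype.sum_prod_type fun q : Finset (Fin a) × Finset (Fin b) =>
      F (q.1.map u) (q.2.map v),
    ← Finset.sum_filter_of_ne (p := fun q => q.2.card = q.1.card) fun q _ hq => by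
      by_contra hne
      exact hq (hF _ _ (by simpa using hne))]
  exact Finset.sum_subtype _ (by simp) _

/-! ### The orderings of `X` -/

theorem nonvanishingOn_map {φ : ℂ → ℂ → ℂ} {n : ℕ} {x : Fin n ↪ D}
    (hx : ∀ j k, j ≠ k → φ (x j) (x k) ≠ 0) (S : Finset (Fin n)) :
    NonvanishingOn φ (S.map x) := by
  intro d hd e he hde
  obtain ⟨j, _, rfl⟩ := Finset.mem_map.1 hd
  obtain ⟨k, _, rfl⟩ := Finset.mem_map.1 he
  exact hx j k fun h => hde (h ▸ rfl)

section
variable {c : ℂ} {T : Fin 3 → Fin 3 → D → A} {a b : ℕ} {u : Fin a ↪ D} {v : Fin b ↪ D}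

theorem X_eq_xOp (hc : c ≠ 0) (hT : IsMonodromy c T)
    (hu : ∀ j k, j ≠ k → h c (u j) (u k) ≠ 0) (hv : ∀ j k, j ≠ k → h c (v j) (v k) ≠ 0) :
    X c T u v = xOp c T (Finset.univ.map u) (Finset.univ.map v) := by
  rw [xOp_eq_sum_rowCoeffL, sum_powerset_map_eq_sum_part, X]
  · refine Finset.sum_congr rfl fun p _ => ?_
    rw [rowCoeffL, if_pos (by simpa using p.2)]
    simp only [opProdCol_eq_symProd (hT.exchangeSymm_odd hc 0 rfl) u (nonvanishingOn_map hu _),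
      opProdCol_eq_symProd (hT.exchangeSymm_odd hc 1 rfl) v (nonvanishingOn_map hv _),
      opProd_eq_symProd (hT.exchangeSymm_even 0 1 rfl) u,
      opProd_eq_symProd (hT.exchangeSymm_even 1 1 rfl) v, fprod_eq_dprod, map_compl]
    congr 1
    ring
  · intro α β hn
    rw [rowCoeffL, if_neg hn, zero_mul, zero_smul]

theorem X_eq_sum_T12_T13_T23 (hc : c ≠ 0) (hT : IsMonodromy c T) (huv : ∀ j k, u j ≠ v k)
    (hu : ∀ j k, j ≠ k → h c (u j) (u k) ≠ 0) (hv : ∀ j k, j ≠ k → h c (v j) (v k) ≠ 0) :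
    X c T u v = ∑ p : Part a b,
      (fprod (g c) v p.V u p.U * fprod (f c) u p.Uᶜ u p.U * fprod (g c) v p.Vᶜ v p.V *
          fprod (f c) v p.V u p.Uᶜ * fprod (h c) u p.U u p.U) •
        (opProd (T 0 1) u p.Uᶜ * opProdCol c (T 0 2) u p.U * opProdCol c (T 1 2) v p.Vᶜ *
          opProd (T 1 1) v p.V) := by
  have hUV : Disjoint (Finset.univ.map u) (Finset.univ.map v) := by
    rw [Finset.disjoint_left]
    intro d hd he
    obtain ⟨j, _, rfl⟩ := Finset.mem_map.1 hd
    obtain ⟨k, _, hk⟩ := Finset.mem_map.1 he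
    exact huv j k hk.symm
  rw [X_eq_xOp hc hT hu hv, xOp_eq_sum_rowCoeffR hc hT (nonvanishingOn_map hu _) hUV,
    sum_powerset_map_eq_sum_part]
  · refine Finset.sum_congr rfl fun p _ => ?_
    rw [rowCoeffR, if_pos (by simpa using p.2)]
    simp only [opProdCol_eq_symProd (hT.exchangeSymm_odd hc 0 rfl) u (nonvanishingOn_map hu _),
      opProdCol_eq_symProd (hT.exchangeSymm_odd hc 1 rfl) v (nonvanishingOn_map hv _),
      opProd_eq_symProd (hT.exchangeSymm_even 0 1 rfl) u,
      opProd_eq_symProd (hT.exchangeSymm_even 1 1 rfl) v, fprod_eq_dprod, map_compl]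
    congr 1
    ring
  · intro α β hn
    rw [rowCoeffR, if_neg hn, zero_mul, zero_smul]

theorem X_eq_sum_T23_T13_T12 (hc : c ≠ 0) (hT : IsMonodromy c T) (huv : ∀ j k, u j ≠ v k)
    (hu : ∀ j k, j ≠ k → h c (u j) (u k) ≠ 0) (hv : ∀ j k, j ≠ k → h c (v j) (v k) ≠ 0)
    (hvu : ∀ j k, h c (v j) (u k) ≠ 0) :
    X c T u v = ∑ p : Part a b,
      (Kpart c u v p * fprod (f c) u p.U u p.Uᶜ * fprod (g c) v p.V v p.Vᶜ *
          fprod (f c) v p.Vᶜ u p.U) •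
        (opProdCol c (T 1 2) v p.Vᶜ * opProdCol c (T 0 2) v p.V * opProd (T 0 1) u p.Uᶜ *
          opProd (T 1 1) u p.U) := by
  have hUV : Disjoint (Finset.univ.map u) (Finset.univ.map v) := by
    rw [Finset.disjoint_left]
    intro d hd he
    obtain ⟨j, _, rfl⟩ := Finset.mem_map.1 hd
    obtain ⟨k, _, hk⟩ := Finset.mem_map.1 he
    exact huv j k hk.symm
  rw [X_eq_xOp hc hT hu hv, xOp_eq_revOp hc hT (nonvanishingOn_map hu _) hUV
    (nonvanishingOn_map hv _) fun d hd e he => ?_, revOp, sum_powerset_map_eq_sum_part]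
  · refine Finset.sum_congr rfl fun p _ => ?_
    rw [revCoeff, ← Kpart_eq_Kf]
    simp only [opProdCol_eq_symProd (hT.exchangeSymm_odd hc 0 rfl) v (nonvanishingOn_map hv _),
      opProdCol_eq_symProd (hT.exchangeSymm_odd hc 1 rfl) v (nonvanishingOn_map hv _),
      opProd_eq_symProd (hT.exchangeSymm_even 0 1 rfl) u,
      opProd_eq_symProd (hT.exchangeSymm_even 1 1 rfl) u, fprod_eq_dprod, map_compl]
  · intro α β hn
    rw [revCoeff, Kf_of_card_ne c hn, zero_mul, zero_mul, zero_mul, zero_smul]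
  · obtain ⟨j, _, rfl⟩ := Finset.mem_map.1 hd
    obtain ⟨k, _, rfl⟩ := Finset.mem_map.1 he
    exact hvu j k

end

/-! ### Bethe vectors -/

variable {H : Type*} [AddCommGroup H] [Module ℂ H]

theorem IsVacuum.opProd_apply {T : Fin 3 → Fin 3 → D → Module.End ℂ H} {lam : Fin 3 → D → ℂ}
    {Ω : H} (hΩ : IsVacuum T lam Ω) (i : Fin 3) {n : ℕ} (x : Fin n → D) (S : Finset (Fin n)) :
    opProd (T i i) x S Ω = (∏ k ∈ S, lam i (x k)) • Ω := by
  have hl : ∀ l : List (Fin n), (l.map fun k => T i i (x k)).prod Ω =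
      (l.map fun k => lam i (x k)).prod • Ω := fun l => by
    induction l with
    | nil => simp
    | cons k l ih =>
      rw [List.map_cons, List.prod_cons, Module.End.mul_apply, ih, map_smul, hΩ.diag, smul_smul,
        List.map_cons, List.prod_cons, mul_comm]
  rw [opProd, hl, ← List.prod_toFinset _ (Finset.sort_nodup S _), Finset.sort_toFinset]

section
variable {c : ℂ} {T : Fin 3 → Fin 3 → D → Module.End ℂ H} {lam : Fin 3 → D → ℂ} {Ω : H}
  {a b : ℕ} {u : Fin a → D} {v : Fin b → D}

theorem bethe_eq_sum_T12_T13_T23 (hc : c ≠ 0) (hT : IsMonodromy c T) (hΩ : IsVacuum T lam Ω)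
    (hu : Function.Injective u) (hv : Function.Injective v) (huv : ∀ j k, u j ≠ v k)
    (hhu : ∀ j k, j ≠ k → h c (u j) (u k) ≠ 0) (hhv : ∀ j k, j ≠ k → h c (v j) (v k) ≠ 0) :
    bethe c T Ω u v = ∑ p : Part a b,
      (fprod (g c) v p.V u p.U * fprod (f c) u p.Uᶜ u p.U * fprod (g c) v p.Vᶜ v p.V *
          fprod (f c) v p.V u p.Uᶜ * fprod (h c) u p.U u p.U * ∏ k ∈ p.V, lam 1 (v k)) •
        (opProd (T 0 1) u p.Uᶜ * opProdCol c (T 0 2) u p.U * opProdCol c (T 1 2) v p.Vᶜ) Ω := by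
  obtain ⟨u, rfl⟩ : ∃ u' : Fin a ↪ D, ⇑u' = u := ⟨⟨u, hu⟩, rfl⟩
  obtain ⟨v, rfl⟩ : ∃ v' : Fin b ↪ D, ⇑v' = v := ⟨⟨v, hv⟩, rfl⟩
  rw [bethe, X_eq_sum_T12_T13_T23 hc hT huv hhu hhv, LinearMap.sum_apply]
  refine Finset.sum_congr rfl fun p _ => ?_
  rw [LinearMap.smul_apply, Module.End.mul_apply, hΩ.opProd_apply, map_smul, smul_smul]

theorem bethe_eq_sum_T23_T13_T12 (hc : c ≠ 0) (hT : IsMonodromy c T) (hΩ : IsVacuum T lam Ω)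
    (hu : Function.Injective u) (hv : Function.Injective v) (huv : ∀ j k, u j ≠ v k)
    (hhu : ∀ j k, j ≠ k → h c (u j) (u k) ≠ 0) (hhv : ∀ j k, j ≠ k → h c (v j) (v k) ≠ 0)
    (hhvu : ∀ j k, h c (v j) (u k) ≠ 0) :
    bethe c T Ω u v = ∑ p : Part a b,
      (Kpart c u v p * fprod (f c) u p.U u p.Uᶜ * fprod (g c) v p.V v p.Vᶜ *
          fprod (f c) v p.Vᶜ u p.U * ∏ k ∈ p.U, lam 1 (u k)) •
        (opProdCol c (T 1 2) v p.Vᶜ * opProdCol c (T 0 2) v p.V * opProd (T 0 1) u p.Uᶜ) Ω := by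
  obtain ⟨u, rfl⟩ : ∃ u' : Fin a ↪ D, ⇑u' = u := ⟨⟨u, hu⟩, rfl⟩
  obtain ⟨v, rfl⟩ : ∃ v' : Fin b ↪ D, ⇑v' = v := ⟨⟨v, hv⟩, rfl⟩
  rw [bethe, X_eq_sum_T23_T13_T12 hc hT huv hhu hhv hhvu, LinearMap.sum_apply]
  refine Finset.sum_congr rfl fun p _ => ?_
  rw [LinearMap.smul_apply, Module.End.mul_apply, hΩ.opProd_apply, map_smul, smul_smul]

end

/-! ### Functoriality and parity of `X` -/

section
variable {B : Type*} [Ring B] [Algebra ℂ B] (F : A →ₐ[ℂ] B)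

theorem IsMonodromy.map {c : ℂ} {T : Fin 3 → Fin 3 → D → A} (hT : IsMonodromy c T) :
    IsMonodromy c fun i j u => F (T i j u) := fun i j k l u v huv => by
  simpa only [map_sub, map_mul, map_smul] using congrArg F (hT i j k l u v huv)

theorem map_opProd {n : ℕ} (t : D → A) (x : Fin n → D) (S : Finset (Fin n)) :
    F (opProd t x S) = opProd (fun d => F (t d)) x S := by
  rw [opProd, opProd, map_list_prod, List.map_map]
  rfl

theorem map_opProdCol (c : ℂ) {n : ℕ} (t : D → A) (x : Fin n → D) (S : Finset (Fin n)) :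
    F (opProdCol c t x S) = opProdCol c (fun d => F (t d)) x S := by
  rw [opProdCol, opProdCol, map_smul, map_opProd]

theorem map_X (c : ℂ) (T : Fin 3 → Fin 3 → D → A) {a b : ℕ} (u : Fin a → D) (v : Fin b → D) :
    F (X c T u v) = X c (fun i j d => F (T i j d)) u v := by
  simp only [X, map_sum, map_smul, map_mul, map_opProd, map_opProdCol]

end

theorem opProd_smul (κ : ℂ) {n : ℕ} (t : D → A) (x : Fin n → D) (S : Finset (Fin n)) :
    opProd (fun d => κ • t d) x S = κ ^ S.card • opProd t x S := by
  have hl : ∀ l : List (Fin n), (l.map fun k => κ • t (x k)).prod =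
      κ ^ l.length • (l.map fun k => t (x k)).prod := fun l => by
    induction l with
    | nil => simp
    | cons k l ih =>
      rw [List.map_cons, List.prod_cons, ih, smul_mul_smul_comm, List.length_cons, pow_succ',
        List.map_cons, List.prod_cons]
  rw [opProd, hl, Finset.length_sort, opProd]

theorem opProdCol_smul (c κ : ℂ) {n : ℕ} (t : D → A) (x : Fin n → D) (S : Finset (Fin n)) :
    opProdCol c (fun d => κ • t d) x S = κ ^ S.card • opProdCol c t x S := by
  rw [opProdCol, opProd_smul, smul_comm, opProdCol]

theorem card_add_card_compl {a b : ℕ} (p : Part a b) : p.U.card + p.Vᶜ.card = b := by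
  have h1 : p.V.card = p.U.card := p.2
  have h2 := Finset.card_add_card_compl p.V
  rw [Fintype.card_fin] at h2
  omega

/-- Every term has #ū_α operators T₁₃ and #v̄_ᾱ operators T₂₃, together b odd factors. -/
theorem parityAut_X (c : ℂ) {a b : ℕ} (u : Fin a → D) (v : Fin b → D) :
    parityAut c D (X c (gen c D) u v) = (-1 : ℂ) ^ b • X c (gen c D) u v := by
  rw [map_X]
  simp only [parityAut_gen]
  rw [X, X, Finset.smul_sum]
  refine Finset.sum_congr rfl fun p _ => ?_
  simp only [opProd_smul, opProdCol_smul, smul_mul_smul_comm, ← card_add_card_compl p, pow_add]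
  simp [par, smul_smul, mul_comm]

theorem psi_X (c : ℂ) {a b : ℕ} (u : Fin a → D) (v : Fin b → D) :
    psi c D (X c (gen c D) u v) =
      (-Complex.I) ^ (b % 2) • (antiHom c D (X c (gen c D) u v)).unop :=
  psi_of_parity c D (Nat.mod_lt _ two_pos) (by
    rw [parityAut_X, neg_one_pow_eq_pow_mod_two])

/-! ### The transposed monodromy matrix -/

/-- The transposed monodromy matrix, which acts on the dual space. -/
def dualT (T : Fin 3 → Fin 3 → D → Module.End ℂ H) (i j : Fin 3) (u : D) :
    Module.End ℂ (Module.Dual ℂ H) :=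
  kap i j • (T j i u).dualMap

theorem dualMap_smul (k : ℂ) (t : Module.End ℂ H) : (k • t).dualMap = k • t.dualMap :=
  map_smul (Module.Dual.transpose (R := ℂ) (M := H) (M' := H)) k t

/-- The transposition of operators, as an algebra homomorphism on the opposite algebra. -/
def dualMapHom (H : Type*) [AddCommGroup H] [Module ℂ H] :
    (Module.End ℂ H)ᵐᵒᵖ →ₐ[ℂ] Module.End ℂ (Module.Dual ℂ H) :=
  AlgHom.ofLinearMap (Module.Dual.transpose ∘ₗ (MulOpposite.opLinearEquiv ℂ).symm.toLinearMap)
    rfl fun _ _ => rfl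

/-- The right action of the algebra of monodromy matrix entries on the dual space. -/
def dualRep (c : ℂ) (T : Fin 3 → Fin 3 → D → Module.End ℂ H) (hT : IsMonodromy c T) :
    RTTAlgebra c D →ₐ[ℂ] Module.End ℂ (Module.Dual ℂ H) :=
  ((dualMapHom H).comp (AlgHom.op (lift c T hT))).comp (antiHom c D)

theorem dualRep_apply (c : ℂ) (T : Fin 3 → Fin 3 → D → Module.End ℂ H) (hT : IsMonodromy c T)
    (x : RTTAlgebra c D) :
    dualRep c T hT x = (lift c T hT (antiHom c D x).unop).dualMap := rfl

theorem dualRep_gen (c : ℂ) (T : Fin 3 → Fin 3 → D → Module.End ℂ H) (hT : IsMonodromy c T)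
    (i j : Fin 3) (u : D) : dualRep c T hT (gen c D i j u) = dualT T i j u := by
  rw [dualRep_apply, show antiHom c D (gen c D i j u) =
    MulOpposite.op (kap i j • gen c D j i u) from lift_gen c _ _ i j u, MulOpposite.unop_op,
    map_smul, lift_gen, dualT, dualMap_smul]

/-- Transposition and `antiHom` both reverse products, so their composite is a representation of the
algebra, and the images of the generators inherit the relations. -/
theorem isMonodromy_dualT {c : ℂ} {T : Fin 3 → Fin 3 → D → Module.End ℂ H}
    (hT : IsMonodromy c T) : IsMonodromy c (dualT T) := by
  simpa only [dualRep_gen] using (isMonodromy_gen c D).map (dualRep c T hT)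

theorem kap_self (i : Fin 3) : kap i i = 1 := by
  fin_cases i <;> simp [kap, par]

theorem IsDualVacuum.isVacuum_dualT {T : Fin 3 → Fin 3 → D → Module.End ℂ H}
    {lam : Fin 3 → D → ℂ} {Ω' : Module.Dual ℂ H} (hΩ' : IsDualVacuum T lam Ω') :
    IsVacuum (dualT T) lam Ω' where
  diag i u := by
    rw [dualT, kap_self, one_smul]
    exact hΩ'.diag i u
  lower i j u hij := by
    rw [dualT, LinearMap.smul_apply, LinearMap.dualMap_apply', hΩ'.upper j i u hij, smul_zero]

theorem dualBethe_eq_bethe (c : ℂ) (T : Fin 3 → Fin 3 → D → Module.End ℂ H)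
    (hT : IsMonodromy c T) (Ω' : Module.Dual ℂ H) {a b : ℕ} (u : Fin a → D) (v : Fin b → D) :
    dualBethe c T hT Ω' u v = (-Complex.I) ^ (b % 2) • bethe c (dualT T) Ω' u v := by
  have h1 : X c (dualT T) u v = dualRep c T hT (X c (gen c D) u v) := by
    rw [map_X]
    simp only [dualRep_gen]
  rw [dualBethe, psi_X, map_smul, bethe, h1, dualRep_apply, LinearMap.comp_smul]
  rfl

/-! ### Transposed products -/

theorem pairProd_append_singleton (φ : ℂ → ℂ → ℂ) (l : List D) (x : D) :
    pairProd φ (l ++ [x]) = (l.map fun y : D => φ x y).prod * pairProd φ l := by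
  induction l with
  | nil => simp [pairProd]
  | cons y l ih =>
    rw [List.cons_append, pairProd, ih, pairProd]
    simp only [List.map_append, List.map_cons, List.map_nil, List.prod_append, List.prod_cons,
      List.prod_nil, mul_one]
    ring

theorem pairProd_reverse (φ : ℂ → ℂ → ℂ) (l : List D) :
    pairProd φ l.reverse = pairProd (fun a b => φ b a) l := by
  induction l with
  | nil => rfl
  | cons x l ih =>
    rw [List.reverse_cons, pairProd_append_singleton, ih, pairProd, List.map_reverse,
      List.prod_reverse]

/-- Transposition reverses the factors. Writing the order-independent product backwards first
restores the original order, and only the arguments of φ are swapped; this explains the different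
normalisations of T_{j3} and T_{3k}. -/
theorem listProd_smul_dualMap {φ : ℂ → ℂ → ℂ} (κ : ℂ) {t : D → Module.End ℂ H}
    (ht : ExchangeSymm φ fun d => κ • (t d).dualMap) {l : List D} (hn : l.Nodup)
    (hφ : ∀ x ∈ l, ∀ y ∈ l, x ≠ y → φ x y ≠ 0) :
    listProd φ (fun d => κ • (t d).dualMap) l =
      κ ^ l.length • (listProd (fun a b => φ b a) t l).dualMap := by
  rw [listProd_perm ht l.reverse_perm.symm hn hφ, listProd, listProd, pairProd_reverse]
  have hl : ((l.reverse.map fun d => κ • (t d).dualMap)).prod =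
      κ ^ l.length • ((l.map t).prod).dualMap := by
    clear hn hφ
    induction l with
    | nil => simp; rfl
    | cons x l ih =>
      rw [List.reverse_cons, List.map_append, List.prod_append, ih, List.map_singleton,
        List.prod_singleton, smul_mul_smul_comm, List.length_cons, pow_succ, List.map_cons,
        List.prod_cons]
      rfl
  rw [hl, smul_comm, dualMap_smul]

theorem sort_map_nodup {n : ℕ} (x : Fin n ↪ D) (S : Finset (Fin n)) :
    ((S.sort (· ≤ ·)).map x).Nodup :=
  (Finset.sort_nodup S _).map x.injective

theorem opProd_dualT {c : ℂ} {T : Fin 3 → Fin 3 → D → Module.End ℂ H} (hT : IsMonodromy c T)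
    (i j : Fin 3) (hij : par i = par j) {n : ℕ} (x : Fin n ↪ D) (S : Finset (Fin n)) :
    opProd (dualT T i j) x S = kap i j ^ S.card • (opProd (T j i) x S).dualMap := by
  have := listProd_smul_dualMap (kap i j) (t := T j i)
    ((isMonodromy_dualT hT).exchangeSymm_even i j hij) (sort_map_nodup x S)
    fun _ _ _ _ _ => one_ne_zero
  rw [List.length_map, Finset.length_sort] at this
  rw [opProd_eq_listProd, opProd_eq_listProd]
  exact this

theorem opProdCol_dualT {c : ℂ} (hc : c ≠ 0) {T : Fin 3 → Fin 3 → D → Module.End ℂ H}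
    (hT : IsMonodromy c T) (i : Fin 3) (hi : par i = 0) {n : ℕ} {x : Fin n ↪ D}
    (hx : ∀ j k, j ≠ k → h c (x j) (x k) ≠ 0) (S : Finset (Fin n)) :
    opProdCol c (dualT T i 2) x S = Complex.I ^ S.card • (opProdRow c (T 2 i) x S).dualMap := by
  have hk : kap i 2 = Complex.I := by simp [kap, par, show (![0, 0, 1] : Fin 3 → ℕ) i = 0 from hi]
  have := listProd_smul_dualMap (kap i 2) (t := T 2 i)
    ((isMonodromy_dualT hT).exchangeSymm_odd hc i hi) (sort_map_nodup x S)
    fun d hd e he hde => by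
      obtain ⟨j, _, rfl⟩ := List.mem_map.1 hd
      obtain ⟨k, _, rfl⟩ := List.mem_map.1 he
      exact hx j k fun e => hde (e ▸ rfl)
  rw [List.length_map, Finset.length_sort, hk] at this
  rw [opProdCol_eq_listProd, opProdRow_eq_listProd, ← this, ← hk]
  rfl

/-- Both sides depend only on b modulo 4. -/
theorem I_pow_mul_neg_I_pow (b : ℕ) :
    (-Complex.I) ^ (b % 2) * Complex.I ^ b = (-1) ^ (b * (b - 1) / 2) := by
  obtain ⟨k, r, hr, rfl⟩ : ∃ k r, r < 4 ∧ b = 4 * k + r :=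
    ⟨b / 4, b % 4, Nat.mod_lt _ (by norm_num), (Nat.div_add_mod b 4).symm⟩
  have hI : Complex.I ^ (4 * k + r) = Complex.I ^ r := by
    rw [pow_add, pow_mul, Complex.I_pow_four, one_pow, one_mul]
  have hm : (4 * k + r) % 2 = r % 2 := by omega
  have hp : (-1 : ℂ) ^ ((4 * k + r) * (4 * k + r - 1) / 2) = (-1) ^ (r * (r - 1) / 2) := by
    rw [neg_one_pow_eq_pow_mod_two, neg_one_pow_eq_pow_mod_two (n := r * (r - 1) / 2)]
    congr 1
    rcases Nat.eq_zero_or_pos (4 * k + r) with h0 | h0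
    · rw [h0, show r = 0 by omega]
    · obtain ⟨m, hm⟩ := Nat.exists_eq_succ_of_ne_zero h0.ne'
      interval_cases r
      · obtain ⟨l, rfl⟩ := Nat.exists_eq_succ_of_ne_zero (show k ≠ 0 by omega)
        rw [show (4 * (l + 1) + 0) * (4 * (l + 1) + 0 - 1) =
          2 * (2 * ((l + 1) * (4 * l + 3))) by
          rw [show 4 * (l + 1) + 0 - 1 = 4 * l + 3 by omega]; ring]
        omega
      · rw [show (4 * k + 1) * (4 * k + 1 - 1) = 2 * (2 * (k * (4 * k + 1))) by
          rw [Nat.add_sub_cancel]; ring]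
        omega
      · rw [show (4 * k + 2) * (4 * k + 2 - 1) = 2 * (2 * (k * (4 * k + 3)) + 1) by
          rw [show 4 * k + 2 - 1 = 4 * k + 1 by omega]; ring]
        omega
      · rw [show (4 * k + 3) * (4 * k + 3 - 1) = 2 * (2 * (k * (4 * k + 5) + 1) + 1) by
          rw [show 4 * k + 3 - 1 = 4 * k + 2 by omega]; ring]
        omega
  rw [hI, hm, hp]
  interval_cases r
  · simp
  · simp
  · simp
  · norm_num [Complex.I_pow_three]

end

end GL21

/-! ### The four expansions -/

theorem mainTheorem4 (c : ℂ) (hc : c ≠ 0) (D : Set ℂ)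
    {H : Type*} [AddCommGroup H] [Module ℂ H]
    (T : Fin 3 → Fin 3 → D → Module.End ℂ H) (hT : GL21.IsMonodromy c T)
    (lam : Fin 3 → D → ℂ)
    (Ω : H) (hΩ : GL21.IsVacuum T lam Ω)
    (Ω' : Module.Dual ℂ H) (hΩ' : GL21.IsDualVacuum T lam Ω')
    (a b : ℕ) (u : Fin a → D) (v : Fin b → D)
    (hu : Function.Injective u) (hv : Function.Injective v) (huv : ∀ j k, u j ≠ v k)
    (hhu : ∀ j k, j ≠ k → GL21.h c (u j) (u k) ≠ 0)
    (hhv : ∀ j k, j ≠ k → GL21.h c (v j) (v k) ≠ 0)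
    (hhvu : ∀ j k, GL21.h c (v j) (u k) ≠ 0) :
    GL21.bethe c T Ω u v =
        ∑ p : GL21.Part a b,
          (GL21.fprod (GL21.g c) v p.V u p.U * GL21.fprod (GL21.f c) u p.Uᶜ u p.U *
            GL21.fprod (GL21.g c) v p.Vᶜ v p.V * GL21.fprod (GL21.f c) v p.V u p.Uᶜ *
            GL21.fprod (GL21.h c) u p.U u p.U * ∏ k ∈ p.V, lam 1 (v k)) •
          (GL21.opProd (T 0 1) u p.Uᶜ * GL21.opProdCol c (T 0 2) u p.U *
            GL21.opProdCol c (T 1 2) v p.Vᶜ) Ω ∧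
      GL21.bethe c T Ω u v =
        ∑ p : GL21.Part a b,
          (GL21.Kpart c u v p * GL21.fprod (GL21.f c) u p.U u p.Uᶜ *
            GL21.fprod (GL21.g c) v p.V v p.Vᶜ * GL21.fprod (GL21.f c) v p.Vᶜ u p.U *
            ∏ k ∈ p.U, lam 1 (u k)) •
          (GL21.opProdCol c (T 1 2) v p.Vᶜ * GL21.opProdCol c (T 0 2) v p.V *
            GL21.opProd (T 0 1) u p.Uᶜ) Ω ∧
      GL21.dualBethe c T hT Ω' u v =
        (-1 : ℂ) ^ (b * (b - 1) / 2) • ∑ p : GL21.Part a b,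
          (GL21.fprod (GL21.g c) v p.V u p.U * GL21.fprod (GL21.f c) u p.Uᶜ u p.U *
            GL21.fprod (GL21.g c) v p.Vᶜ v p.V * GL21.fprod (GL21.f c) v p.V u p.Uᶜ *
            GL21.fprod (GL21.h c) u p.U u p.U * ∏ k ∈ p.V, lam 1 (v k)) •
          (Ω' ∘ₗ (GL21.opProdRow c (T 2 1) v p.Vᶜ * GL21.opProdRow c (T 2 0) u p.U *
            GL21.opProd (T 1 0) u p.Uᶜ)) ∧
      GL21.dualBethe c T hT Ω' u v =
        (-1 : ℂ) ^ (b * (b - 1) / 2) • ∑ p : GL21.Part a b,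
          (GL21.Kpart c u v p * GL21.fprod (GL21.f c) u p.U u p.Uᶜ *
            GL21.fprod (GL21.g c) v p.V v p.Vᶜ * GL21.fprod (GL21.f c) v p.Vᶜ u p.U *
            ∏ k ∈ p.U, lam 1 (u k)) •
          (Ω' ∘ₗ (GL21.opProd (T 1 0) u p.Uᶜ * GL21.opProdRow c (T 2 0) v p.V *
            GL21.opProdRow c (T 2 1) v p.Vᶜ)) := by
  obtain ⟨u, rfl⟩ : ∃ u' : Fin a ↪ D, ⇑u' = u := ⟨⟨u, hu⟩, rfl⟩
  obtain ⟨v, rfl⟩ : ∃ v' : Fin b ↪ D, ⇑v' = v := ⟨⟨v, hv⟩, rfl⟩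
  have hT' := GL21.isMonodromy_dualT hT
  have hk : GL21.kap 0 1 = 1 := by simp [GL21.kap, GL21.par]
  -- Each odd factor of the transposed matrix carries one i, and ψ contributes (-i)^{b mod 2}; the
  -- total is independent of the partition.
  have hI : ∀ p : GL21.Part a b, (-Complex.I) ^ (b % 2) *
      (Complex.I ^ p.U.card * Complex.I ^ p.Vᶜ.card) = (-1) ^ (b * (b - 1) / 2) := fun p => by
    rw [← pow_add, GL21.card_add_card_compl, GL21.I_pow_mul_neg_I_pow]
  refine ⟨GL21.bethe_eq_sum_T12_T13_T23 hc hT hΩ hu hv huv hhu hhv,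
    GL21.bethe_eq_sum_T23_T13_T12 hc hT hΩ hu hv huv hhu hhv hhvu, ?_, ?_⟩
  · rw [GL21.dualBethe_eq_bethe,
      GL21.bethe_eq_sum_T12_T13_T23 hc hT' hΩ'.isVacuum_dualT hu hv huv hhu hhv,
      Finset.smul_sum, Finset.smul_sum]
    refine Finset.sum_congr rfl fun p _ => ?_
    rw [GL21.opProd_dualT hT 0 1 rfl, GL21.opProdCol_dualT hc hT 0 rfl hhu,
      GL21.opProdCol_dualT hc hT 1 rfl hhv, hk, one_pow, one_smul, ← hI p]
    simp only [mul_smul_comm, smul_mul_assoc, LinearMap.smul_apply, smul_smul]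
    rw [show ∀ x y z : Module.End ℂ H, (x.dualMap * y.dualMap * z.dualMap) Ω' =
      Ω' ∘ₗ (z * y * x) from fun _ _ _ => rfl]
    congr 1
    ring
  · rw [GL21.dualBethe_eq_bethe,
      GL21.bethe_eq_sum_T23_T13_T12 hc hT' hΩ'.isVacuum_dualT hu hv huv hhu hhv hhvu,
      Finset.smul_sum, Finset.smul_sum]
    refine Finset.sum_congr rfl fun p _ => ?_
    rw [GL21.opProd_dualT hT 0 1 rfl, GL21.opProdCol_dualT hc hT 0 rfl hhv,
      GL21.opProdCol_dualT hc hT 1 rfl hhv, hk, one_pow, one_smul, ← hI p,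
      -- Here the operators T₃₁ carry the parameters v̄_α, so their number appears as #v̄_α instead
      -- of #ū_α.
      ← show p.V.card = p.U.card from p.2]
    simp only [mul_smul_comm, smul_mul_assoc, LinearMap.smul_apply, smul_smul]
    rw [show ∀ x y z : Module.End ℂ H, (x.dualMap * y.dualMap * z.dualMap) Ω' =
      Ω' ∘ₗ (z * y * x) from fun _ _ _ => rfl]
    congr 1
    ring
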